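/- Let $I$ be a finite set and let $A=(a_{ij})_{i,j\in I}$ be an indecomposable symmetrizable generalized Cartan matrix: $a_{ii}=2$, $a_{ij}\in\mathbb{Z}_{\le 0}$ for $i\ne j$, there are $d_i\in\mathbb{Q}_{>0}$ with $d_ia_{ij}=d_ja_{ji}$, and for every nonempty proper subset $S\subset I$ there are $i\in S$, $j\in I\setminus S$ with $a_{ij}\neq 0$. Let $\mathfrak g$ be the derived Kac–Moody algebra of $A$, i.e. the complex Lie algebra with generators $e_i,f_i,h_i$ ($i\in I$) and relations $[h_i,h_j]=0$, $[h_i,e_j]=a_{ij}e_j$, $[h_i,f_j]=-a_{ij}f_j$, $[e_i,f_j]=\delta_{ij}h_i$, and $\mathrm{ad}(e_i)^{1-a_{ij}}(e_j)=\mathrm{ad}(f_i)^{1-a_{ij}}(f_j)=0$ for $i\neq j$; let $\mathfrak h=\sum_i\mathbb{C}h_i$. Let $Q=\bigoplus_{i}\mathbb{Z}\alpha_i$ be the root lattice, on which the simple reflections act by $r_i(\alpha_j)=\alpha_j-a_{ij}\alpha_i$. Let $X\subseteq I$ be such that $A_X=(a_{ij})_{i,j\in X}$ is of finite type (all principal minors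 are positive), let $w_X$ be the longest element of $W_X=\langle r_i\rangle_{i\in X}$, and let $\tau$ be a permutation of $I$ with $\tau^2=\mathrm{id}$, $a_{\tau(i)\tau(j)}=a_{ij}$ for all $i,j\in I$, and $-w_X(\alpha_i)=\alpha_{\tau(i)}$ for all $i\in X$. Put $\theta=\mathrm{Ad}(m_{w_X})\,\tau\,\omega$, where $\omega(e_i)=-f_i$, $\omega(f_i)=-e_i$, $\omega(h_i)=-h_i$; $\tau$ acts on $\mathfrak g$ by permuting the indices of the generators; and, for a reduced expression $w_X=r_{i_1}\cdots r_{i_\ell}$, $\mathrm{Ad}(m_{w_X})=\mathrm{Ad}(m_{i_1})\cdots\mathrm{Ad}(m_{i_\ell})$ with $\mathrm{Ad}(m_i)=\exp(\mathrm{ad}\,e_i)\exp(-\mathrm{ad}\,f_i)\exp(\mathrm{ad}\,e_i)$. On $Q$ put $\theta=-w_X\tau$, where $\tau(\alpha_i)=\alpha_{\tau(i)}$. Assume that $(X,\tau)$ is a generalized Satake diagram, that is, for all $i\in X$ and $j\in I\setminus X$, $$\theta(\alpha_j)=-(\alpha_i+\alpha_j)\ \Longrightarrow\ a_{ji}\neq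 -1 .$$ For $j\in I\setminus X$ let $X(j)$ be the smallest subset $Y\subseteq X$ that contains all $i\in X$ with $a_{ij}\ne0$ and satisfies $a_{ik}=0$ for all $i\in Y$, $k\in X\setminus Y$. Let $\boldsymbol c\in(\mathbb{C}^\times)^{I\setminus X}$ satisfy, for all $j\in I\setminus X$, $$a_{j,\tau(j)}=0\ \text{ and }\ X(j)=\emptyset\ \Longrightarrow\ c_j=c_{\tau(j)} .$$ Let $\mathfrak h^\theta=\{x\in\mathfrak h\mid\theta(x)=x\}$, let $\mathfrak n_X^+$ be the Lie subalgebra generated by the $e_i$ with $i\in X$, let $g_i=f_i$ for $i\in X$ and $g_i=f_i+c_i\theta(f_i)$ for $i\in I\setminus X$, and let $\mathfrak k_{\boldsymbol c}$ be the Lie subalgebra of $\mathfrak g$ generated by $\mathfrak n_X^+$, $\mathfrak h^\theta$ and all $g_i$, $i\in I$. Then $$\mathfrak k_{\boldsymbol c}\cap\mathfrak h=\mathfrak h^\theta .$$ -/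

import Mathlib

noncomputable section

namespace KacMoody

open CartanMatrix

variable {I : Type*} [DecidableEq I]

/-! ### Symmetrizable generalized Cartan matrices and Dynkin diagram notions -/

/-- `A` is an indecomposable symmetrizable generalized Cartan matrix. -/
structure IsIndecSymmGCM (A : Matrix I I ℤ) : Prop where
  diag : ∀ i, A i i = 2
  offDiag : ∀ i j, i ≠ j → A i j ≤ 0
  symmetrizable : ∃ d : I → ℚ, (∀ i, 0 < d i) ∧ ∀ i j, d i * (A i j : ℚ) = d j * (A j i : ℚ)
  indecomposable : ∀ S : Set I, S.Nonempty → S ≠ Set.univ → ∃ i ∈ S, ∃ j ∉ S, A i j ≠ 0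

/-- The submatrix `A_X` is of finite type: all its principal minors are positive. -/
def IsFiniteType (A : Matrix I I ℤ) (X : Finset I) : Prop :=
  ∀ Y : Finset I, Y ⊆ X →
    0 < (A.submatrix (fun i : {i // i ∈ Y} => (i : I)) (fun i : {i // i ∈ Y} => (i : I))).det

/-- `τ` is a diagram automorphism of `A`. -/
def IsDiagramAut (A : Matrix I I ℤ) (τ : Equiv.Perm I) : Prop :=
  ∀ i j, A (τ i) (τ j) = A i j

/-- `Y` is a (possibly empty, possibly disconnected) component of `X`. -/
def IsComponent (A : Matrix I I ℤ) (X : Finset I) (Y : Set I) : Prop :=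
  Y ⊆ (X : Set I) ∧ ∀ i ∈ Y, ∀ j ∈ X, j ∉ Y → A i j = 0

/-- `X(j)`: the smallest component of `X` containing all `i ∈ X` with `a_{ij} ≠ 0`. -/
def adjComponent (A : Matrix I I ℤ) (X : Finset I) (j : I) : Set I :=
  {i | ∀ Y : Set I, IsComponent A X Y → (∀ k ∈ X, A k j ≠ 0 → k ∈ Y) → i ∈ Y}

/-! ### Root lattice and Weyl group

The root lattice `Q` is the free abelian group `I → ℤ` on the simple roots (`I` is finite in all
uses). -/

/-- The simple root `α_i`. -/
def simpleRoot (i : I) : I → ℤ := Pi.single i 1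

/-- The simple reflection `r_i` on the root lattice, `r_i(α_j) = α_j - a_{ij} α_i`. -/
def reflection [Fintype I] (A : Matrix I I ℤ) (i : I) (v : I → ℤ) : I → ℤ :=
  v - (∑ j, A i j * v j) • simpleRoot i

/-- The Weyl group element `r_{i₁} r_{i₂} ⋯ r_{iₗ}` acting on the root lattice. -/
def weylAct [Fintype I] (A : Matrix I I ℤ) : List I → (I → ℤ) → (I → ℤ)
  | [] => id
  | i :: l => reflection A i ∘ weylAct A l

/-- `l` is a reduced word in the generators `r_i`, `i ∈ X`, of the parabolic subgroup `W_X`. -/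
def IsReducedWord [Fintype I] (A : Matrix I I ℤ) (X : Finset I) (l : List I) : Prop :=
  (∀ i ∈ l, i ∈ X) ∧
    ∀ l' : List I, (∀ i ∈ l', i ∈ X) → weylAct A l' = weylAct A l → l.length ≤ l'.length

/-- `l` is a reduced word for the longest element `w_X` of `W_X`. -/
def IsLongestWord [Fintype I] (A : Matrix I I ℤ) (X : Finset I) (l : List I) : Prop :=
  IsReducedWord A X l ∧ ∀ l' : List I, IsReducedWord A X l' → l'.length ≤ l.length

/-- The induced action of a diagram automorphism on the root lattice, `τ(α_i) = α_{τ(i)}`. -/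
def permAct (τ : Equiv.Perm I) (v : I → ℤ) : I → ℤ := fun i => v (τ.symm i)

/-- `θ = - w_X τ` on the root lattice, for a word `l` representing `w_X`. -/
def thetaRoot [Fintype I] (A : Matrix I I ℤ) (τ : Equiv.Perm I) (l : List I) (v : I → ℤ) : I → ℤ :=
  -weylAct A l (permAct τ v)

/-- `(X, τ)` is a generalized Satake diagram associated to `A`. The conditions `compat` and
`satake` only depend on the longest element `w_X`, which exists and is unique as `A_X` is of
finite type; they are imposed for every reduced word of `w_X`. -/
structure IsGenSatake [Fintype I] (A : Matrix I I ℤ) (X : Finset I) (τ : Equiv.Perm I) : Prop where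
  finiteType : IsFiniteType A X
  diagramAut : IsDiagramAut A τ
  invol : ∀ i, τ (τ i) = i
  compat : ∀ l, IsLongestWord A X l → ∀ i ∈ X, -weylAct A l (simpleRoot i) = simpleRoot (τ i)
  satake : ∀ l, IsLongestWord A X l → ∀ i ∈ X, ∀ j ∉ X,
    thetaRoot A τ l (simpleRoot j) = -(simpleRoot i + simpleRoot j) → A j i ≠ -1

/-! ### The derived Kac-Moody algebra

Mathlib's `Matrix.ToLieAlgebra ℂ A` is the complex Lie algebra with generators `e_i, f_i, h_i` and
relations `[h_i,h_j] = 0`, `[h_i,e_j] = a_{ij} e_j`, `[h_i,f_j] = -a_{ij} f_j`,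
`[e_i,f_j] = δ_{ij} h_i` and the Serre relations. -/

/-- The derived Kac-Moody Lie algebra of `A`. -/
abbrev Alg (A : Matrix I I ℤ) := Matrix.ToLieAlgebra ℂ A

/-- The Serre-type defining relations, for families `e, f, h` in a complex Lie algebra. -/
structure Rels {L : Type*} [LieRing L] [LieAlgebra ℂ L] (A : Matrix I I ℤ) (e f h : I → L) :
    Prop where
  hh : ∀ i j, ⁅h i, h j⁆ = 0
  ef_same : ∀ i, ⁅e i, f i⁆ = h i
  ef_ne : ∀ i j, i ≠ j → ⁅e i, f j⁆ = 0
  he : ∀ i j, ⁅h i, e j⁆ = A i j • e j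
  hf : ∀ i j, ⁅h i, f j⁆ = -(A i j • f j)
  serre_e : ∀ i j, ((LieAlgebra.ad ℂ L (e i)) ^ (-A i j).toNat) ⁅e i, e j⁆ = 0
  serre_f : ∀ i j, ((LieAlgebra.ad ℂ L (f i)) ^ (-A i j).toNat) ⁅f i, f j⁆ = 0

/-- The quotient map from the free Lie algebra on the generators. -/
def proj (A : Matrix I I ℤ) : FreeLieAlgebra ℂ (Generators I) →ₗ⁅ℂ⁆ Alg A :=
  { (Relations.toIdeal ℂ A).toSubmodule.mkQ with
    map_lie' := fun {_ _} => rfl }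

/-- The Chevalley generator `e_i`. -/
def e (A : Matrix I I ℤ) (i : I) : Alg A := proj A (FreeLieAlgebra.of ℂ (Generators.E i))

/-- The Chevalley generator `f_i`. -/
def f (A : Matrix I I ℤ) (i : I) : Alg A := proj A (FreeLieAlgebra.of ℂ (Generators.F i))

/-- The Chevalley generator `h_i`. -/
def h (A : Matrix I I ℤ) (i : I) : Alg A := proj A (FreeLieAlgebra.of ℂ (Generators.H i))

theorem map_ad_pow {L L' : Type*} [LieRing L] [LieAlgebra ℂ L] [LieRing L'] [LieAlgebra ℂ L']
    (φ : L →ₗ⁅ℂ⁆ L') (x y : L) (n : ℕ) :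
    φ (((LieAlgebra.ad ℂ L x) ^ n) y) = ((LieAlgebra.ad ℂ L' (φ x)) ^ n) (φ y) := by
  induction n with
  | zero => simp
  | succ n ih => rw [pow_succ', pow_succ', Module.End.mul_apply, Module.End.mul_apply,
      LieAlgebra.ad_apply, LieAlgebra.ad_apply, LieHom.map_lie, ih]

theorem ad_neg_pow {L : Type*} [LieRing L] [LieAlgebra ℂ L] (x y : L) (n : ℕ)
    (hxy : ((LieAlgebra.ad ℂ L x) ^ n) y = 0) : ((LieAlgebra.ad ℂ L (-x)) ^ n) y = 0 := by
  rw [map_neg, neg_pow, Module.End.mul_apply, hxy, map_zero]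

theorem proj_eq_zero (A : Matrix I I ℤ) {x : FreeLieAlgebra ℂ (Generators I)}
    (hx : x ∈ Relations.toSet ℂ A) : proj A x = 0 :=
  (Submodule.Quotient.mk_eq_zero _).2 (LieSubmodule.subset_lieSpan hx)

/-- The generators satisfy the defining relations. -/
theorem rels (A : Matrix I I ℤ) : Rels A (e A) (f A) (h A) where
  hh i j := by
    have := proj_eq_zero A (x := Relations.HH ℂ (i, j)) (by simp [Relations.toSet])
    simpa [e, f, h, Relations.HH] using this
  ef_same i := by
    have := proj_eq_zero A (x := Relations.EF ℂ (i, i)) (by simp [Relations.toSet])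
    simpa [e, f, h, Relations.EF, sub_eq_zero] using this
  ef_ne i j hij := by
    have := proj_eq_zero A (x := Relations.EF ℂ (i, j)) (by simp [Relations.toSet])
    simpa [e, f, h, Relations.EF, hij] using this
  he i j := by
    have := proj_eq_zero A (x := Relations.HE ℂ A (i, j)) (by simp [Relations.toSet])
    simpa [e, f, h, Relations.HE, sub_eq_zero] using this
  hf i j := by
    have := proj_eq_zero A (x := Relations.HF ℂ A (i, j)) (by simp [Relations.toSet])
    simpa [e, f, h, Relations.HF, add_eq_zero_iff_eq_neg] using this
  serre_e i j := by
    have := proj_eq_zero A (x := Relations.adE ℂ A (i, j)) (by simp [Relations.toSet])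
    simpa [e, f, h, Relations.adE, map_ad_pow] using this
  serre_f i j := by
    have := proj_eq_zero A (x := Relations.adF ℂ A (i, j)) (by simp [Relations.toSet])
    simpa [e, f, h, Relations.adF, map_ad_pow] using this

section Lift

variable {L : Type*} [LieRing L] [LieAlgebra ℂ L]

/-- Images of the free generators. -/
def genMap (e' f' h' : I → L) : Generators I → L
  | .H i => h' i
  | .E i => e' i
  | .F i => f' i

theorem toIdeal_le_ker {A : Matrix I I ℤ} {e' f' h' : I → L} (H : Rels A e' f' h') :
    Relations.toIdeal ℂ A ≤ (FreeLieAlgebra.lift ℂ (genMap e' f' h')).ker := by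
  refine LieSubmodule.lieSpan_le.2 ?_
  rintro x (((((⟨⟨i, j⟩, rfl⟩ | ⟨⟨i, j⟩, rfl⟩) | ⟨⟨i, j⟩, rfl⟩) | ⟨⟨i, j⟩, rfl⟩) |
    ⟨⟨i, j⟩, rfl⟩) | ⟨⟨i, j⟩, rfl⟩)
  · simp [Relations.HH, genMap, H.hh]
  · by_cases hij : i = j
    · subst hij
      simp [Relations.EF, genMap, H.ef_same]
    · simp [Relations.EF, genMap, hij, H.ef_ne]
  · simp [Relations.HE, genMap, H.he]
  · simp [Relations.HF, genMap, H.hf]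
  · simp [Relations.adE, genMap, map_ad_pow, H.serre_e]
  · simp [Relations.adF, genMap, map_ad_pow, H.serre_f]

/-- The Lie algebra homomorphism out of the Kac-Moody algebra given by images of the generators
that satisfy the defining relations. -/
def lift {A : Matrix I I ℤ} {e' f' h' : I → L} (H : Rels A e' f' h') : Alg A →ₗ⁅ℂ⁆ L :=
  { (Relations.toIdeal ℂ A).toSubmodule.liftQ
      (FreeLieAlgebra.lift ℂ (genMap e' f' h') : FreeLieAlgebra ℂ (Generators I) →ₗ[ℂ] L)
      (fun _ hx => toIdeal_le_ker H hx) with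
    map_lie' := fun {x y} => by
      induction x using Submodule.Quotient.induction_on with | _ x => ?_
      induction y using Submodule.Quotient.induction_on with | _ y => ?_
      exact LieHom.map_lie (FreeLieAlgebra.lift ℂ (genMap e' f' h')) x y }

end Lift

/-- The automorphism of the Kac-Moody algebra induced by a diagram automorphism:
`e_i ↦ e_{τ(i)}`, `f_i ↦ f_{τ(i)}`, `h_i ↦ h_{τ(i)}`. -/
def diagramHom {A : Matrix I I ℤ} {τ : Equiv.Perm I} (hτ : IsDiagramAut A τ) :
    Alg A →ₗ⁅ℂ⁆ Alg A :=
  lift (A := A) (e' := fun i => e A (τ i)) (f' := fun i => f A (τ i)) (h' := fun i => h A (τ i))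
    { hh := fun _ _ => (rels A).hh _ _
      ef_same := fun _ => (rels A).ef_same _
      ef_ne := fun _ _ hij => (rels A).ef_ne _ _ (fun hh => hij (τ.injective hh))
      he := fun i j => by rw [(rels A).he, hτ]
      hf := fun i j => by rw [(rels A).hf, hτ]
      serre_e := fun i j => by rw [← hτ i j]; exact (rels A).serre_e _ _
      serre_f := fun i j => by rw [← hτ i j]; exact (rels A).serre_f _ _ }

/-- The Chevalley involution `ω`: `e_i ↦ -f_i`, `f_i ↦ -e_i`, `h_i ↦ -h_i`. -/
def chevalley (A : Matrix I I ℤ) : Alg A →ₗ⁅ℂ⁆ Alg A :=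
  lift (A := A) (e' := fun i => -f A i) (f' := fun i => -e A i) (h' := fun i => -h A i)
    { hh := fun _ _ => by simp [(rels A).hh]
      ef_same := fun i => by
        rw [neg_lie, lie_neg, neg_neg, ← lie_skew, (rels A).ef_same]
      ef_ne := fun i j hij => by
        rw [neg_lie, lie_neg, neg_neg, ← lie_skew, (rels A).ef_ne j i (Ne.symm hij), neg_zero]
      he := fun i j => by simp [(rels A).hf]
      hf := fun i j => by simp [(rels A).he]
      serre_e := fun i j => by
        refine ad_neg_pow _ _ _ ?_
        rw [neg_lie, lie_neg, neg_neg]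
        exact (rels A).serre_f i j
      serre_f := fun i j => by
        refine ad_neg_pow _ _ _ ?_
        rw [neg_lie, lie_neg, neg_neg]
        exact (rels A).serre_e i j }

/-! ### The automorphism `θ` and the subalgebra `k_c` -/

/-- `exp(ad x)(y) = ∑ₙ ad(x)ⁿ(y) / n!`, for `x` acting locally nilpotently (so that the sum is
finite). -/
def expAd {A : Matrix I I ℤ} (x y : Alg A) : Alg A :=
  ∑ᶠ n : ℕ, ((n.factorial : ℂ)⁻¹) • (((LieAlgebra.ad ℂ (Alg A) x) ^ n) y)

/-- `Ad(m_i) = exp(ad e_i) exp(ad(-f_i)) exp(ad e_i)`. -/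
def AdM (A : Matrix I I ℤ) (i : I) (y : Alg A) : Alg A :=
  expAd (e A i) (expAd (-f A i) (expAd (e A i) y))

/-- `Ad(m_{i₁} m_{i₂} ⋯ m_{iₗ})`. For a reduced word this only depends on the Weyl group element
represented by the word, because the `m_i` satisfy the braid relations. -/
def AdWord (A : Matrix I I ℤ) : List I → Alg A → Alg A
  | [] => id
  | i :: l => AdM A i ∘ AdWord A l

/-- `θ = Ad(m_{w_X}) τ ω`, where `l` is a reduced word for `w_X`. -/
def theta {A : Matrix I I ℤ} {τ : Equiv.Perm I} (hτ : IsDiagramAut A τ) (l : List I)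
    (y : Alg A) : Alg A :=
  AdWord A l (diagramHom hτ (chevalley A y))

/-- The Cartan subalgebra `𝔥`, spanned by the `h_i`. -/
def cartan (A : Matrix I I ℤ) : Submodule ℂ (Alg A) := Submodule.span ℂ (Set.range (h A))

/-- `𝔥^θ`, the fixed points of `θ` in `𝔥`. -/
def cartanFixed {A : Matrix I I ℤ} {τ : Equiv.Perm I} (hτ : IsDiagramAut A τ) (l : List I) :
    Set (Alg A) :=
  {x | x ∈ cartan A ∧ theta hτ l x = x}

/-- `𝔫⁺_X`, the Lie subalgebra generated by the `e_i`, `i ∈ X`. -/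
def nPlus (A : Matrix I I ℤ) (X : Finset I) : LieSubalgebra ℂ (Alg A) :=
  LieSubalgebra.lieSpan ℂ (Alg A) (e A '' (X : Set I))

/-- `g_i = f_i` for `i ∈ X` and `g_i = f_i + c_i θ(f_i)` otherwise. -/
def g {A : Matrix I I ℤ} {τ : Equiv.Perm I} (hτ : IsDiagramAut A τ) (l : List I) (X : Finset I)
    (c : {i // i ∉ X} → ℂˣ) (i : I) : Alg A :=
  if hi : i ∈ X then f A i else f A i + (c ⟨i, hi⟩ : ℂ) • theta hτ l (f A i)

/-- The Lie subalgebra `𝔨_c` generated by `𝔫⁺_X`, `𝔥^θ` and all `g_i`. -/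
def kc {A : Matrix I I ℤ} {τ : Equiv.Perm I} (hτ : IsDiagramAut A τ) (l : List I) (X : Finset I)
    (c : {i // i ∉ X} → ℂˣ) : LieSubalgebra ℂ (Alg A) :=
  LieSubalgebra.lieSpan ℂ (Alg A)
    ((nPlus A X : Set (Alg A)) ∪ cartanFixed hτ l ∪ Set.range (g hτ l X c))

end KacMoody

end

/-! Filter `𝔨_c` by word length in the `g_i`: `filt m` is `𝔫_X⁺ + 𝔥^θ` plus the span of the
right-normed brackets of at most `m` letters. Brackets add degrees and every element of `𝔨_c` has
some degree (`filt_lie_filt`, `mem_filt_of_mem_kc`). Since `g_i` is `f_i` plus a term of positive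
height, a bracket of `m` letters `g_i` equals the same bracket of the `f_i`, of height `-m`, plus
terms of larger height (`brWord_gen_sub`). An element of `𝔥` has height 0, so if it lies in `filt
(m+1)`, its longest words form a linear relation between brackets of the `f_i`. If every such
relation holds for the `g_i` modulo shorter words, the degree drops step by step to 0
(`mem_base_of_mem_filt`), and then `𝔥 ∩ (𝔫_X⁺ + 𝔥^θ) = 𝔥^θ` by height.

It suffices to know this for the Serre relations (`sum_brWord_mem_of_serre`), because they generate
all relations between the `f_i`. To see the latter, `𝔤` is made to act on the free associative
algebra in the `f_i` modulo the Serre ideal, and a relation is evaluated at 1. Dynkin's bracketing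
operator, which multiplies Lie polynomials of degree `m` by `m`, carries the result over to the
`g_i`.

There remains `SerreLower`: `ad(g_i)^{1-a_ij}(g_j)` is a combination of shorter words. For `i ∈ X`
it is zero. Otherwise split it into weight components in `f_i` and `θ(f_i)`. Write `w_X(α_j) = α_j +
γ_j`, with `γ_j ≥ 0` supported on `X`. Most weights that occur have coefficients of both signs or
are proper multiples of simple roots, possibly only after applying `w_X⁻¹`, so the components
vanish. The survivors are treated by hand. The generalized Satake condition rules out a component of
weight 0 when `τ(i) = i` and `j ∈ X`. The condition on `c` makes `[g_i, g_j]` fixed by `θ` when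
`τ(i) = j`, `a_ij = 0` and `i`, `j` are not joined to `X`. -/

noncomputable section

set_option linter.unusedSectionVars false

namespace KacMoody

open CartanMatrix

variable {I : Type*} [DecidableEq I]

/-! ### Generation and local nilpotency -/

section Lift

variable {L : Type*} [LieRing L] [LieAlgebra ℂ L] {A : Matrix I I ℤ} {e' f' h' : I → L}

@[simp] theorem lift_e (H : Rels A e' f' h') (i : I) : lift H (e A i) = e' i :=
  FreeLieAlgebra.lift_of_apply (genMap e' f' h') (Generators.E i)

@[simp] theorem lift_f (H : Rels A e' f' h') (i : I) : lift H (f A i) = f' i :=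
  FreeLieAlgebra.lift_of_apply (genMap e' f' h') (Generators.F i)

@[simp] theorem lift_h (H : Rels A e' f' h') (i : I) : lift H (h A i) = h' i :=
  FreeLieAlgebra.lift_of_apply (genMap e' f' h') (Generators.H i)

end Lift

variable {A : Matrix I I ℤ}

/-- The `h_i` come along as `[e_i, f_i]`, so the projection from the free Lie algebra factors
through `S`. -/
theorem lieSubalgebra_eq_top (S : LieSubalgebra ℂ (Alg A)) (he : ∀ i, e A i ∈ S)
    (hf : ∀ i, f A i ∈ S) : S = ⊤ := by
  have hh : ∀ i, h A i ∈ S := fun i => by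
    rw [← (rels A).ef_same]; exact S.lie_mem (he i) (hf i)
  let ψ : FreeLieAlgebra ℂ (Generators I) →ₗ⁅ℂ⁆ S :=
    FreeLieAlgebra.lift ℂ (genMap (fun i => ⟨e A i, he i⟩) (fun i => ⟨f A i, hf i⟩)
      (fun i => ⟨h A i, hh i⟩))
  have hψ : S.incl.comp ψ = proj A := by
    apply FreeLieAlgebra.hom_ext
    rintro (i | i | i) <;>
      simp only [LieHom.comp_apply, ψ, FreeLieAlgebra.lift_of_apply, genMap] <;> rfl
  refine eq_top_iff.2 fun x _ => ?_
  obtain ⟨y, rfl⟩ : ∃ y, proj A y = x := Submodule.Quotient.mk_surjective _ x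
  rw [← hψ]
  exact (ψ y).2

theorem hom_eq_of_eq_on_gen {L : Type*} [LieRing L] [LieAlgebra ℂ L] {φ ψ : Alg A →ₗ⁅ℂ⁆ L}
    (he : ∀ i, φ (e A i) = ψ (e A i)) (hf : ∀ i, φ (f A i) = ψ (f A i)) : φ = ψ := by
  let S : LieSubalgebra ℂ (Alg A) :=
    { LinearMap.eqLocus (φ : Alg A →ₗ[ℂ] L) (ψ : Alg A →ₗ[ℂ] L) with
      lie_mem' := fun {x y} hx hy => by
        change φ ⁅x, y⁆ = ψ ⁅x, y⁆
        rw [LieHom.map_lie, LieHom.map_lie, show φ x = ψ x from hx, show φ y = ψ y from hy] }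
  ext x
  have : x ∈ S := by rw [lieSubalgebra_eq_top S he hf]; trivial
  exact this

/-- `x` acts locally nilpotently on the Kac-Moody algebra. -/
def AdLocNil (x : Alg A) : Prop := ∀ y : Alg A, ∃ n : ℕ, ((LieAlgebra.ad ℂ (Alg A) x) ^ n) y = 0

/-- The vectors killed by some power of `ad e_i` form a subalgebra (Engel), so generators suffice:
the Serre relation handles `e_j`, and `f_i` dies after three steps through `h_i` and `e_i`. -/
theorem adLocNil_e (A : Matrix I I ℤ) (i : I) : AdLocNil (e A i) := by
  have key : LieSubalgebra.engel ℂ (e A i) = ⊤ := by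
    refine lieSubalgebra_eq_top _ (fun j => ?_) (fun j => ?_)
    · rw [LieSubalgebra.mem_engel_iff]
      exact ⟨(-A i j).toNat + 1, by rw [pow_succ]; exact (rels A).serre_e i j⟩
    · rw [LieSubalgebra.mem_engel_iff]
      refine ⟨3, ?_⟩
      by_cases hij : i = j
      · subst hij
        simp only [pow_succ, pow_zero, one_mul, Module.End.mul_apply, LieAlgebra.ad_apply,
          (rels A).ef_same]
        rw [← lie_skew (e A i) (h A i), (rels A).he, lie_neg, lie_zsmul, lie_self]
        simp
      · simp [pow_succ, (rels A).ef_ne i j hij]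
  intro y
  rw [← LieSubalgebra.mem_engel_iff, key]
  trivial

theorem adLocNil_f (A : Matrix I I ℤ) (i : I) : AdLocNil (f A i) := by
  have key : LieSubalgebra.engel ℂ (f A i) = ⊤ := by
    refine lieSubalgebra_eq_top _ (fun j => ?_) (fun j => ?_)
    · rw [LieSubalgebra.mem_engel_iff]
      refine ⟨3, ?_⟩
      by_cases hij : i = j
      · subst hij
        simp only [pow_succ, pow_zero, one_mul, Module.End.mul_apply, LieAlgebra.ad_apply]
        rw [← lie_skew (f A i) (e A i), (rels A).ef_same, lie_neg, ← lie_skew (f A i) (h A i),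
          (rels A).hf]
        simp
      · simp [pow_succ, ← lie_skew (f A i) (e A j), (rels A).ef_ne j i (Ne.symm hij)]
    · rw [LieSubalgebra.mem_engel_iff]
      exact ⟨(-A i j).toNat + 1, by rw [pow_succ]; exact (rels A).serre_f i j⟩
  intro y
  rw [← LieSubalgebra.mem_engel_iff, key]
  trivial

theorem AdLocNil.neg {x : Alg A} (hx : AdLocNil x) : AdLocNil (-x) := fun y =>
  (hx y).imp fun n hn => ad_neg_pow x y n hn

/-! ### Exponentials of locally nilpotent elements -/

theorem expAd_eq_sum {x y : Alg A} {N : ℕ} (hN : ((LieAlgebra.ad ℂ (Alg A) x) ^ N) y = 0) :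
    expAd x y = ∑ n ∈ Finset.range N,
      ((n.factorial : ℂ)⁻¹) • (((LieAlgebra.ad ℂ (Alg A) x) ^ n) y) := by
  refine finsum_eq_sum_of_support_subset _ fun n hn => ?_
  rw [Finset.coe_range, Set.mem_Iio]
  by_contra h
  exact hn (by simp [Module.End.pow_map_zero_of_le (not_lt.1 h) hN])

theorem AdLocNil.exists_common {x : Alg A} (hx : AdLocNil x) (y z : Alg A) :
    ∃ n : ℕ, ((LieAlgebra.ad ℂ (Alg A) x) ^ n) y = 0 ∧
      ((LieAlgebra.ad ℂ (Alg A) x) ^ n) z = 0 := by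
  obtain ⟨n, hn⟩ := hx y
  obtain ⟨m, hm⟩ := hx z
  exact ⟨max n m, Module.End.pow_map_zero_of_le (le_max_left _ _) hn,
    Module.End.pow_map_zero_of_le (le_max_right _ _) hm⟩

/-- This is the Leibniz rule for `ad(x)ⁿ/n!`, summed as a Cauchy product. Beyond the common bound
`N` all terms vanish, so summing over the square `p₁, p₂ < N` or over the diagonals `p₁ + p₂ = n <
2N` gives the same value. -/
theorem expAd_lie {x : Alg A} (hx : AdLocNil x) (y z : Alg A) :
    expAd x ⁅y, z⁆ = ⁅expAd x y, expAd x z⁆ := by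
  obtain ⟨N, hy, hz⟩ := hx.exists_common y z
  have hyk : ∀ k, N ≤ k → ((LieAlgebra.ad ℂ (Alg A) x) ^ k) y = 0 :=
    fun k hk => Module.End.pow_map_zero_of_le hk hy
  have hzk : ∀ k, N ≤ k → ((LieAlgebra.ad ℂ (Alg A) x) ^ k) z = 0 :=
    fun k hk => Module.End.pow_map_zero_of_le hk hz
  have hyz : ((LieAlgebra.ad ℂ (Alg A) x) ^ (N + N)) ⁅y, z⁆ = 0 := by
    rw [LieAlgebra.ad_pow_lie]
    refine Finset.sum_eq_zero fun p hp => ?_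
    rw [Finset.HasAntidiagonal.mem_antidiagonal] at hp
    rcases (by omega : N ≤ p.1 ∨ N ≤ p.2) with h | h
    · simp [hyk _ h]
    · simp [hzk _ h]
  rw [expAd_eq_sum hy, expAd_eq_sum hz, expAd_eq_sum hyz, sum_lie]
  simp_rw [lie_sum]
  rw [← Finset.sum_product', ← Finset.sum_fiberwise_of_maps_to (t := Finset.range (N + N))
    (g := fun p : ℕ × ℕ => p.1 + p.2)
    (fun p hp => by simp only [Finset.mem_product, Finset.mem_range] at hp ⊢; omega)]
  refine Finset.sum_congr rfl fun n _ => ?_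
  rw [LieAlgebra.ad_pow_lie, Finset.smul_sum]
  symm
  refine (Finset.sum_subset (fun p hp => ?_) fun p hp hp' => ?_).trans
    (Finset.sum_congr rfl fun p hp => ?_)
  · simp only [Finset.mem_filter] at hp
    simpa using hp.2
  · simp only [Finset.mem_filter, Finset.mem_product, Finset.mem_range,
      Finset.HasAntidiagonal.mem_antidiagonal] at hp hp'
    rcases (by omega : N ≤ p.1 ∨ N ≤ p.2) with h | h
    · simp [hyk _ h]
    · simp [hzk _ h]
  · rw [Finset.HasAntidiagonal.mem_antidiagonal] at hp
    subst hp
    rw [smul_lie, lie_smul, ← Nat.cast_smul_eq_nsmul ℂ, smul_smul, smul_smul,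
      Nat.choose_symm_add, Nat.add_choose]
    congr 1
    have h1 : ((p.1 + p.2).factorial : ℂ) ≠ 0 := by exact_mod_cast Nat.factorial_ne_zero _
    rw [Nat.cast_div (Nat.factorial_mul_factorial_dvd_factorial_add _ _)
      (by exact_mod_cast mul_ne_zero (Nat.factorial_ne_zero _) (Nat.factorial_ne_zero _))]
    push_cast
    field_simp

/-- `exp(ad x)` as a homomorphism of Lie algebras, for `x` acting locally nilpotently. -/
def expHom {x : Alg A} (hx : AdLocNil x) : Alg A →ₗ⁅ℂ⁆ Alg A where
  toFun := expAd x
  map_add' y z := by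
    obtain ⟨N, hy, hz⟩ := hx.exists_common y z
    rw [expAd_eq_sum hy, expAd_eq_sum hz, expAd_eq_sum (N := N) (by rw [map_add, hy, hz, add_zero]),
      ← Finset.sum_add_distrib]
    exact Finset.sum_congr rfl fun n _ => by rw [map_add, smul_add]
  map_smul' c y := by
    obtain ⟨N, hy⟩ := hx y
    rw [expAd_eq_sum hy, expAd_eq_sum (N := N) (by rw [map_smul, hy, smul_zero]), Finset.smul_sum]
    exact Finset.sum_congr rfl fun n _ => by rw [map_smul, smul_comm, RingHom.id_apply]
  map_lie' {y z} := expAd_lie hx y z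

@[simp] theorem expHom_apply {x : Alg A} (hx : AdLocNil x) (y : Alg A) :
    expHom hx y = expAd x y := rfl

/-- If `N` is minimal with `ad(x)^N y = 0`, then `ad(x)^{N-1}` maps `exp(ad x) y` to `ad(x)^{N-1} y
≠ 0`. Injectivity is all that is needed later; no inverse is constructed. -/
theorem expHom_injective {x : Alg A} (hx : AdLocNil x) : Function.Injective (expHom hx) := by
  rw [injective_iff_map_eq_zero]
  intro y hy
  by_contra hne
  classical
  have hex := hx y
  let N := Nat.find hex
  have hN : ((LieAlgebra.ad ℂ (Alg A) x) ^ N) y = 0 := Nat.find_spec hex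
  have hpos : 0 < N := by
    rcases Nat.eq_zero_or_pos N with h | h
    · rw [h] at hN; exact absurd (by simpa using hN) hne
    · exact h
  have hlt : ((LieAlgebra.ad ℂ (Alg A) x) ^ (N - 1)) y ≠ 0 :=
    Nat.find_min hex (by omega : N - 1 < N)
  rw [expHom_apply, expAd_eq_sum hN] at hy
  have h2 := congrArg ((LieAlgebra.ad ℂ (Alg A) x) ^ (N - 1)) hy
  rw [map_zero, map_sum, Finset.sum_eq_single_of_mem 0 (Finset.mem_range.2 hpos)] at h2
  · exact hlt (by simpa using h2)
  · intro n _ hn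
    rw [map_smul, ← Module.End.mul_apply, ← pow_add,
      Module.End.pow_map_zero_of_le (by omega : N ≤ N - 1 + n) hN, smul_zero]

theorem expAd_eq_self {x y : Alg A} (hxy : ⁅x, y⁆ = 0) : expAd x y = y := by
  rw [expAd_eq_sum (N := 1) (by simpa using hxy)]
  simp

/-- A derivation scaling `x` by `μ`, conjugated by `exp(ad x)`. -/
theorem derivation_expAd {x : Alg A} (hx : AdLocNil x) (D : LieDerivation ℂ (Alg A) (Alg A))
    {μ : ℂ} (hD : D x = μ • x) (y : Alg A) :
    D (expAd x y) = expAd x (D y) + μ • ⁅x, expAd x y⁆ := by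
  have hpow : ∀ n : ℕ, D (((LieAlgebra.ad ℂ (Alg A) x) ^ n) y) =
      ((LieAlgebra.ad ℂ (Alg A) x) ^ n) (D y) +
        ((n : ℂ) * μ) • ((LieAlgebra.ad ℂ (Alg A) x) ^ n) y := by
    intro n
    induction n with
    | zero => simp
    | succ n ih =>
      rw [pow_succ', Module.End.mul_apply, Module.End.mul_apply, LieAlgebra.ad_apply,
        LieAlgebra.ad_apply, LieDerivation.apply_lie_eq_add, ih, hD, lie_add, lie_smul, smul_lie]
      push_cast
      module
  obtain ⟨N, hy, hz⟩ := hx.exists_common y (D y)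
  have hy' := Module.End.pow_map_zero_of_le (Nat.le_succ N) hy
  rw [expAd_eq_sum hz, expAd_eq_sum hy', map_sum]
  simp_rw [map_smul, hpow, smul_add, Finset.sum_add_distrib]
  congr 1
  · rw [Finset.sum_range_succ, hz, smul_zero, add_zero]
  -- Since `n/n! = 1/(n-1)!`, the factor `nμ` shifts the series by one index. The term at 0 drops
  -- out on one side, the term at `N` on the other.
  · rw [Finset.sum_range_succ', Finset.sum_range_succ (n := N), lie_add, lie_sum]
    simp only [lie_smul, hy, lie_zero, smul_zero, add_zero, Nat.cast_zero, zero_mul, zero_smul,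
      Finset.smul_sum]
    refine Finset.sum_congr rfl fun n _ => ?_
    rw [pow_succ', Module.End.mul_apply, LieAlgebra.ad_apply, smul_smul, smul_smul]
    congr 1
    have h1 : (n.factorial : ℂ) ≠ 0 := by exact_mod_cast Nat.factorial_ne_zero _
    have h2 : ((n : ℂ) + 1) ≠ 0 := by exact_mod_cast Nat.succ_ne_zero n
    rw [Nat.factorial_succ]
    push_cast
    field_simp

end KacMoody

namespace KacMoody

open CartanMatrix

variable {I : Type*} [DecidableEq I]

/-! ### Degree derivations -/

/-- The Lie algebra `L ⊗ ℂ[ε]` over the dual numbers, `ε² = 0`. -/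
def DualExt (L : Type*) := L × L

namespace DualExt

variable {L : Type*} [LieRing L] [LieAlgebra ℂ L]

instance : AddCommGroup (DualExt L) := inferInstanceAs (AddCommGroup (L × L))

instance : Module ℂ (DualExt L) := inferInstanceAs (Module ℂ (L × L))

instance : Bracket (DualExt L) (DualExt L) :=
  ⟨fun x y => (⁅x.1, y.1⁆, ⁅x.1, y.2⁆ + ⁅x.2, y.1⁆)⟩

theorem ext {x y : DualExt L} (h1 : x.1 = y.1) (h2 : x.2 = y.2) : x = y := Prod.ext h1 h2

@[simp] theorem lie_fst (x y : DualExt L) : (⁅x, y⁆ : DualExt L).1 = ⁅x.1, y.1⁆ := rfl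
@[simp] theorem lie_snd (x y : DualExt L) :
    (⁅x, y⁆ : DualExt L).2 = ⁅x.1, y.2⁆ + ⁅x.2, y.1⁆ := rfl
@[simp] theorem add_fst (x y : DualExt L) : (x + y).1 = x.1 + y.1 := rfl
@[simp] theorem add_snd (x y : DualExt L) : (x + y).2 = x.2 + y.2 := rfl
@[simp] theorem zero_fst : (0 : DualExt L).1 = 0 := rfl
@[simp] theorem zero_snd : (0 : DualExt L).2 = 0 := rfl
@[simp] theorem smul_fst (c : ℂ) (x : DualExt L) : (c • x).1 = c • x.1 := rfl
@[simp] theorem smul_snd (c : ℂ) (x : DualExt L) : (c • x).2 = c • x.2 := rfl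

instance : LieRing (DualExt L) where
  add_lie x y z := ext (by simp) (by simp only [lie_snd, add_fst, add_snd, add_lie]; abel)
  lie_add x y z := ext (by simp) (by simp only [lie_snd, add_fst, add_snd, lie_add]; abel)
  lie_self x := ext (by simp) (by
    rw [lie_snd, zero_snd, ← lie_skew, neg_add_cancel])
  leibniz_lie x y z := ext (by simp) (by
    simp only [lie_snd, lie_fst, add_snd, add_lie, lie_add]
    rw [leibniz_lie x.1 y.1 z.2, leibniz_lie x.1 y.2 z.1, leibniz_lie x.2 y.1 z.1]
    abel)

instance : LieAlgebra ℂ (DualExt L) where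
  lie_smul c x y := ext (by simp) (by simp)

/-- The projection to the first component. -/
def fstHom : DualExt L →ₗ⁅ℂ⁆ L where
  toFun x := x.1
  map_add' _ _ := rfl
  map_smul' _ _ := rfl
  map_lie' := rfl

/-- The element `x + ε s x`. -/
def scaled (s : ℂ) (x : L) : DualExt L := (x, s • x)

theorem scaled_lie (s t : ℂ) (x y : L) :
    ⁅scaled s x, scaled t y⁆ = scaled (s + t) ⁅x, y⁆ := by
  refine ext rfl ?_
  change ⁅x, t • y⁆ + ⁅s • x, y⁆ = (s + t) • ⁅x, y⁆
  rw [lie_smul, smul_lie, add_comm, add_smul]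

theorem scaled_zero (s : ℂ) : scaled s (0 : L) = 0 := ext rfl (by simp [scaled])

theorem zsmul_scaled (s : ℂ) (n : ℤ) (x : L) : scaled s (n • x) = n • scaled s x := by
  rw [← Int.cast_smul_eq_zsmul ℂ, ← Int.cast_smul_eq_zsmul ℂ]
  exact ext rfl (smul_comm s (n : ℂ) x)

theorem neg_scaled (s : ℂ) (x : L) : scaled s (-x) = -scaled s x := by
  have := zsmul_scaled s (-1) x
  simpa using this

theorem ad_pow_scaled (s t : ℂ) (x y : L) (n : ℕ) :
    ((LieAlgebra.ad ℂ (DualExt L) (scaled s x)) ^ n) (scaled t y) =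
      scaled (n * s + t) (((LieAlgebra.ad ℂ L x) ^ n) y) := by
  induction n with
  | zero => simp
  | succ n ih =>
    rw [pow_succ', Module.End.mul_apply, ih, LieAlgebra.ad_apply, scaled_lie, pow_succ',
      Module.End.mul_apply, LieAlgebra.ad_apply]
    congr 1
    push_cast
    ring

end DualExt

open DualExt

/-- `x ↦ x + ε D(x)`, where `D` is the derivation scaling `e_i`, `f_i` by `c_i`, `-c_i`. -/
def degHom (A : Matrix I I ℤ) (c : I → ℂ) : Alg A →ₗ⁅ℂ⁆ DualExt (Alg A) :=
  lift (A := A) (e' := fun i => scaled (c i) (e A i)) (f' := fun i => scaled (-c i) (f A i))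
    (h' := fun i => scaled 0 (h A i))
    { hh := fun i j => by rw [scaled_lie, (rels A).hh, scaled_zero]
      ef_same := fun i => by rw [scaled_lie, (rels A).ef_same, add_neg_cancel]
      ef_ne := fun i j hij => by rw [scaled_lie, (rels A).ef_ne i j hij, scaled_zero]
      he := fun i j => by rw [scaled_lie, (rels A).he, zero_add, zsmul_scaled]
      hf := fun i j => by rw [scaled_lie, (rels A).hf, zero_add, neg_scaled, zsmul_scaled]
      serre_e := fun i j => by
        rw [scaled_lie, ad_pow_scaled, (rels A).serre_e, scaled_zero]
      serre_f := fun i j => by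
        rw [scaled_lie, ad_pow_scaled, (rels A).serre_f, scaled_zero] }

theorem degHom_fst (A : Matrix I I ℤ) (c : I → ℂ) (x : Alg A) : (degHom A c x).1 = x := by
  have : fstHom.comp (degHom A c) = LieHom.id :=
    hom_eq_of_eq_on_gen (fun i => by simp [degHom]; rfl) (fun i => by simp [degHom]; rfl)
  exact congrArg (fun φ : Alg A →ₗ⁅ℂ⁆ Alg A => φ x) this

/-- The derivation scaling `e_i`, `f_i`, `h_i` by `c_i`, `-c_i`, `0`. -/
def degDer (A : Matrix I I ℤ) (c : I → ℂ) : LieDerivation ℂ (Alg A) (Alg A) where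
  toFun x := (degHom A c x).2
  map_add' x y := by rw [map_add]; rfl
  map_smul' t x := by rw [map_smul]; rfl
  leibniz' x y := by
    change (degHom A c ⁅x, y⁆).2 = ⁅x, (degHom A c y).2⁆ - ⁅y, (degHom A c x).2⁆
    rw [LieHom.map_lie, lie_snd, degHom_fst, degHom_fst, ← lie_skew y, sub_neg_eq_add]

theorem degDer_e (A : Matrix I I ℤ) (c : I → ℂ) (i : I) : degDer A c (e A i) = c i • e A i :=
  congrArg (fun p : DualExt (Alg A) => p.2) (lift_e _ i)

theorem degDer_f (A : Matrix I I ℤ) (c : I → ℂ) (i : I) : degDer A c (f A i) = -c i • f A i :=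
  congrArg (fun p : DualExt (Alg A) => p.2) (lift_f _ i)

theorem degDer_h (A : Matrix I I ℤ) (c : I → ℂ) (i : I) : degDer A c (h A i) = 0 :=
  (congrArg (fun p : DualExt (Alg A) => p.2) (lift_h _ i)).trans (zero_smul ℂ _)

theorem lieDerivation_eq_of_gen {A : Matrix I I ℤ} {D D' : LieDerivation ℂ (Alg A) (Alg A)}
    (he : ∀ i, D (e A i) = D' (e A i)) (hf : ∀ i, D (f A i) = D' (f A i)) (x : Alg A) :
    D x = D' x := by
  let S : LieSubalgebra ℂ (Alg A) :=
    { LinearMap.eqLocus (D : Alg A →ₗ[ℂ] Alg A) (D' : Alg A →ₗ[ℂ] Alg A) with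
      lie_mem' := fun {x y} hx hy => by
        change D ⁅x, y⁆ = D' ⁅x, y⁆
        rw [LieDerivation.apply_lie_eq_add, LieDerivation.apply_lie_eq_add,
          show D x = D' x from hx, show D y = D' y from hy] }
  have : x ∈ S := by rw [lieSubalgebra_eq_top S he hf]; trivial
  exact this

/-- So `ad h_i` is one of the degree derivations. With arbitrary parameters these also separate
weights that all the `h_i` confuse when `A` is singular, which is why `rootSpace` is defined through
them. -/
theorem h_lie_eq_degDer (A : Matrix I I ℤ) (i : I) (x : Alg A) :
    ⁅h A i, x⁆ = degDer A (fun j => (A i j : ℂ)) x := by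
  rw [← LieDerivation.ad_apply_apply (R := ℂ)]
  refine lieDerivation_eq_of_gen (fun j => ?_) (fun j => ?_) x
  · rw [degDer_e, LieDerivation.ad_apply_apply, (rels A).he, Int.cast_smul_eq_zsmul]
  · rw [degDer_f, LieDerivation.ad_apply_apply, (rels A).hf, neg_smul, Int.cast_smul_eq_zsmul]

/-! ### Root spaces -/

section Weights

variable [Fintype I] {A : Matrix I I ℤ}

/-- The value of the weight `β` on the degree derivation with parameters `c`. -/
def wtEval (c : I → ℂ) (β : I → ℤ) : ℂ := ∑ i, c i * (β i : ℂ)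

theorem wtEval_add (c : I → ℂ) (β γ : I → ℤ) : wtEval c (β + γ) = wtEval c β + wtEval c γ := by
  simp [wtEval, mul_add, Finset.sum_add_distrib]

@[simp] theorem wtEval_simpleRoot (c : I → ℂ) (i : I) : wtEval c (simpleRoot i) = c i := by
  simp [wtEval, simpleRoot, Pi.single_apply]

@[simp] theorem wtEval_neg (c : I → ℂ) (β : I → ℤ) : wtEval c (-β) = -wtEval c β := by
  simp [wtEval]

@[simp] theorem wtEval_zero (c : I → ℂ) : wtEval c 0 = 0 := by simp [wtEval]

theorem wtEval_zsmul (c : I → ℂ) (n : ℤ) (β : I → ℤ) : wtEval c (n • β) = n * wtEval c β := by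
  simp only [wtEval, Pi.smul_apply, smul_eq_mul, Int.cast_mul, Finset.mul_sum]
  exact Finset.sum_congr rfl fun i _ => by ring

/-- The root space `𝔤_β`, for `β` in the root lattice. -/
def rootSpace (A : Matrix I I ℤ) (β : I → ℤ) : Submodule ℂ (Alg A) :=
  ⨅ c : I → ℂ, Module.End.eigenspace (degDer A c : Alg A →ₗ[ℂ] Alg A) (wtEval c β)

theorem mem_rootSpace {β : I → ℤ} {x : Alg A} :
    x ∈ rootSpace A β ↔ ∀ c, degDer A c x = wtEval c β • x := by
  simp [rootSpace, Submodule.mem_iInf]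

theorem e_mem (i : I) : e A i ∈ rootSpace A (simpleRoot i) :=
  mem_rootSpace.2 fun c => by rw [degDer_e, wtEval_simpleRoot]

theorem f_mem (i : I) : f A i ∈ rootSpace A (-simpleRoot i) :=
  mem_rootSpace.2 fun c => by rw [degDer_f, wtEval_neg, wtEval_simpleRoot]

theorem h_mem (i : I) : h A i ∈ rootSpace A 0 :=
  mem_rootSpace.2 fun c => by rw [degDer_h, wtEval_zero, zero_smul]

theorem cartan_le : cartan A ≤ rootSpace A 0 := by
  refine Submodule.span_le.2 ?_
  rintro _ ⟨i, rfl⟩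
  exact h_mem i

theorem lie_mem_rootSpace {β γ : I → ℤ} {x y : Alg A} (hx : x ∈ rootSpace A β)
    (hy : y ∈ rootSpace A γ) : ⁅x, y⁆ ∈ rootSpace A (β + γ) := by
  rw [mem_rootSpace] at *
  intro c
  rw [LieDerivation.apply_lie_eq_add, hx, hy, wtEval_add, lie_smul, smul_lie]
  module

theorem h_lie_of_mem {β : I → ℤ} {x : Alg A} (hx : x ∈ rootSpace A β) (i : I) :
    ⁅h A i, x⁆ = (∑ j, A i j * β j) • x := by
  rw [h_lie_eq_degDer, mem_rootSpace.1 hx, wtEval, ← Int.cast_smul_eq_zsmul ℂ]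
  push_cast
  rfl

/-- A single derivation suffices: for parameters linearly independent over `ℚ`, distinct elements of
the root lattice give distinct eigenvalues. -/
theorem iSupIndep_rootSpace (A : Matrix I I ℤ) : iSupIndep (rootSpace A) := by
  obtain ⟨c, hc⟩ : ∃ c : I → ℂ, LinearIndependent ℚ c := by
    have h1 : (Fintype.card I : Cardinal) ≤ Module.rank ℚ ℂ := by
      rw [Complex.rank_rat_complex]
      exact (Cardinal.natCast_le_aleph0).trans Cardinal.aleph0_le_continuum
    obtain ⟨s, hs, hli⟩ := le_rank_iff_exists_linearIndependent_finset.1 h1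
    have eqv : I ≃ s := Fintype.equivOfCardEq (by simp [hs])
    exact ⟨fun i => (eqv i : ℂ), hli.comp eqv eqv.injective⟩
  have hinj : Function.Injective (wtEval c) := by
    intro β γ h
    have h0 : ∑ i, ((β i - γ i : ℤ) : ℚ) • c i = 0 := by
      have h1 : wtEval c β - wtEval c γ = 0 := sub_eq_zero.2 h
      rw [← h1, wtEval, wtEval, ← Finset.sum_sub_distrib]
      refine Finset.sum_congr rfl fun i _ => ?_
      rw [Algebra.smul_def]
      push_cast
      simp
      ring
    funext i
    have := Fintype.linearIndependent_iff.1 hc _ h0 i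
    have h2 : β i - γ i = 0 := by exact_mod_cast this
    omega
  refine ((Module.End.eigenspaces_iSupIndep (degDer A c : Alg A →ₗ[ℂ] Alg A)).comp hinj).mono
    fun β => ?_
  exact iInf_le _ c

/-- In a root space, a family of homogeneous spanning vectors may be cut down to those of the
right weight. -/
theorem mem_span_of_mem_rootSpace {ι : Type*} {b : ι → Alg A} {wt : ι → I → ℤ}
    (hb : ∀ k, b k ∈ rootSpace A (wt k)) {β : I → ℤ} {x : Alg A}
    (hx : x ∈ rootSpace A β) (hspan : x ∈ Submodule.span ℂ (Set.range b)) :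
    x ∈ Submodule.span ℂ (b '' {k | wt k = β}) := by
  have hsub : Set.range b = b '' {k | wt k = β} ∪ b '' {k | wt k ≠ β} := by
    rw [← Set.image_union, ← Set.image_univ]
    congr 1
    ext k
    simp [em]
  rw [hsub, Submodule.span_union, Submodule.mem_sup] at hspan
  obtain ⟨y, hy, z, hz, rfl⟩ := hspan
  have hy' : y ∈ rootSpace A β := by
    refine Submodule.span_le.2 ?_ hy
    rintro _ ⟨k, rfl, rfl⟩
    exact hb k
  have hz' : z ∈ ⨆ γ, ⨆ (_ : γ ≠ β), rootSpace A γ := by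
    refine Submodule.span_le.2 ?_ hz
    rintro _ ⟨k, hk, rfl⟩
    exact Submodule.mem_iSup_of_mem (wt k) (Submodule.mem_iSup_of_mem hk (hb k))
  have h0 : z = 0 := Submodule.disjoint_def.1 (iSupIndep_rootSpace A β) z
    (by simpa using Submodule.sub_mem _ hx hy') hz'
  rw [h0, add_zero]
  exact hy

end Weights

/-! ### Right-normed brackets -/

section Words

variable {L : Type*} [LieRing L] [LieAlgebra ℂ L]

/-- The right-normed bracket `[x_{j₁}, [x_{j₂}, ⋯, x_{jₘ}]]` (zero for the empty word). -/
def brWord (x : I → L) : List I → L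
  | [] => 0
  | [i] => x i
  | i :: j :: l => ⁅x i, brWord x (j :: l)⁆

@[simp] theorem brWord_singleton (x : I → L) (i : I) : brWord x [i] = x i := rfl

theorem brWord_cons (x : I → L) (i : I) {l : List I} (hl : l ≠ []) :
    brWord x (i :: l) = ⁅x i, brWord x l⁆ := by
  cases l with
  | nil => exact absurd rfl hl
  | cons j l => rfl

theorem lie_brWord_mem_span (x : I → L) (i : I) (l : List I) :
    ⁅x i, brWord x l⁆ ∈ Submodule.span ℂ (Set.range (brWord x)) := by
  by_cases hl : l = []
  · subst hl; simp [brWord]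
  · rw [← brWord_cons x i hl]; exact Submodule.subset_span ⟨_, rfl⟩

theorem lie_span_brWord (x : I → L) (i : I) {y : L}
    (hy : y ∈ Submodule.span ℂ (Set.range (brWord x))) :
    ⁅x i, y⁆ ∈ Submodule.span ℂ (Set.range (brWord x)) := by
  induction hy using Submodule.span_induction with
  | mem y hy => obtain ⟨l, rfl⟩ := hy; exact lie_brWord_mem_span x i l
  | zero => simp
  | add y z _ _ hy hz => rw [lie_add]; exact add_mem hy hz
  | smul c y _ hy => rw [lie_smul]; exact Submodule.smul_mem _ _ hy

variable {x y t : I → L}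

theorem cartan_lie_brWord (htx : ∀ i j, ∃ c : ℂ, ⁅t i, x j⁆ = c • x j) (i : I) (l : List I) :
    ∃ c : ℂ, ⁅t i, brWord x l⁆ = c • brWord x l := by
  induction l with
  | nil => exact ⟨0, by simp [brWord]⟩
  | cons j l ih =>
    by_cases hl : l = []
    · subst hl; exact htx i j
    · obtain ⟨c, hc⟩ := ih
      obtain ⟨c', hc'⟩ := htx i j
      refine ⟨c' + c, ?_⟩
      rw [brWord_cons x j hl, leibniz_lie, hc, hc', smul_lie, lie_smul]
      module

theorem lie_cartan_sup_span (htx : ∀ i j, ∃ c : ℂ, ⁅t i, x j⁆ = c • x j) (j : I) {z : L}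
    (hz : z ∈ Submodule.span ℂ (Set.range t) ⊔ Submodule.span ℂ (Set.range (brWord x))) :
    ⁅x j, z⁆ ∈ Submodule.span ℂ (Set.range (brWord x)) := by
  suffices h : Submodule.span ℂ (Set.range t) ⊔ Submodule.span ℂ (Set.range (brWord x)) ≤
      (Submodule.span ℂ (Set.range (brWord x))).comap (LieAlgebra.ad ℂ L (x j)) from h hz
  refine sup_le (Submodule.span_le.2 ?_) fun v hv => lie_span_brWord x j hv
  rintro _ ⟨i, rfl⟩
  obtain ⟨c, hc⟩ := htx i j
  change ⁅x j, t i⁆ ∈ Submodule.span ℂ (Set.range (brWord x))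
  rw [← lie_skew, hc]
  exact neg_mem (Submodule.smul_mem _ _ (Submodule.subset_span ⟨[j], rfl⟩))

/-- Applied with `t` the `h_i` and `y` the generators opposite to `x`. An opposite generator turns
one letter into an element of the span of `t`, and this acts on the rest of the word by scalars. -/
theorem opposite_lie_brWord (htx : ∀ i j, ∃ c : ℂ, ⁅t i, x j⁆ = c • x j)
    (hyx : ∀ i j, ⁅y i, x j⁆ ∈ Submodule.span ℂ (Set.range t)) (i : I) (l : List I) :
    ⁅y i, brWord x l⁆ ∈
      Submodule.span ℂ (Set.range t) ⊔ Submodule.span ℂ (Set.range (brWord x)) := by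
  induction l with
  | nil => simp [brWord]
  | cons j l ih =>
    by_cases hl : l = []
    · subst hl; exact Submodule.mem_sup_left (hyx i j)
    · rw [brWord_cons x j hl, leibniz_lie]
      refine Submodule.mem_sup_right (add_mem ?_ (lie_cartan_sup_span htx j ih))
      refine Submodule.span_induction (p := fun u _ => ⁅u, brWord x l⁆ ∈ _) ?_ (by simp)
        (fun u v _ _ hu hv => by rw [add_lie]; exact add_mem hu hv)
        (fun c u _ hu => by rw [smul_lie]; exact Submodule.smul_mem _ _ hu) (hyx i j)
      rintro _ ⟨k, rfl⟩
      obtain ⟨c, hc⟩ := cartan_lie_brWord htx k l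
      rw [hc]
      exact Submodule.smul_mem _ _ (Submodule.subset_span ⟨_, rfl⟩)

end Words

end KacMoody

namespace KacMoody

open CartanMatrix

variable {I : Type*} [DecidableEq I]

/-! ### Triangular spanning set and small root spaces -/

variable {A : Matrix I I ℤ}

theorem he_scalar (A : Matrix I I ℤ) (i j : I) : ∃ c : ℂ, ⁅h A i, e A j⁆ = c • e A j :=
  ⟨A i j, by rw [(rels A).he, Int.cast_smul_eq_zsmul]⟩

theorem hf_scalar (A : Matrix I I ℤ) (i j : I) : ∃ c : ℂ, ⁅h A i, f A j⁆ = c • f A j :=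
  ⟨-A i j, by rw [(rels A).hf, neg_smul, Int.cast_smul_eq_zsmul]⟩

theorem ef_mem_cartan (A : Matrix I I ℤ) (i j : I) : ⁅e A i, f A j⁆ ∈ cartan A := by
  by_cases hij : i = j
  · subst hij
    rw [(rels A).ef_same]
    exact Submodule.subset_span ⟨i, rfl⟩
  · rw [(rels A).ef_ne i j hij]
    exact zero_mem _

/-- The spanning family of the Kac-Moody algebra given by right-normed brackets and the `h_i`. -/
def triFamily (A : Matrix I I ℤ) : List I ⊕ I ⊕ List I → Alg A :=
  Sum.elim (brWord (e A)) (Sum.elim (h A) (brWord (f A)))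

theorem span_triFamily (A : Matrix I I ℤ) :
    Submodule.span ℂ (Set.range (triFamily A)) = ⊤ := by
  set S := Submodule.span ℂ (Set.range (triFamily A)) with hS
  have hdec : S = Submodule.span ℂ (Set.range (brWord (e A))) ⊔
      (cartan A ⊔ Submodule.span ℂ (Set.range (brWord (f A)))) := by
    rw [hS, triFamily, Set.Sum.elim_range, Set.Sum.elim_range, Submodule.span_union,
      Submodule.span_union]
    rfl
  have hSe : Submodule.span ℂ (Set.range (brWord (e A))) ≤ S := hdec ▸ le_sup_left
  have hSh : cartan A ≤ S := hdec ▸ le_sup_left.trans le_sup_right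
  have hSf : Submodule.span ℂ (Set.range (brWord (f A))) ≤ S :=
    hdec ▸ le_sup_right.trans le_sup_right
  have he : ∀ i, S ≤ S.comap (LieAlgebra.ad ℂ (Alg A) (e A i)) := by
    intro i
    conv_lhs => rw [hdec]
    refine sup_le (fun x hx => hSe (lie_span_brWord _ i hx)) (sup_le ?_ ?_)
    · exact fun x hx => hSe (lie_cartan_sup_span (he_scalar A) i (Submodule.mem_sup_left hx))
    · refine Submodule.span_le.2 ?_
      rintro _ ⟨l, rfl⟩
      exact (sup_le hSh hSf)
        (opposite_lie_brWord (y := e A) (hf_scalar A) (ef_mem_cartan A) i l)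
  have hf : ∀ i, S ≤ S.comap (LieAlgebra.ad ℂ (Alg A) (f A i)) := by
    intro i
    conv_lhs => rw [hdec]
    refine sup_le ?_ (sup_le ?_ (fun x hx => hSf (lie_span_brWord _ i hx)))
    · refine Submodule.span_le.2 ?_
      rintro _ ⟨l, rfl⟩
      refine (sup_le hSh hSe) (opposite_lie_brWord (y := f A) (he_scalar A) (fun i j => ?_) i l)
      rw [← lie_skew]
      exact neg_mem (ef_mem_cartan A j i)
    · exact fun x hx => hSf (lie_cartan_sup_span (hf_scalar A) i (Submodule.mem_sup_left hx))
  -- The elements `x` with `[x, S] ⊆ S` form a subalgebra containing all `e_i` and `f_i`, hence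
  -- everything. Thus `S` is itself a subalgebra, and it contains the generators.
  let N : LieSubalgebra ℂ (Alg A) :=
    { carrier := {x | ∀ y ∈ S, ⁅x, y⁆ ∈ S}
      add_mem' := fun hx hy z hz => by rw [add_lie]; exact add_mem (hx z hz) (hy z hz)
      zero_mem' := fun z _ => by simp
      smul_mem' := fun c x hx z hz => by rw [smul_lie]; exact Submodule.smul_mem _ _ (hx z hz)
      lie_mem' := fun {x y} hx hy z hz => by
        rw [lie_lie]; exact sub_mem (hx _ (hy z hz)) (hy _ (hx z hz)) }
  have hN : N = ⊤ := lieSubalgebra_eq_top N (fun i y hy => he i hy) (fun i y hy => hf i hy)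
  have hN' : ∀ x, ∀ y ∈ S, ⁅x, y⁆ ∈ S := fun x => by
    have : x ∈ N := by rw [hN]; trivial
    exact this
  let S' : LieSubalgebra ℂ (Alg A) := { S with lie_mem' := fun {x y} _ hy => hN' x y hy }
  have hS' : S' = ⊤ := lieSubalgebra_eq_top S'
    (fun i => Submodule.subset_span ⟨Sum.inl [i], rfl⟩)
    (fun i => Submodule.subset_span ⟨Sum.inr (Sum.inr [i]), rfl⟩)
  refine eq_top_iff.2 fun x _ => ?_
  have : x ∈ S' := by rw [hS']; trivial
  exact this

/-- The weight of a word. -/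
def wordWt (l : List I) : I → ℤ := fun i => (l.count i : ℤ)

theorem wordWt_cons (i : I) (l : List I) : wordWt (i :: l) = simpleRoot i + wordWt l := by
  funext k
  simp only [wordWt, simpleRoot, Pi.add_apply, Pi.single_apply, List.count_cons]
  by_cases h : i = k
  · subst h; simp [add_comm]
  · simp [h, Ne.symm h]

section

variable [Fintype I]

theorem brWord_mem_rootSpace {x : I → Alg A} {wt : I → I → ℤ}
    (hx : ∀ i, x i ∈ rootSpace A (wt i)) (l : List I) :
    brWord x l ∈ rootSpace A (l.map wt).sum := by
  induction l with
  | nil => exact zero_mem _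
  | cons i l ih =>
    by_cases hl : l = []
    · subst hl; simpa using hx i
    · rw [brWord_cons x i hl, List.map_cons, List.sum_cons]
      exact lie_mem_rootSpace (hx i) ih

theorem brWord_e_mem (l : List I) : brWord (e A) l ∈ rootSpace A (wordWt l) := by
  have h : (l.map simpleRoot).sum = wordWt l := by
    induction l with
    | nil => funext k; simp [wordWt]
    | cons i l ih => rw [List.map_cons, List.sum_cons, ih, wordWt_cons]
  exact h ▸ brWord_mem_rootSpace e_mem l

theorem brWord_f_mem (l : List I) : brWord (f A) l ∈ rootSpace A (-wordWt l) := by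
  have h : (l.map (fun i => -simpleRoot i)).sum = -wordWt l := by
    induction l with
    | nil => funext k; simp [wordWt]
    | cons i l ih => rw [List.map_cons, List.sum_cons, ih, wordWt_cons, neg_add]
  exact h ▸ brWord_mem_rootSpace f_mem l

/-- The weights of `triFamily`. -/
def triWt : List I ⊕ I ⊕ List I → I → ℤ :=
  Sum.elim wordWt (Sum.elim (fun _ => 0) (fun l => -wordWt l))

theorem mem_span_triFamily {β : I → ℤ} {x : Alg A} (hx : x ∈ rootSpace A β) :
    x ∈ Submodule.span ℂ (triFamily A '' {k | triWt k = β}) := by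
  refine mem_span_of_mem_rootSpace (wt := triWt) ?_ hx (by rw [span_triFamily]; trivial)
  rintro (l | i | l)
  exacts [brWord_e_mem l, h_mem i, brWord_f_mem l]

theorem wordWt_nonneg (l : List I) (i : I) : 0 ≤ wordWt l i := by simp [wordWt]

theorem mem_submodule_of_pos {β : I → ℤ} {x : Alg A} (hx : x ∈ rootSpace A β)
    {i : I} (hi : 0 < β i) {S : Submodule ℂ (Alg A)}
    (hS : ∀ l, wordWt l = β → brWord (e A) l ∈ S) : x ∈ S := by
  refine Submodule.span_le.2 ?_ (mem_span_triFamily hx)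
  rintro _ ⟨(l | k | l), rfl, rfl⟩
  · exact hS l rfl
  · simp [triWt] at hi
  · have := wordWt_nonneg l i
    simp only [triWt, Sum.elim_inr, Pi.neg_apply] at hi
    omega

theorem mem_submodule_of_neg {β : I → ℤ} {x : Alg A} (hx : x ∈ rootSpace A β)
    {i : I} (hi : β i < 0) {S : Submodule ℂ (Alg A)}
    (hS : ∀ l, -wordWt l = β → brWord (f A) l ∈ S) : x ∈ S := by
  refine Submodule.span_le.2 ?_ (mem_span_triFamily hx)
  rintro _ ⟨(l | k | l), rfl, rfl⟩
  · have := wordWt_nonneg l i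
    simp only [triWt, Sum.elim_inl] at hi
    omega
  · simp [triWt] at hi
  · exact hS l rfl

/-- The weight of each spanning vector has coefficients of one sign. This lemma,
`eq_zero_of_multiple` and twisting by the Weyl group are the only ways in which a weight is
recognised as a non-root. -/
theorem eq_zero_of_mixed {β : I → ℤ} {x : Alg A} (hx : x ∈ rootSpace A β) {i j : I}
    (hi : 0 < β i) (hj : β j < 0) : x = 0 := by
  rw [← Submodule.mem_bot ℂ]
  refine mem_submodule_of_pos hx hi fun l hl => ?_
  have := wordWt_nonneg l j
  rw [hl] at this
  omega

theorem eq_replicate_of_wordWt {n : ℤ} {i : I} {l : List I} (hl : wordWt l = n • simpleRoot i) :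
    l = List.replicate l.length i ∧ (l.length : ℤ) = n := by
  have h1 : ∀ b ∈ l, b = i := by
    intro b hb
    by_contra hne
    have h2 := congrFun hl b
    simp only [wordWt, simpleRoot, Pi.smul_apply, Pi.single_apply, hne, if_false, smul_zero,
      Nat.cast_eq_zero, List.count_eq_zero] at h2
    exact h2 hb
  have h3 := List.eq_replicate_iff.2 ⟨rfl, h1⟩
  refine ⟨h3, ?_⟩
  have h2 := congrFun hl i
  rw [wordWt, h3, List.count_replicate_self] at h2
  simpa [simpleRoot] using h2

theorem brWord_replicate_eq_zero {L : Type*} [LieRing L] [LieAlgebra ℂ L] (x : I → L) (i : I)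
    {n : ℕ} (hn : n ≠ 1) : brWord x (List.replicate n i) = 0 := by
  match n, hn with
  | 0, _ => rfl
  | 2, _ => exact lie_self _
  | n + 3, _ =>
    rw [List.replicate_succ, brWord_cons x i (by simp),
      brWord_replicate_eq_zero x i (by omega : n + 2 ≠ 1), lie_zero]

/-- Only words in the single letter `i` have such a weight, and their innermost bracket is `[x_i,
x_i]`. -/
theorem eq_zero_of_multiple {n : ℤ} {i : I} {x : Alg A} (hx : x ∈ rootSpace A (n • simpleRoot i))
    (hn : 2 ≤ n ∨ n ≤ -2) : x = 0 := by
  rw [← Submodule.mem_bot ℂ]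
  rcases hn with hn | hn
  · refine mem_submodule_of_pos (i := i) hx (by simp [simpleRoot]; omega) fun l hl => ?_
    obtain ⟨h1, h2⟩ := eq_replicate_of_wordWt hl
    rw [h1, brWord_replicate_eq_zero _ _ (by omega)]
    exact zero_mem _
  · refine mem_submodule_of_neg (i := i) hx (by simp [simpleRoot]; omega) fun l hl => ?_
    obtain ⟨h1, h2⟩ := eq_replicate_of_wordWt (n := -n) (i := i) (l := l)
      (by rw [neg_smul, ← hl, neg_neg])
    rw [h1, brWord_replicate_eq_zero _ _ (by omega)]
    exact zero_mem _

theorem mem_span_e {i : I} {x : Alg A} (hx : x ∈ rootSpace A (simpleRoot i)) :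
    ∃ t : ℂ, x = t • e A i := by
  suffices h : x ∈ Submodule.span ℂ {e A i} by
    obtain ⟨t, rfl⟩ := Submodule.mem_span_singleton.1 h
    exact ⟨t, rfl⟩
  refine mem_submodule_of_pos (i := i) hx (by simp [simpleRoot]) fun l hl => ?_
  obtain ⟨h1, h2⟩ := eq_replicate_of_wordWt (n := 1) (i := i) (l := l) (by simpa using hl)
  rw [h1, show l.length = 1 by omega]
  exact Submodule.mem_span_singleton_self _

theorem mem_span_f {i : I} {x : Alg A} (hx : x ∈ rootSpace A (-simpleRoot i)) :
    ∃ t : ℂ, x = t • f A i := by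
  suffices h : x ∈ Submodule.span ℂ {f A i} by
    obtain ⟨t, rfl⟩ := Submodule.mem_span_singleton.1 h
    exact ⟨t, rfl⟩
  refine mem_submodule_of_neg (i := i) hx (by simp [simpleRoot]) fun l hl => ?_
  obtain ⟨h1, h2⟩ := eq_replicate_of_wordWt (n := 1) (i := i) (l := l)
    (by simpa using neg_injective hl)
  rw [h1, show l.length = 1 by omega]
  exact Submodule.mem_span_singleton_self _

theorem mem_span_lie_e {i j : I} (hij : i ≠ j) {x : Alg A}
    (hx : x ∈ rootSpace A (simpleRoot i + simpleRoot j)) :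
    ∃ t : ℂ, x = t • ⁅e A i, e A j⁆ := by
  suffices h : x ∈ Submodule.span ℂ {⁅e A i, e A j⁆} by
    obtain ⟨t, rfl⟩ := Submodule.mem_span_singleton.1 h
    exact ⟨t, rfl⟩
  refine mem_submodule_of_pos (i := i) hx
    (by simp [simpleRoot, hij]) fun l hl => ?_
  have hperm : l.Perm [i, j] := by
    rw [List.perm_iff_count]
    intro k
    have h1 := congrFun hl k
    have h2 : wordWt [i, j] = simpleRoot i + simpleRoot j := by
      rw [wordWt_cons, wordWt_cons]
      funext k; simp [wordWt]
    rw [← h2] at h1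
    exact Nat.cast_injective (R := ℤ) h1
  have hlen : l.length = 2 := hperm.length_eq
  obtain ⟨a, b, rfl⟩ := List.length_eq_two.1 hlen
  have ha : a = i ∨ a = j := by simpa using hperm.subset (List.mem_cons_self)
  rcases ha with rfl | rfl
  · have : b = j := by simpa using (List.perm_cons a).1 hperm
    subst this
    exact Submodule.mem_span_singleton_self _
  · have h3 := hperm.trans (List.Perm.swap a i [])
    have : b = i := by simpa using (List.perm_cons a).1 h3
    subst this
    change ⁅e A a, e A b⁆ ∈ _
    rw [← neg_mem_iff, lie_skew]
    exact Submodule.mem_span_singleton_self _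

theorem brWord_e_mem_nPlus {X : Finset I} {l : List I} (hl : ∀ i ∈ l, i ∈ X) :
    brWord (e A) l ∈ nPlus A X := by
  induction l with
  | nil => exact zero_mem _
  | cons i l ih =>
    have hi : e A i ∈ nPlus A X := LieSubalgebra.subset_lieSpan ⟨i, hl i (by simp), rfl⟩
    by_cases h : l = []
    · subst h; exact hi
    · rw [brWord_cons _ _ h]
      exact (nPlus A X).lie_mem hi (ih fun k hk => hl k (by simp [hk]))

theorem mem_nPlus_of_rootSpace {X : Finset I} {β : I → ℤ} (hβX : ∀ i ∉ X, β i = 0)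
    (hβ0 : β ≠ 0) (hβ : ∀ i, 0 ≤ β i) {x : Alg A} (hx : x ∈ rootSpace A β) : x ∈ nPlus A X := by
  obtain ⟨i, hi⟩ := Function.ne_iff.1 hβ0
  refine mem_submodule_of_pos (S := (nPlus A X).toSubmodule) (i := i) hx
    (lt_of_le_of_ne (hβ i) (Ne.symm hi)) fun l hl => ?_
  refine brWord_e_mem_nPlus fun k hk => ?_
  by_contra hkX
  have h1 := congrFun hl k
  rw [hβX k hkX] at h1
  simp only [wordWt, Nat.cast_eq_zero, List.count_eq_zero] at h1
  exact h1 hk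

/-! ### The action of `Ad(m_i)` on root spaces -/

/-- `Ad(m_i)` as a homomorphism of Lie algebras. -/
def AdMHom (A : Matrix I I ℤ) (i : I) : Alg A →ₗ⁅ℂ⁆ Alg A :=
  (expHom (adLocNil_e A i)).comp
    ((expHom (adLocNil_f A i).neg).comp (expHom (adLocNil_e A i)))

theorem AdMHom_apply (i : I) (x : Alg A) : AdMHom A i x = AdM A i x := rfl

theorem AdMHom_injective (i : I) : Function.Injective (AdMHom A i) :=
  (expHom_injective (adLocNil_e A i)).comp
    ((expHom_injective (adLocNil_f A i).neg).comp (expHom_injective (adLocNil_e A i)))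

theorem expHom_e_h (hA : IsIndecSymmGCM A) (i : I) :
    expHom (adLocNil_e A i) (h A i) = h A i - (2 : ℂ) • e A i := by
  have h1 : ⁅e A i, h A i⁆ = -(2 : ℂ) • e A i := by
    rw [← lie_skew, (rels A).he, hA.diag, neg_smul, ← Int.cast_smul_eq_zsmul ℂ]; norm_num
  rw [expHom_apply, expAd_eq_sum (N := 2)
    (by simp [pow_succ, h1])]
  simp [Finset.sum_range_succ, h1, sub_eq_add_neg]

theorem expHom_e_e (i : I) : expHom (adLocNil_e A i) (e A i) = e A i := expAd_eq_self (lie_self _)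

theorem lie_f_h (hA : IsIndecSymmGCM A) (i : I) : ⁅f A i, h A i⁆ = (2 : ℂ) • f A i := by
  rw [← lie_skew, (rels A).hf, hA.diag, neg_neg, ← Int.cast_smul_eq_zsmul ℂ]; norm_num

theorem lie_f_e (i : I) : ⁅f A i, e A i⁆ = -h A i := by
  rw [← lie_skew, (rels A).ef_same]

theorem expHom_f_h (hA : IsIndecSymmGCM A) (i : I) :
    expHom (adLocNil_f A i).neg (h A i) = h A i - (2 : ℂ) • f A i := by
  rw [expHom_apply, expAd_eq_sum (N := 2) (by simp [pow_succ, lie_f_h hA])]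
  simp [Finset.sum_range_succ, lie_f_h hA, sub_eq_add_neg]

theorem expHom_f_e (hA : IsIndecSymmGCM A) (i : I) :
    expHom (adLocNil_f A i).neg (e A i) = e A i + h A i - f A i := by
  rw [expHom_apply, expAd_eq_sum (N := 3) (by simp [pow_succ, lie_f_e, lie_f_h hA])]
  simp [Finset.sum_range_succ, lie_f_e, lie_f_h hA, pow_succ, sub_eq_add_neg, smul_smul]

theorem AdMHom_h (hA : IsIndecSymmGCM A) (i : I) : AdMHom A i (h A i) = -h A i := by
  simp only [AdMHom, LieHom.comp_apply, expHom_e_h hA, map_sub, map_smul, expHom_f_h hA,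
    expHom_f_e hA, map_add, expHom_e_e]
  module

/-- Moving the derivation past the three exponentials produces `c_i` times the adjoint action of
conjugates of `e_i`, `f_i`, `e_i`, and these add up to `h_i` (`key`). -/
theorem degDer_AdMHom (hA : IsIndecSymmGCM A) (c : I → ℂ) (i : I) (y : Alg A) :
    degDer A c (AdMHom A i y) =
      AdMHom A i (degDer A c y) + c i • ⁅h A i, AdMHom A i y⁆ := by
  have hE := derivation_expAd (adLocNil_e A i) (degDer A c) (degDer_e A c i)
  have hF := derivation_expAd (adLocNil_f A i).neg (degDer A c) (μ := -c i)
    (by rw [map_neg, degDer_f, smul_neg])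
  simp only [← expHom_apply (adLocNil_e A i)] at hE
  simp only [← expHom_apply (adLocNil_f A i).neg] at hF
  have key : expHom (adLocNil_e A i) (expHom (adLocNil_f A i).neg (e A i)) +
      expHom (adLocNil_e A i) (f A i) + e A i = h A i := by
    rw [expHom_f_e hA, map_sub, map_add, expHom_e_e, expHom_e_h hA]
    module
  simp only [AdMHom, LieHom.comp_apply]
  rw [hE, hF, hE]
  rw [← key]
  simp only [map_add, map_smul, map_neg, LieHom.map_lie, add_lie, neg_lie]
  module

/-- As `Ad(m_i)` negates `h_i`, the latter acts on `Ad(m_i) x` by the negative of its value at `β`.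
The correction term of `degDer_AdMHom` is then exactly the difference between `β` and `r_i(β)`. -/
theorem AdMHom_mem_rootSpace (hA : IsIndecSymmGCM A) (i : I) {β : I → ℤ} {x : Alg A}
    (hx : x ∈ rootSpace A β) : AdMHom A i x ∈ rootSpace A (reflection A i β) := by
  rw [mem_rootSpace]
  intro c
  have h1 : ⁅h A i, AdMHom A i x⁆ = -((∑ j, A i j * β j : ℤ) : ℂ) • AdMHom A i x := by
    rw [← neg_neg (h A i), ← AdMHom_h hA, neg_lie, ← LieHom.map_lie, h_lie_of_mem hx,
      ← Int.cast_smul_eq_zsmul ℂ, map_smul, neg_smul]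
  rw [degDer_AdMHom hA, mem_rootSpace.1 hx, h1, map_smul, reflection, sub_eq_add_neg, wtEval_add,
    wtEval_neg, wtEval_zsmul, wtEval_simpleRoot]
  module

/-- `Ad(m_{i₁} ⋯ m_{iₗ})` as a homomorphism of Lie algebras. -/
def AdWordHom (A : Matrix I I ℤ) : List I → (Alg A →ₗ⁅ℂ⁆ Alg A)
  | [] => LieHom.id
  | i :: l => (AdMHom A i).comp (AdWordHom A l)

theorem AdWordHom_apply (l : List I) (x : Alg A) : AdWordHom A l x = AdWord A l x := by
  induction l with
  | nil => rfl
  | cons i l ih => simp only [AdWordHom, AdWord, LieHom.comp_apply, ih]; rfl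

theorem AdWordHom_injective (l : List I) : Function.Injective (AdWordHom A l) := by
  induction l with
  | nil => exact fun _ _ h => h
  | cons i l ih => exact (AdMHom_injective i).comp ih

theorem AdWordHom_mem_rootSpace (hA : IsIndecSymmGCM A) (l : List I) {β : I → ℤ} {x : Alg A}
    (hx : x ∈ rootSpace A β) : AdWordHom A l x ∈ rootSpace A (weylAct A l β) := by
  induction l with
  | nil => exact hx
  | cons i l ih => exact AdMHom_mem_rootSpace hA i ih

theorem AdWordHom_eq_self {l : List I} {x : Alg A}
    (hx : ∀ i ∈ l, ⁅e A i, x⁆ = 0 ∧ ⁅f A i, x⁆ = 0) : AdWordHom A l x = x := by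
  induction l with
  | nil => rfl
  | cons i l ih =>
    have h1 := hx i (by simp)
    rw [AdWordHom, LieHom.comp_apply, ih fun k hk => hx k (by simp [hk]), AdMHom_apply, AdM,
      expAd_eq_self h1.1, expAd_eq_self (x := -f A i) (by rw [neg_lie, h1.2, neg_zero]),
      expAd_eq_self h1.1]

/-! ### The Weyl group action -/

theorem weylAct_add (l : List I) (v u : I → ℤ) :
    weylAct A l (v + u) = weylAct A l v + weylAct A l u := by
  induction l with
  | nil => rfl
  | cons i l ih =>
    simp only [weylAct, Function.comp_apply, ih, reflection, Pi.add_apply, mul_add,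
      Finset.sum_add_distrib]
    module

/-- The Weyl group action as an additive map. -/
def weylHom (A : Matrix I I ℤ) (l : List I) : (I → ℤ) →+ (I → ℤ) :=
  AddMonoidHom.mk' (weylAct A l) (weylAct_add l)

theorem weylHom_apply (l : List I) (v : I → ℤ) : weylHom A l v = weylAct A l v := rfl

theorem weylAct_apply_of_notMem {X : Finset I} {l : List I} (hl : ∀ i ∈ l, i ∈ X) (v : I → ℤ)
    {k : I} (hk : k ∉ X) : weylAct A l v k = v k := by
  induction l with
  | nil => rfl
  | cons i l ih =>
    have hik : k ≠ i := fun h => hk (h ▸ hl i (by simp))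
    simp [weylAct, reflection, simpleRoot, hik, ih fun j hj => hl j (by simp [hj])]

theorem reflection_reflection (hA : IsIndecSymmGCM A) (i : I) (v : I → ℤ) :
    reflection A i (reflection A i v) = v := by
  have h1 : ∑ j, A i j * reflection A i v j = -∑ j, A i j * v j := by
    simp only [reflection, simpleRoot, Pi.sub_apply, Pi.smul_apply, smul_eq_mul, mul_sub,
      Finset.sum_sub_distrib, Pi.single_apply, mul_ite, mul_one, mul_zero, Finset.sum_ite_eq',
      Finset.mem_univ, if_true, hA.diag]
    ring
  rw [reflection, h1, reflection]
  module

theorem weylAct_append (l l' : List I) (v : I → ℤ) :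
    weylAct A (l ++ l') v = weylAct A l (weylAct A l' v) := by
  induction l with
  | nil => rfl
  | cons i l ih => simp only [List.cons_append, weylAct, Function.comp_apply, ih]

theorem weylAct_reverse (hA : IsIndecSymmGCM A) (l : List I) (v : I → ℤ) :
    weylAct A l.reverse (weylAct A l v) = v := by
  induction l with
  | nil => rfl
  | cons i l ih =>
    rw [List.reverse_cons, weylAct_append]
    simp only [weylAct, Function.comp_apply, id_eq, reflection_reflection hA, ih]

/-- Allows a weight to be tested after a Weyl group element has been applied, since `Ad(m_w)` is
injective and maps `𝔤_β` into `𝔤_{wβ}`. -/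
theorem eq_zero_of_weyl (hA : IsIndecSymmGCM A) (l : List I) {β : I → ℤ}
    (h : ∀ y ∈ rootSpace A (weylAct A l β), y = 0) {x : Alg A} (hx : x ∈ rootSpace A β) :
    x = 0 :=
  AdWordHom_injective l (by rw [map_zero]; exact h _ (AdWordHom_mem_rootSpace hA l hx))

end

end KacMoody

namespace KacMoody

open CartanMatrix

variable {I : Type*} [DecidableEq I]

/-! ### `sl₂`-computations -/

section Sl2

variable {L : Type*} [LieRing L] [LieAlgebra ℂ L]

theorem lie_ad_pow_weight {x t v : L} {lam : ℂ} (htx : ⁅t, x⁆ = -(2 : ℂ) • x)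
    (htv : ⁅t, v⁆ = lam • v) (m : ℕ) :
    ⁅t, ((LieAlgebra.ad ℂ L x) ^ m) v⁆ = (lam - 2 * m) • ((LieAlgebra.ad ℂ L x) ^ m) v := by
  induction m with
  | zero => simp [htv]
  | succ m ih =>
    rw [pow_succ', Module.End.mul_apply, LieAlgebra.ad_apply, leibniz_lie, ih, htx, smul_lie,
      lie_smul]
    push_cast
    module

/-- `y xᵐ⁺¹ v = (m+1)(λ-m) xᵐ v` for a highest weight vector `v` of weight `λ`. -/
theorem lie_ad_pow_succ {x y t v : L} {lam : ℂ} (hyx : ⁅y, x⁆ = t) (htx : ⁅t, x⁆ = -(2 : ℂ) • x)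
    (hyv : ⁅y, v⁆ = 0) (htv : ⁅t, v⁆ = lam • v) (m : ℕ) :
    ⁅y, ((LieAlgebra.ad ℂ L x) ^ (m + 1)) v⁆ =
      ((m + 1) * (lam - m)) • ((LieAlgebra.ad ℂ L x) ^ m) v := by
  induction m with
  | zero =>
    rw [zero_add, pow_one, LieAlgebra.ad_apply, leibniz_lie, hyx, hyv, htv]
    simp
  | succ m ih =>
    rw [pow_succ', Module.End.mul_apply, LieAlgebra.ad_apply, leibniz_lie, ih, hyx,
      lie_ad_pow_weight htx htv, lie_smul, ← LieAlgebra.ad_apply ℂ L x, ← Module.End.mul_apply,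
      ← pow_succ']
    push_cast
    module

theorem lie_ad_pow_of_lie_eq_zero {x y v : L} (hyx : ⁅y, x⁆ = 0) (m : ℕ) :
    ⁅y, ((LieAlgebra.ad ℂ L x) ^ m) v⁆ = ((LieAlgebra.ad ℂ L x) ^ m) ⁅y, v⁆ := by
  induction m with
  | zero => simp
  | succ m ih =>
    rw [pow_succ', Module.End.mul_apply, Module.End.mul_apply, LieAlgebra.ad_apply, leibniz_lie,
      ih, hyx, zero_lie, zero_add, LieAlgebra.ad_apply]

theorem IsIndecSymmGCM.symm_zero {A : Matrix I I ℤ} (hA : IsIndecSymmGCM A) {i j : I}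
    (hij : A i j = 0) : A j i = 0 := by
  obtain ⟨d, hd, hs⟩ := hA.symmetrizable
  have h1 := hs i j
  rw [hij] at h1
  have h2 : d j * (A j i : ℚ) = 0 := by simpa using h1.symm
  exact_mod_cast (mul_eq_zero.1 h2).resolve_left (ne_of_gt (hd j))

/-- Serre elements commute with the opposite generators. -/
theorem lie_serre_eq_zero {A : Matrix I I ℤ} (hA : IsIndecSymmGCM A) {x y t : I → L}
    (hyx_ne : ∀ i j, i ≠ j → ⁅y i, x j⁆ = 0) (hyx : ∀ i, ⁅y i, x i⁆ = t i)
    (htx : ∀ i j, ⁅t i, x j⁆ = -(A i j : ℂ) • x j) {i j : I} (hij : i ≠ j) (k : I) :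
    ⁅y k, ((LieAlgebra.ad ℂ L (x i)) ^ ((-A i j).toNat + 1)) (x j)⁆ = 0 := by
  have hn : (((-A i j).toNat : ℤ)) = -A i j := Int.toNat_of_nonneg (by have := hA.offDiag i j hij; omega)
  by_cases hki : k = i
  · subst hki
    -- The exponent `n = -a_ij` equals the highest weight `λ`, so the factor `λ - n` vanishes.
    rw [lie_ad_pow_succ (hyx k) (by rw [htx, hA.diag]; norm_num) (hyx_ne k j hij) (htx k j)]
    have : ((-A k j).toNat : ℂ) = -(A k j : ℂ) := by exact_mod_cast congrArg (Int.cast (R := ℂ)) hn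
    rw [this, sub_self, mul_zero, zero_smul]
  · rw [lie_ad_pow_of_lie_eq_zero (hyx_ne k i hki)]
    by_cases hkj : k = j
    · subst hkj
      have h1 : ⁅x i, t k⁆ = (A k i : ℂ) • x i := by rw [← lie_skew, htx, neg_smul, neg_neg]
      rw [hyx, pow_succ, Module.End.mul_apply, LieAlgebra.ad_apply, h1]
      -- One more `ad x_i` would kill the multiple `a_ki x_i`. If `a_ik = 0` no such factor is left,
      -- but then `a_ki = 0` as well.
      by_cases h0 : A i k = 0
      · rw [hA.symm_zero h0]; simp
      · obtain ⟨n, hn'⟩ : ∃ n, (-A i k).toNat = n + 1 := ⟨(-A i k).toNat - 1, by omega⟩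
        rw [hn', pow_succ, Module.End.mul_apply, LieAlgebra.ad_apply, lie_smul, lie_self,
          smul_zero, map_zero]
    · rw [hyx_ne k j hkj, map_zero]

theorem brWord_serre (x : I → L) (i j : I) (n : ℕ) :
    brWord x (List.replicate n i ++ [j]) = ((LieAlgebra.ad ℂ L (x i)) ^ n) (x j) := by
  induction n with
  | zero => rfl
  | succ n ih =>
    rw [List.replicate_succ, List.cons_append, brWord_cons x i (by simp), ih, pow_succ',
      Module.End.mul_apply, LieAlgebra.ad_apply]

theorem map_brWord {L' : Type*} [LieRing L'] [LieAlgebra ℂ L'] (φ : L →ₗ⁅ℂ⁆ L') (x : I → L)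
    (l : List I) : φ (brWord x l) = brWord (fun i => φ (x i)) l := by
  induction l with
  | nil => exact map_zero φ
  | cons i l ih =>
    by_cases hl : l = []
    · subst hl; rfl
    · rw [brWord_cons _ _ hl, brWord_cons _ _ hl, LieHom.map_lie, ih]

end Sl2

/-! ### A Verma module with the Serre relations of `𝔫⁻` divided out -/

section VermaModule

attribute [local instance] LieRing.ofAssociativeRing

namespace Verma

variable (A : Matrix I I ℤ)

/-- The space of noncommutative polynomials in the `f_i`. -/
def T (I : Type*) := List I →₀ ℂ

instance : AddCommGroup (T I) := inferInstanceAs (AddCommGroup (List I →₀ ℂ))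

instance : Module ℂ (T I) := inferInstanceAs (Module ℂ (List I →₀ ℂ))

/-- A word as a basis vector. -/
def word (l : List I) : T I := (Finsupp.single l 1 : List I →₀ ℂ)

theorem hom_ext {M : Type*} [AddCommGroup M] [Module ℂ M] {φ ψ : T I →ₗ[ℂ] M}
    (H : ∀ l, φ (word l) = ψ (word l)) : φ = ψ :=
  Finsupp.lhom_ext' (φ := (φ : (List I →₀ ℂ) →ₗ[ℂ] M)) (ψ := (ψ : (List I →₀ ℂ) →ₗ[ℂ] M))
    fun l => LinearMap.ext_ring (H l)

/-- The linear map with prescribed values on words. -/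
def ofWords {M : Type*} [AddCommGroup M] [Module ℂ M] (v : List I → M) : T I →ₗ[ℂ] M :=
  (Finsupp.linearCombination ℂ v : (List I →₀ ℂ) →ₗ[ℂ] M)

@[simp] theorem ofWords_word {M : Type*} [AddCommGroup M] [Module ℂ M] (v : List I → M)
    (l : List I) : ofWords v (word l) = v l :=
  (Finsupp.linearCombination_single ℂ 1 l).trans (one_smul ℂ _)

/-- `f_i` acts by prepending a letter. -/
def opF (i : I) : Module.End ℂ (T I) := ofWords fun l => word (i :: l)

@[simp] theorem opF_word (i : I) (l : List I) : opF i (word l) = word (i :: l) := ofWords_word _ _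

/-- The `h_i`-eigenvalue of a word. -/
def hEig (i : I) (l : List I) : ℂ := -((l.map fun j => (A i j : ℂ)).sum)

theorem hEig_cons (i j : I) (l : List I) : hEig A i (j :: l) = hEig A i l - A i j := by
  simp [hEig]; ring

/-- `h_i` acts diagonally. -/
def opH (i : I) : Module.End ℂ (T I) := ofWords fun l => hEig A i l • word l

@[simp] theorem opH_word (i : I) (l : List I) : opH A i (word l) = hEig A i l • word l :=
  ofWords_word _ _

/-- The action of `e_k` on words. -/
def eWord (k : I) : List I → T I
  | [] => 0
  | j :: l => opF j (eWord k l) + if k = j then hEig A k l • word l else 0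

/-- The action of `e_k`. -/
def opE (k : I) : Module.End ℂ (T I) := ofWords (eWord A k)

@[simp] theorem opE_nil (k : I) : opE A k (word []) = 0 := ofWords_word _ _

theorem opE_cons (k j : I) (l : List I) : opE A k (word (j :: l)) =
    opF j (opE A k (word l)) + if k = j then opH A k (word l) else 0 := by
  simp [opE, eWord]

theorem lie_opE_opF_same (k : I) : ⁅opE A k, opF k⁆ = opH A k := by
  refine hom_ext fun l => ?_
  rw [LieRing.of_associative_ring_bracket]
  simp [opE_cons]

theorem lie_opE_opF_ne {k j : I} (hkj : k ≠ j) : ⁅opE A k, opF j⁆ = 0 := by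
  refine hom_ext fun l => ?_
  rw [LieRing.of_associative_ring_bracket]
  simp [opE_cons, hkj]

theorem lie_opH_opF (i j : I) : ⁅opH A i, opF j⁆ = -(A i j : ℂ) • opF j := by
  refine hom_ext fun l => ?_
  rw [LieRing.of_associative_ring_bracket]
  simp [hEig_cons, sub_smul]

theorem lie_opH_opH (i j : I) : ⁅opH A i, opH A j⁆ = 0 := by
  refine hom_ext fun l => ?_
  rw [LieRing.of_associative_ring_bracket]
  simp [smul_smul, mul_comm]

/-- An operator commuting with all `f_j` and killing the empty word vanishes. -/
theorem eq_zero_of_lie_opF {P : Module.End ℂ (T I)} (hP : ∀ j : I, ⁅opF j, P⁆ = 0)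
    (h0 : P (word []) = 0) : P = 0 := by
  refine hom_ext fun l => ?_
  induction l with
  | nil => simpa using h0
  | cons j l ih =>
    have h1 := congrArg (fun Q : Module.End ℂ (T I) => Q (word l)) (hP j)
    rw [LieRing.of_associative_ring_bracket] at h1
    simp only [LinearMap.sub_apply, Module.End.mul_apply, opF_word, ih, LinearMap.zero_apply,
      map_zero, zero_sub, neg_eq_zero] at h1
    simpa using h1

theorem lie_opH_opE (i j : I) : ⁅opH A i, opE A j⁆ = (A i j : ℂ) • opE A j := by
  rw [← sub_eq_zero]
  refine eq_zero_of_lie_opF (fun k => ?_) ?_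
  · have h1 : ⁅opF k, opH A i⁆ = (A i k : ℂ) • opF k := by
      rw [← lie_skew, lie_opH_opF, neg_smul, neg_neg]
    rw [lie_sub, lie_smul, leibniz_lie, h1, smul_lie]
    by_cases hjk : j = k
    · subst hjk
      have h2 : ⁅opF j, opE A j⁆ = -opH A j := by rw [← lie_skew, lie_opE_opF_same]
      rw [h2, lie_neg, lie_opH_opH]
      module
    · have h2 : ⁅opF k, opE A j⁆ = 0 := by rw [← lie_skew, lie_opE_opF_ne A hjk, neg_zero]
      rw [h2]; simp
  · simp [LieRing.of_associative_ring_bracket]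

/-- Serre elements as operators. -/
def opS (i j : I) : Module.End ℂ (T I) :=
  brWord opF (List.replicate ((-A i j).toNat + 1) i ++ [j])

variable {A}

theorem lie_opE_opS (hA : IsIndecSymmGCM A) {i j : I} (hij : i ≠ j) (k : I) :
    ⁅opE A k, opS A i j⁆ = 0 := by
  rw [opS, brWord_serre]
  exact lie_serre_eq_zero hA (y := opE A) (t := opH A) (fun _ _ h => lie_opE_opF_ne A h)
    (lie_opE_opF_same A) (lie_opH_opF A) hij k

theorem ad_pow_opE_nil {P : Module.End ℂ (T I)} (hP : P (word []) = 0) (i : I) (n : ℕ) :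
    ((LieAlgebra.ad ℂ (Module.End ℂ (T I)) (opE A i)) ^ n) P (word []) = 0 := by
  induction n with
  | zero => simpa using hP
  | succ n ih =>
    rw [pow_succ', Module.End.mul_apply, LieAlgebra.ad_apply, LieRing.of_associative_ring_bracket,
      LinearMap.sub_apply, Module.End.mul_apply, Module.End.mul_apply, ih, opE_nil, map_zero,
      map_zero, sub_zero]

theorem opE_serre (hA : IsIndecSymmGCM A) (i j : I) :
    ((LieAlgebra.ad ℂ (Module.End ℂ (T I)) (opE A i)) ^ (-A i j).toNat) ⁅opE A i, opE A j⁆ = 0 := by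
  by_cases hij : i = j
  · subst hij; simp
  -- The same computation with the roles of `e` and `f` exchanged: the Serre element in the `e_i`
  -- commutes with all `opF k`. It also kills the empty word, hence it is zero.
  · have h1 := fun k => lie_serre_eq_zero hA (x := opE A) (y := opF) (t := fun i => -opH A i)
      (fun a b hab => by rw [← lie_skew, lie_opE_opF_ne A (Ne.symm hab), neg_zero])
      (fun a => by rw [← lie_skew, lie_opE_opF_same])
      (fun a b => by rw [neg_lie, lie_opH_opE, neg_smul]) hij k
    have h2 := eq_zero_of_lie_opF h1 (ad_pow_opE_nil (opE_nil A j) i _)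
    rwa [pow_succ] at h2

/-- The composition of the operators `f_i` along a word. -/
def opWord (u : List I) : Module.End ℂ (T I) := (u.map opF).prod

variable (A) in
/-- The two-sided ideal generated by the Serre elements. -/
def serreIdeal : Submodule ℂ (T I) :=
  Submodule.span ℂ {x | ∃ (u : List I) (i j : I) (v : List I), i ≠ j ∧
    x = opWord u (opS A i j (word v))}

theorem opS_mem {i j : I} (hij : i ≠ j) (y : T I) : opS A i j y ∈ serreIdeal A := by
  have : (serreIdeal A).mkQ ∘ₗ opS A i j = 0 := hom_ext fun l =>
    (Submodule.Quotient.mk_eq_zero _).2 (Submodule.subset_span ⟨[], i, j, l, hij, rfl⟩)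
  exact (Submodule.Quotient.mk_eq_zero _).1 (congrArg (fun φ : T I →ₗ[ℂ] _ => φ y) this)

theorem opF_serreIdeal (k : I) {y : T I} (hy : y ∈ serreIdeal A) : opF k y ∈ serreIdeal A := by
  suffices h : serreIdeal A ≤ (serreIdeal A).comap (opF k) from h hy
  refine Submodule.span_le.2 ?_
  rintro _ ⟨u, i, j, v, hij, rfl⟩
  exact Submodule.subset_span ⟨k :: u, i, j, v, hij, rfl⟩

theorem serreIdeal_induction {P : Module.End ℂ (T I)}
    (h0 : ∀ i j v, i ≠ j → P (opS A i j (word v)) ∈ serreIdeal A)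
    (hs : ∀ k, ∀ y ∈ serreIdeal A, P y ∈ serreIdeal A → P (opF k y) ∈ serreIdeal A) {y : T I}
    (hy : y ∈ serreIdeal A) : P y ∈ serreIdeal A := by
  suffices h : serreIdeal A ≤ (serreIdeal A).comap P from h hy
  refine Submodule.span_le.2 ?_
  rintro _ ⟨u, i, j, v, hij, rfl⟩
  change P _ ∈ serreIdeal A
  induction u with
  | nil => exact h0 i j v hij
  | cons k u ih => exact hs k _ (Submodule.subset_span ⟨u, i, j, v, hij, rfl⟩) ih

theorem commute_apply {P Q R : Module.End ℂ (T I)} (h : ⁅P, Q⁆ = R) (y : T I) :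
    P (Q y) = Q (P y) + R y := by
  rw [← h, LieRing.of_associative_ring_bracket]
  simp

theorem opH_serreIdeal (k : I) {y : T I} (hy : y ∈ serreIdeal A) : opH A k y ∈ serreIdeal A := by
  refine serreIdeal_induction (fun i j v hij => ?_) (fun i y hy h => ?_) hy
  · obtain ⟨c, hc⟩ := cartan_lie_brWord (t := opH A) (x := opF)
      (fun i j => ⟨_, lie_opH_opF A i j⟩) k (List.replicate ((-A i j).toNat + 1) i ++ [j])
    rw [commute_apply (Q := opS A i j) hc]
    exact add_mem (opS_mem hij _) (Submodule.smul_mem _ _ (opS_mem hij _))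
  · rw [commute_apply (lie_opH_opF A k i)]
    exact add_mem (opF_serreIdeal i h) (Submodule.smul_mem _ _ (opF_serreIdeal i hy))

theorem opE_serreIdeal (hA : IsIndecSymmGCM A) (k : I) {y : T I} (hy : y ∈ serreIdeal A) :
    opE A k y ∈ serreIdeal A := by
  refine serreIdeal_induction (fun i j v hij => ?_) (fun i y hy h => ?_) hy
  · rw [commute_apply (lie_opE_opS hA hij k), LinearMap.zero_apply, add_zero]
    exact opS_mem hij _
  · by_cases hki : k = i
    · subst hki
      rw [commute_apply (lie_opE_opF_same A k)]
      exact add_mem (opF_serreIdeal k h) (opH_serreIdeal k hy)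
    · rw [commute_apply (lie_opE_opF_ne A hki), LinearMap.zero_apply, add_zero]
      exact opF_serreIdeal i h

variable (A) in
/-- The operators preserving the Serre ideal. -/
def stab : LieSubalgebra ℂ (Module.End ℂ (T I)) where
  carrier := {P | ∀ y ∈ serreIdeal A, P y ∈ serreIdeal A}
  add_mem' hP hQ y hy := add_mem (hP y hy) (hQ y hy)
  zero_mem' y _ := zero_mem _
  smul_mem' c P hP y hy := Submodule.smul_mem _ _ (hP y hy)
  lie_mem' {P Q} hP hQ y hy := by
    rw [LieRing.of_associative_ring_bracket]
    exact sub_mem (hP _ (hQ y hy)) (hQ _ (hP y hy))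

variable (A) in
/-- The action of the stabilizer on the quotient by the Serre ideal. -/
def toQuot : stab A →ₗ⁅ℂ⁆ Module.End ℂ (T I ⧸ serreIdeal A) where
  toFun P := (serreIdeal A).mapQ (serreIdeal A) P.1 P.2
  map_add' _ _ := Submodule.linearMap_qext _ rfl
  map_smul' _ _ := Submodule.linearMap_qext _ rfl
  map_lie' {_ _} := Submodule.linearMap_qext _ rfl

theorem toQuot_mk (P : stab A) (y : T I) :
    toQuot A P (Submodule.Quotient.mk y) = Submodule.Quotient.mk (P.1 y) := rfl

/-- `opE` as an element of the stabilizer. -/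
def sE (hA : IsIndecSymmGCM A) (i : I) : stab A := ⟨opE A i, fun _ hy => opE_serreIdeal hA i hy⟩

variable (A) in
/-- `opF` as an element of the stabilizer. -/
def sF (i : I) : stab A := ⟨opF i, fun _ hy => opF_serreIdeal i hy⟩

variable (A) in
/-- `opH` as an element of the stabilizer. -/
def sH (i : I) : stab A := ⟨opH A i, fun _ hy => opH_serreIdeal i hy⟩

/-- Only the Serre relations of the `f_i` need the quotient; all others hold already on `T I`. The
ideal contains the products with words on the right too, so that `opS A i j` acts as zero on the
whole quotient. -/
theorem rels_toQuot (hA : IsIndecSymmGCM A) : Rels A (fun i => toQuot A (sE hA i))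
    (fun i => toQuot A (sF A i)) (fun i => toQuot A (sH A i)) where
  hh i j := by
    rw [← LieHom.map_lie, show ⁅sH A i, sH A j⁆ = 0 from Subtype.ext (lie_opH_opH A i j), map_zero]
  ef_same i := by
    rw [← LieHom.map_lie, show ⁅sE hA i, sF A i⁆ = sH A i from Subtype.ext (lie_opE_opF_same A i)]
  ef_ne i j hij := by
    rw [← LieHom.map_lie, show ⁅sE hA i, sF A j⁆ = 0 from Subtype.ext (lie_opE_opF_ne A hij),
      map_zero]
  he i j := by
    rw [← LieHom.map_lie, ← Int.cast_smul_eq_zsmul ℂ, ← map_smul]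
    exact congrArg _ (Subtype.ext (lie_opH_opE A i j))
  hf i j := by
    rw [← LieHom.map_lie, ← Int.cast_smul_eq_zsmul ℂ, ← neg_smul, ← map_smul]
    exact congrArg _ (Subtype.ext (lie_opH_opF A i j))
  serre_e i j := by
    rw [← LieHom.map_lie, ← map_ad_pow]
    have : ((LieAlgebra.ad ℂ (stab A) (sE hA i)) ^ (-A i j).toNat) ⁅sE hA i, sE hA j⁆ = 0 := by
      refine Subtype.ext ?_
      exact (map_ad_pow (stab A).incl _ _ _).trans (opE_serre hA i j)
    rw [this, map_zero]
  serre_f i j := by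
    by_cases hij : i = j
    · subst hij; simp
    · rw [← LieHom.map_lie, ← map_ad_pow]
      refine Submodule.linearMap_qext _ (LinearMap.ext fun y => ?_)
      change toQuot A _ (Submodule.Quotient.mk y) = 0
      rw [toQuot_mk, Submodule.Quotient.mk_eq_zero]
      have h1 : (((LieAlgebra.ad ℂ (stab A) (sF A i)) ^ (-A i j).toNat) ⁅sF A i, sF A j⁆).1 =
          opS A i j := by
        rw [opS, brWord_serre, pow_succ]
        exact map_ad_pow (stab A).incl _ _ _
      rw [h1]
      exact opS_mem hij y

/-- Let both sides of the relation act on the class of the empty word. The `f_i` act by left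
multiplication, so the Lie polynomial itself appears, and it must vanish modulo the Serre ideal. -/
theorem sum_brWord_mem_serreIdeal (hA : IsIndecSymmGCM A) {s : Finset (List I)} {a : List I → ℂ}
    (h0 : ∑ l ∈ s, a l • brWord (f A) l = 0) :
    ∑ l ∈ s, a l • brWord opF l (word []) ∈ serreIdeal A := by
  have h1 := congrArg (fun x => lift (rels_toQuot hA) x (Submodule.Quotient.mk (word []))) h0
  simp only [map_sum, map_smul, map_zero, map_brWord, lift_f, LinearMap.zero_apply,
    LinearMap.sum_apply, LinearMap.smul_apply] at h1
  rw [← Submodule.Quotient.mk_eq_zero, ← h1]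
  rw [← Submodule.mkQ_apply, map_sum]
  refine Finset.sum_congr rfl fun l _ => ?_
  rw [map_smul, ← map_brWord (toQuot A) (sF A), toQuot_mk]
  rw [← Submodule.mkQ_apply]
  congr 2
  exact congrArg (fun P : Module.End ℂ (T I) => P (word []))
    (map_brWord (stab A).incl (sF A) l).symm

/-! ### Dynkin's operator -/

section Dynkin

variable {L : Type*} [LieRing L] [LieAlgebra ℂ L] (x : I → L)

/-- The right-normed bracketing map on the words of length `n`. -/
def dynkin (n : ℕ) : T I →ₗ[ℂ] L := ofWords fun l => if l.length = n then brWord x l else 0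

variable (I) in
/-- The constant term. -/
def constTerm : T I →ₗ[ℂ] ℂ := ofWords fun l => if l = [] then 1 else 0

theorem constTerm_word (l : List I) : constTerm I (word l) = if l = [] then 1 else 0 :=
  ofWords_word _ _

variable (I) in
/-- Polynomials without constant term. -/
def Tpos : Submodule ℂ (T I) := LinearMap.ker (constTerm I)

theorem opF_mem_Tpos (i : I) (y : T I) : opF i y ∈ Tpos I := by
  have : constTerm I ∘ₗ opF i = 0 :=
    hom_ext fun l => by rw [LinearMap.comp_apply, opF_word, constTerm_word]; simp
  exact congrArg (fun φ : T I →ₗ[ℂ] ℂ => φ y) this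

theorem word_mem_Tpos {l : List I} (hl : l ≠ []) : word l ∈ Tpos I := by
  simp [Tpos, constTerm_word, hl]

theorem dynkin_zero (y : T I) : dynkin x 0 y = 0 := by
  have : dynkin x 0 = 0 := hom_ext fun l => by
    rw [dynkin, ofWords_word]
    split_ifs with h
    · rw [List.length_eq_zero_iff.1 h]; rfl
    · rfl
  rw [this, LinearMap.zero_apply]

theorem dynkin_word (n : ℕ) (l : List I) :
    dynkin x n (word l) = if l.length = n then brWord x l else 0 := ofWords_word _ _

/-- The bracketing map turns a leading letter into `ad x_i`. A constant term must be excluded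
because the empty bracket is 0 whereas the word `[i]` goes to `x_i`. For `n = 0` the truncated `n -
1` does no harm, both sides being zero. -/
theorem dynkin_opF (n : ℕ) (i : I) {y : T I} (hy : y ∈ Tpos I) :
    dynkin x n (opF i y) = ⁅x i, dynkin x (n - 1) y⁆ := by
  have key : dynkin x n ∘ₗ opF i - (LieAlgebra.ad ℂ L (x i)) ∘ₗ dynkin x (n - 1) =
      (LinearMap.toSpanSingleton ℂ L (if n = 1 then x i else 0)) ∘ₗ constTerm I := by
    refine hom_ext fun l => ?_
    by_cases hl : l = []
    · subst hl
      simp only [LinearMap.sub_apply, LinearMap.comp_apply, opF_word, dynkin_word,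
        LieAlgebra.ad_apply]
      simp [constTerm_word, brWord, eq_comm]
    · have h1 : (l.length + 1 = n) ↔ l.length = n - 1 := by
        have := List.length_pos_iff.2 hl
        omega
      simp only [LinearMap.sub_apply, LinearMap.comp_apply, opF_word, dynkin_word,
        LieAlgebra.ad_apply, List.length_cons, h1, brWord_cons x i hl]
      split_ifs <;> simp [constTerm_word, hl]
  have h2 := congrArg (fun φ : T I →ₗ[ℂ] L => φ y) key
  simp only [LinearMap.sub_apply, LinearMap.comp_apply, LieAlgebra.ad_apply,
    show constTerm I y = 0 from hy, map_zero] at h2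
  exact sub_eq_zero.1 h2

theorem brWord_opF_mem_Tpos {l : List I} (hl : l ≠ []) {y : T I} : brWord opF l y ∈ Tpos I := by
  induction l generalizing y with
  | nil => exact absurd rfl hl
  | cons i l ih =>
    by_cases h : l = []
    · subst h; exact opF_mem_Tpos i y
    · rw [brWord_cons _ _ h, LieRing.of_associative_ring_bracket]
      exact sub_mem (opF_mem_Tpos _ _) (ih h)

/-- Iterating `dynkin_opF`: left multiplication by a Lie polynomial becomes the adjoint action of
its value at `x`. -/
theorem dynkin_brWord (n : ℕ) {l : List I} (hl : l ≠ []) {y : T I} (hy : y ∈ Tpos I) :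
    dynkin x n (brWord opF l y) = ⁅brWord x l, dynkin x (n - l.length) y⁆ := by
  induction l generalizing n y with
  | nil => exact absurd rfl hl
  | cons i l ih =>
    by_cases h : l = []
    · subst h; exact dynkin_opF x n i hy
    · rw [brWord_cons _ _ h, brWord_cons _ _ h, LieRing.of_associative_ring_bracket,
        LinearMap.sub_apply, Module.End.mul_apply, Module.End.mul_apply, map_sub,
        dynkin_opF x n i (brWord_opF_mem_Tpos h), ih _ h hy, ih _ h (opF_mem_Tpos i y),
        dynkin_opF x _ i hy, lie_lie, List.length_cons, Nat.sub_sub, Nat.sub_sub, add_comm 1]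

/-- The Dynkin–Specht–Wever theorem. For `P = iQ - Qi` of degree `n`, the first product contributes
`(n-1)[x_i, Q(x)]` by induction and the second `[Q(x), x_i]` by `dynkin_brWord`. -/
theorem dynkin_brWord_nil (n : ℕ) {l : List I} (hl : l ≠ []) :
    dynkin x n (brWord opF l (word [])) = if l.length = n then (n : ℂ) • brWord x l else 0 := by
  induction l generalizing n with
  | nil => exact absurd rfl hl
  | cons i l ih =>
    by_cases h : l = []
    · subst h
      rw [brWord_singleton, opF_word, dynkin_word]
      simp only [List.length_singleton]
      split_ifs with h1
      · subst h1; simp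
      · rfl
    · rw [brWord_cons _ _ h, brWord_cons _ _ h, LieRing.of_associative_ring_bracket,
        LinearMap.sub_apply, Module.End.mul_apply, Module.End.mul_apply, map_sub,
        dynkin_opF x n i (brWord_opF_mem_Tpos h), ih _ h, dynkin_brWord x n h (opF_mem_Tpos i _),
        opF_word, dynkin_word]
      have hpos := List.length_pos_iff.2 h
      simp only [List.length_cons, List.length_nil, brWord_singleton]
      by_cases hn : l.length + 1 = n
      · subst hn
        rw [if_pos (by omega), if_pos (by omega), if_pos rfl, ← lie_skew (x i) (brWord x l),
          lie_smul, ← lie_skew (x i) (brWord x l)]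
        simp only [Nat.add_sub_cancel]
        push_cast
        module
      · rw [if_neg (by omega), if_neg (by omega), if_neg hn]
        simp

end Dynkin

end Verma

/-! ### Lifting relations between the `f_i` to filtered Lie algebras -/

open Verma

/-- If the Serre elements in the family `x` have lower filtration degree than expected, then so
has every linear relation between the right-normed brackets of the `f_i`. -/
theorem sum_brWord_mem_of_serre {A : Matrix I I ℤ} (hA : IsIndecSymmGCM A) {L : Type*} [LieRing L]
    [LieAlgebra ℂ L] {x : I → L} {K : ℕ → Submodule ℂ L} (hmono : Monotone K)
    (hx : ∀ i, x i ∈ K 1) (hlie : ∀ a b, ∀ y ∈ K a, ∀ z ∈ K b, ⁅y, z⁆ ∈ K (a + b))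
    (hS : ∀ i j, i ≠ j → ((LieAlgebra.ad ℂ L (x i)) ^ ((-A i j).toNat + 1)) (x j) ∈
      K ((-A i j).toNat + 1))
    {m : ℕ} (hm : m ≠ 0) {s : Finset (List I)} (hs : ∀ l ∈ s, l.length = m) {a : List I → ℂ}
    (h0 : ∑ l ∈ s, a l • brWord (f A) l = 0) :
    ∑ l ∈ s, a l • brWord x l ∈ K (m - 1) := by
  have hword : ∀ n l, dynkin x n (word l) ∈ K n := by
    intro n l
    rw [dynkin_word]
    split_ifs with h
    · subst h
      induction l with
      | nil => exact zero_mem _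
      | cons i l ih =>
        by_cases hl : l = []
        · subst hl; exact hx i
        · rw [brWord_cons _ _ hl, List.length_cons, add_comm]
          exact hlie _ _ _ (hx i) _ ih
    · exact zero_mem _
  -- On a product `u S v` with a Serre element `S`, the letters of `u` act by brackets, while `S v`
  -- goes to a multiple of `S(x)` if `v` is empty and to the bracket of `S(x)` with the image of `v`
  -- otherwise. The drop of degree assumed for `S(x)` is inherited either way.
  have hgen : ∀ n, serreIdeal A ≤ (K (n - 1)).comap (dynkin x n) := by
    intro n
    refine Submodule.span_le.2 ?_
    rintro _ ⟨u, i, j, v, hij, rfl⟩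
    change dynkin x n _ ∈ K (n - 1)
    have hne : List.replicate ((-A i j).toNat + 1) i ++ [j] ≠ [] := by simp
    have hlen : (List.replicate ((-A i j).toNat + 1) i ++ [j]).length = (-A i j).toNat + 2 := by
      simp
    have hSij := hS i j hij
    rw [← brWord_serre] at hSij
    induction u generalizing n with
    | nil =>
      change dynkin x n (opS A i j (word v)) ∈ K (n - 1)
      rw [opS]
      by_cases hv : v = []
      · subst hv
        rw [dynkin_brWord_nil x n hne]
        split_ifs with h
        · exact Submodule.smul_mem _ _ (hmono (by omega) hSij)
        · exact zero_mem _
      · rw [dynkin_brWord x n hne (word_mem_Tpos hv), hlen]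
        rcases Nat.lt_or_ge n ((-A i j).toNat + 2) with h | h
        · rw [show n - ((-A i j).toNat + 2) = 0 by omega, dynkin_zero, lie_zero]
          exact zero_mem _
        · exact hmono (by omega) (hlie _ _ _ hSij _ (hword (n - ((-A i j).toNat + 2)) v))
    | cons k u ih =>
      change dynkin x n (opF k (opWord u _)) ∈ K (n - 1)
      have hpos : opWord u (opS A i j (word v)) ∈ Tpos I := by
        cases u with
        | nil => exact brWord_opF_mem_Tpos hne
        | cons k' u => exact opF_mem_Tpos _ _
      rw [dynkin_opF x n k hpos]
      rcases Nat.lt_or_ge n 2 with h | h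
      · rw [show n - 1 = 0 by omega, dynkin_zero, lie_zero]
        exact zero_mem _
      · have := hlie _ _ _ (hx k) _ (ih (n - 1))
        rwa [show 1 + (n - 1 - 1) = n - 1 by omega] at this
  have h1 := hgen m (sum_brWord_mem_serreIdeal hA h0)
  change dynkin x m _ ∈ K (m - 1) at h1
  have h2 : dynkin x m (∑ l ∈ s, a l • brWord opF l (word [])) =
      (m : ℂ) • ∑ l ∈ s, a l • brWord x l := by
    rw [map_sum, Finset.smul_sum]
    refine Finset.sum_congr rfl fun l hl => ?_
    rw [map_smul, dynkin_brWord_nil x m (by rintro rfl; exact hm (hs _ hl).symm),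
      if_pos (hs l hl), smul_comm]
  rw [h2] at h1
  exact (Submodule.smul_mem_iff _ (by exact_mod_cast hm)).1 h1

/-- Send every `f_i` to 1 in the abelian Lie algebra `ℂ`, filtered by `K 0 = 0` and `K n = ℂ` for `n
> 0`. The relation `f_i = 0` would put 1 into `K 0`. -/
theorem f_ne_zero {A : Matrix I I ℤ} (hA : IsIndecSymmGCM A) (i : I) : f A i ≠ 0 := by
  intro h0
  let K : ℕ → Submodule ℂ ℂ := fun n => if n = 0 then ⊥ else ⊤
  have hK : ∀ n, n ≠ 0 → K n = ⊤ := fun n hn => if_neg hn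
  have hlie : ∀ y z : ℂ, ⁅y, z⁆ = 0 := fun y z => by
    rw [LieRing.of_associative_ring_bracket, mul_comm, sub_self]
  have h1 := sum_brWord_mem_of_serre hA (x := fun _ : I => (1 : ℂ)) (K := K)
    (fun a b hab => by
      by_cases ha : a = 0
      · simp [K, ha]
      · rw [hK b (by omega)]; exact le_top)
    (fun _ => by rw [hK 1 one_ne_zero]; trivial)
    (fun a b y _ z _ => by rw [hlie]; exact zero_mem _)
    (fun _ _ _ => by rw [hK _ (Nat.succ_ne_zero _)]; trivial)
    (m := 1) one_ne_zero (s := {[i]}) (by simp) (a := fun _ => 1) (by simpa using h0)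
  simp [K] at h1

end VermaModule

end KacMoody

namespace KacMoody

open CartanMatrix

variable {I : Type*} [DecidableEq I]

/-! ### The automorphism `θ` -/

section Theta

variable [Fintype I]

/-- A generalized Satake diagram together with a reduced word of the longest element of `W_X`. -/
structure SatakeDatum (A : Matrix I I ℤ) (X : Finset I) (τ : Equiv.Perm I) (l : List I) : Prop where
  gcm : IsIndecSymmGCM A
  satake : IsGenSatake A X τ
  longest : IsLongestWord A X l

theorem e_ne_zero {A : Matrix I I ℤ} (hA : IsIndecSymmGCM A) (i : I) : e A i ≠ 0 := by
  intro h0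
  have h1 : chevalley A (e A i) = -f A i := lift_e _ i
  rw [h0, map_zero] at h1
  exact f_ne_zero hA i (neg_eq_zero.1 h1.symm)

namespace SatakeDatum

variable {A : Matrix I I ℤ} {X : Finset I} {τ : Equiv.Perm I} {l : List I}
  (H : SatakeDatum A X τ l)
include H

theorem word_mem : ∀ i ∈ l, i ∈ X := H.longest.1.1

theorem w_root {i : I} (hi : i ∈ X) : weylAct A l (simpleRoot i) = -simpleRoot (τ i) := by
  rw [← H.satake.compat l H.longest i hi, neg_neg]

theorem tau_mem {i : I} (hi : i ∈ X) : τ i ∈ X := by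
  by_contra hτ
  have h1 := congrFun (H.w_root hi) (τ i)
  rw [weylAct_apply_of_notMem H.word_mem _ hτ] at h1
  have hne : τ i ≠ i := fun h => hτ (by rwa [h])
  simp [simpleRoot, hne] at h1

theorem tau_mem_iff {i : I} : τ i ∈ X ↔ i ∈ X :=
  ⟨fun h => by rw [← H.satake.invol i]; exact H.tau_mem h, H.tau_mem⟩

theorem w_inv_root {i : I} (hi : i ∈ X) :
    weylAct A l.reverse (simpleRoot i) = -simpleRoot (τ i) := by
  have h1 := weylAct_reverse H.gcm l (simpleRoot (τ i))
  rw [H.w_root (H.tau_mem hi), H.satake.invol, ← weylHom_apply, map_neg, weylHom_apply] at h1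
  rw [← h1, neg_neg]

theorem w_inv_of_support {v : I → ℤ} (hv : ∀ i ∉ X, v i = 0) :
    weylAct A l.reverse v = -permAct τ v := by
  have hdec : v = ∑ i, v i • simpleRoot i := by
    funext k
    simp [simpleRoot, Finset.sum_apply, Pi.single_apply]
  have h1 : ∀ i, v i • weylHom A l.reverse (simpleRoot i) = v i • -simpleRoot (τ i) := by
    intro i
    by_cases hi : i ∈ X
    · rw [weylHom_apply, H.w_inv_root hi]
    · rw [hv i hi, zero_smul, zero_smul]
  conv_lhs => rw [hdec]
  rw [← weylHom_apply, map_sum]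
  simp only [map_zsmul, h1]
  funext k
  simp only [Finset.sum_apply, Pi.smul_apply, Pi.neg_apply, simpleRoot, Pi.single_apply, permAct,
    smul_eq_mul, mul_neg, mul_ite, mul_one, mul_zero, Finset.sum_neg_distrib]
  congr 1
  rw [Finset.sum_eq_single (τ.symm k)]
  · simp
  · intro i _ hi
    rw [if_neg]
    rintro rfl
    simp at hi
  · simp

/-- `Ad(m_u) e_j` is a nonzero vector of weight `u(α_j)`, whose coefficient at `j` is 1. A negative
coefficient elsewhere would force it to vanish. -/
theorem weyl_nonneg {u : List I} (hu : ∀ i ∈ u, i ∈ X) {j : I} (hj : j ∉ X) (k : I) :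
    0 ≤ (weylAct A u (simpleRoot j) - simpleRoot j) k := by
  have hjj : weylAct A u (simpleRoot j) j = 1 := by
    rw [weylAct_apply_of_notMem hu _ hj]; simp [simpleRoot]
  by_cases hkj : k = j
  · subst hkj
    rw [Pi.sub_apply, hjj]
    simp [simpleRoot]
  · by_contra hlt
    have hlt' : weylAct A u (simpleRoot j) k < 0 := by
      simpa [simpleRoot, hkj] using hlt
    have h0 := eq_zero_of_mixed (AdWordHom_mem_rootSpace H.gcm u (e_mem (A := A) j))
      (i := j) (j := k) (by rw [hjj]; exact one_pos) hlt'
    exact e_ne_zero H.gcm j (AdWordHom_injective u (by rw [h0, map_zero]))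

omit H in
variable (A l) in
/-- `γ_j = w_X(α_j) - α_j`. -/
def gam (j : I) : I → ℤ := weylAct A l (simpleRoot j) - simpleRoot j

omit H in
theorem w_eq_add_gam (j : I) : weylAct A l (simpleRoot j) = simpleRoot j + gam A l j := by
  rw [gam]; abel

theorem gam_nonneg {j : I} (hj : j ∉ X) (k : I) : 0 ≤ gam A l j k := H.weyl_nonneg H.word_mem hj k

theorem gam_notMem (j : I) {k : I} (hk : k ∉ X) : gam A l j k = 0 := by
  rw [gam, Pi.sub_apply, weylAct_apply_of_notMem H.word_mem _ hk, sub_self]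

theorem w_inv_eq_add (j : I) :
    weylAct A l.reverse (simpleRoot j) = simpleRoot j + permAct τ (gam A l j) := by
  have h1 := weylAct_reverse H.gcm l (simpleRoot j)
  rw [w_eq_add_gam, weylAct_add, H.w_inv_of_support fun k hk => H.gam_notMem j hk] at h1
  exact eq_add_of_add_neg_eq h1

/-- `θ` as a homomorphism of Lie algebras. -/
def thetaHom : Alg A →ₗ⁅ℂ⁆ Alg A :=
  (AdWordHom A l).comp ((diagramHom H.satake.diagramAut).comp (chevalley A))

theorem thetaHom_apply (x : Alg A) : H.thetaHom x = theta H.satake.diagramAut l x :=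
  AdWordHom_apply l _

theorem theta_f (i : I) : H.thetaHom (f A i) = -AdWordHom A l (e A (τ i)) := by
  simp [thetaHom, chevalley, diagramHom]

theorem theta_e (i : I) : H.thetaHom (e A i) = -AdWordHom A l (f A (τ i)) := by
  simp [thetaHom, chevalley, diagramHom]

theorem theta_f_mem (j : I) :
    H.thetaHom (f A j) ∈ rootSpace A (weylAct A l (simpleRoot (τ j))) := by
  rw [theta_f]
  exact neg_mem (AdWordHom_mem_rootSpace H.gcm l (e_mem _))

theorem theta_f_ne_zero (j : I) : H.thetaHom (f A j) ≠ 0 := by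
  rw [theta_f]
  intro h0
  exact e_ne_zero H.gcm (τ j) (AdWordHom_injective l (by rw [map_zero]; exact neg_eq_zero.1 h0))

theorem theta_f_of_mem {k : I} (hk : k ∈ X) : ∃ s : ℂ, s ≠ 0 ∧ H.thetaHom (f A k) = s • f A k := by
  have h1 := H.theta_f_mem k
  rw [H.w_root (H.tau_mem hk), H.satake.invol] at h1
  obtain ⟨s, hs⟩ := mem_span_f h1
  refine ⟨s, fun h0 => H.theta_f_ne_zero k ?_, hs⟩
  rw [hs, h0, zero_smul]

theorem AdWord_f_of_mem {k : I} (hk : k ∈ X) :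
    ∃ s : ℂ, s ≠ 0 ∧ AdWordHom A l (f A k) = s • e A (τ k) := by
  have h1 := AdWordHom_mem_rootSpace H.gcm l (f_mem (A := A) k)
  rw [← weylHom_apply, map_neg, weylHom_apply, H.w_root hk, neg_neg] at h1
  obtain ⟨s, hs⟩ := mem_span_e h1
  refine ⟨s, fun h0 => f_ne_zero H.gcm k (AdWordHom_injective l ?_), hs⟩
  rw [hs, h0, zero_smul, map_zero]

/-- `θ` scales `e_k` and `f_k`, hence scales `h_k` by the product of the two factors. Applying `θ`
to `[h_k, f_k] = -2f_k` shows that this product is 1. -/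
theorem theta_h_of_mem {k : I} (hk : k ∈ X) : H.thetaHom (h A k) = h A k := by
  obtain ⟨s, hs0, hs⟩ := H.theta_f_of_mem hk
  obtain ⟨t, -, ht⟩ := H.AdWord_f_of_mem (H.tau_mem hk)
  rw [H.satake.invol] at ht
  have h1 : H.thetaHom (h A k) = -(t * s) • h A k := by
    rw [← (rels A).ef_same, LieHom.map_lie, theta_e, ht, hs]
    simp [smul_smul, mul_comm]
  have h2 : H.thetaHom ⁅h A k, f A k⁆ = ⁅H.thetaHom (h A k), H.thetaHom (f A k)⁆ :=
    LieHom.map_lie _ _ _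
  rw [(rels A).hf, H.gcm.diag, ← Int.cast_smul_eq_zsmul ℂ, map_neg, map_smul, hs, h1, smul_lie,
    lie_smul, (rels A).hf, H.gcm.diag, ← Int.cast_smul_eq_zsmul ℂ] at h2
  have h3 : (2 * s * (1 + t * s)) • f A k = 0 := by
    rw [← sub_eq_zero] at h2
    rw [← neg_eq_zero, ← h2]
    push_cast
    module
  have h4 : 1 + t * s = 0 := by
    have := (smul_eq_zero.1 h3).resolve_right (f_ne_zero H.gcm k)
    simpa [hs0] using this
  rw [h1, show -(t * s) = 1 by linear_combination -h4, one_smul]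

theorem tau_ne {j k : I} (hj : j ∉ X) (hk : k ∈ X) : k ≠ j := fun h => hj (h ▸ hk)

/-- The bracket has weight `α_k + w_X(α_{τj})`, which `w_X⁻¹` maps to `α_{τj} - α_{τk}`, a non-root.
-/
theorem e_lie_theta {j k : I} (hj : j ∉ X) (hk : k ∈ X) : ⁅e A k, H.thetaHom (f A j)⁆ = 0 := by
  refine eq_zero_of_weyl H.gcm l.reverse (fun y hy => ?_)
    (lie_mem_rootSpace (e_mem k) (H.theta_f_mem j))
  rw [weylAct_add, weylAct_reverse H.gcm, H.w_inv_root hk] at hy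
  have hτj : τ j ∉ X := fun h => hj (H.tau_mem_iff.1 h)
  have hne : τ k ≠ τ j := fun h => hτj (h ▸ H.tau_mem hk)
  exact eq_zero_of_mixed hy (i := τ j) (j := τ k) (by simp [simpleRoot, hne.symm])
    (by simp [simpleRoot, hne])

/-- So `γ_j = 0` means that `j` is not joined to `X`. If `w_X` fixes `α_j`, then `Ad(m_{w_X})`
carries `[f_{τk}, e_j] = 0` to a nonzero multiple of `[e_k, e_j]`, and bracketing that with `f_k`
gives `-a_kj e_j`. -/
theorem cartan_zero_of_gam_eq_zero {j k : I} (hj : j ∉ X) (hk : k ∈ X) (h0 : gam A l j = 0) :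
    A k j = 0 := by
  obtain ⟨s, hs0, hs⟩ := H.AdWord_f_of_mem (H.tau_mem hk)
  rw [H.satake.invol] at hs
  have h1 := AdWordHom_mem_rootSpace H.gcm l (e_mem (A := A) j)
  rw [w_eq_add_gam, h0, add_zero] at h1
  obtain ⟨t, ht⟩ := mem_span_e h1
  have ht0 : t ≠ 0 := fun h0 =>
    e_ne_zero H.gcm j (AdWordHom_injective l (by rw [ht, h0, zero_smul, map_zero]))
  have hne : ∀ {i}, i ∈ X → ⁅f A i, e A j⁆ = 0 := fun {i} hi => by
    rw [← lie_skew, (rels A).ef_ne j i (H.tau_ne hj hi).symm, neg_zero]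
  have h2 : ⁅e A k, e A j⁆ = 0 := by
    have h3 := congrArg (AdWordHom A l) (hne (H.tau_mem hk))
    rw [LieHom.map_lie, hs, ht, map_zero, smul_lie, lie_smul, smul_smul] at h3
    exact (smul_eq_zero.1 h3).resolve_left (mul_ne_zero hs0 ht0)
  have h4 : ⁅f A k, ⁅e A k, e A j⁆⁆ = -(A k j • e A j) := by
    rw [leibniz_lie, lie_f_e, hne hk, lie_zero, add_zero, neg_lie, (rels A).he]
  rw [h2, lie_zero, ← Int.cast_smul_eq_zsmul ℂ, eq_comm, neg_eq_zero] at h4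
  exact_mod_cast (smul_eq_zero.1 h4).resolve_right (e_ne_zero H.gcm j)

theorem theta_f_of_isolated {j : I} (hj : j ∉ X) (h0 : ∀ k ∈ X, A k (τ j) = 0) :
    H.thetaHom (f A j) = -e A (τ j) := by
  rw [theta_f, AdWordHom_eq_self]
  intro k hk
  have hkX := H.word_mem k hk
  have hne : τ j ≠ k := fun h => hj (H.tau_mem_iff.1 (h ▸ hkX))
  refine ⟨?_, by rw [← lie_skew, (rels A).ef_ne _ _ hne, neg_zero]⟩
  have h1 := (rels A).serre_e k (τ j)
  rw [h0 k hkX] at h1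
  simpa using h1

theorem tau_isolated {j : I} (h0 : ∀ k ∈ X, A k j = 0) : ∀ k ∈ X, A k (τ j) = 0 := by
  intro k hk
  rw [← H.satake.diagramAut, H.satake.invol]
  exact h0 _ (H.tau_mem hk)

/-- In this case `θ(f_j) = -e_{τj}` is a nonzero vector both of weight `α_{τj}` and of weight
`w_X(α_{τj})`, so the two weights agree. -/
theorem gam_tau_eq_zero {j : I} (hj : j ∉ X) (h0 : gam A l j = 0) : gam A l (τ j) = 0 := by
  have h1 := H.tau_isolated fun k hk => H.cartan_zero_of_gam_eq_zero hj hk h0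
  have h2 := H.theta_f_of_isolated hj h1
  by_contra hne
  have h4 := Submodule.disjoint_def.1 ((iSupIndep_rootSpace A).pairwiseDisjoint
    (show weylAct A l (simpleRoot (τ j)) ≠ simpleRoot (τ j) from fun h => hne (by
      rw [gam, h, sub_self]))) _ (H.theta_f_mem j) (by rw [h2]; exact neg_mem (e_mem _))
  exact H.theta_f_ne_zero j h4

end SatakeDatum

end Theta

end KacMoody

namespace KacMoody

open CartanMatrix

variable {I : Type*} [DecidableEq I] [Fintype I]

/-! ### The height filtration -/

section Height

variable (A : Matrix I I ℤ)

/-- The elements of height `n`. -/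
def heightSpace (n : ℤ) : Submodule ℂ (Alg A) :=
  Module.End.eigenspace (degDer A fun _ => 1 : Alg A →ₗ[ℂ] Alg A) n

/-- The span of the elements of height at least `n`. -/
def heightGE (n : ℤ) : Submodule ℂ (Alg A) :=
  Submodule.span ℂ {x | ∃ s, n ≤ s ∧ x ∈ heightSpace A s}

variable {A}

theorem mem_heightSpace {n : ℤ} {x : Alg A} :
    x ∈ heightSpace A n ↔ degDer A (fun _ => 1) x = (n : ℂ) • x :=
  Module.End.mem_eigenspace_iff

theorem heightSpace_le {m n : ℤ} (hmn : m ≤ n) : heightSpace A n ≤ heightGE A m :=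
  fun _ hx => Submodule.subset_span ⟨n, hmn, hx⟩

theorem heightGE_anti {m n : ℤ} (hmn : m ≤ n) : heightGE A n ≤ heightGE A m :=
  Submodule.span_mono fun _ ⟨s, hs, hx⟩ => ⟨s, hmn.trans hs, hx⟩

theorem rootSpace_le_heightSpace (β : I → ℤ) : rootSpace A β ≤ heightSpace A (∑ i, β i) := by
  intro x hx
  rw [mem_heightSpace, mem_rootSpace.1 hx, wtEval]
  simp

theorem lie_mem_heightGE {m n : ℤ} {x y : Alg A} (hx : x ∈ heightGE A m) (hy : y ∈ heightGE A n) :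
    ⁅x, y⁆ ∈ heightGE A (m + n) := by
  induction hx using Submodule.span_induction with
  | mem x hx =>
    obtain ⟨s, hs, hx⟩ := hx
    induction hy using Submodule.span_induction with
    | mem y hy =>
      obtain ⟨t, ht, hy⟩ := hy
      refine heightSpace_le (add_le_add hs ht) ?_
      rw [mem_heightSpace] at *
      rw [LieDerivation.apply_lie_eq_add, hx, hy, lie_smul, smul_lie]
      push_cast
      module
    | zero => rw [lie_zero]; exact zero_mem _
    | add y z _ _ hy hz => rw [lie_add]; exact add_mem hy hz
    | smul c y _ hy => rw [lie_smul]; exact Submodule.smul_mem _ _ hy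
  | zero => rw [zero_lie]; exact zero_mem _
  | add y z _ _ hy hz => rw [add_lie]; exact add_mem hy hz
  | smul c y _ hy => rw [smul_lie]; exact Submodule.smul_mem _ _ hy

theorem eq_zero_of_heightSpace {n : ℤ} {x : Alg A} (hx : x ∈ heightSpace A n)
    (hx' : x ∈ heightGE A (n + 1)) : x = 0 := by
  refine Submodule.disjoint_def.1 (Module.End.eigenspaces_iSupIndep
    (degDer A fun _ => 1 : Alg A →ₗ[ℂ] Alg A) (n : ℂ)) x hx ?_
  refine Submodule.span_le.2 ?_ hx'
  rintro y ⟨s, hs, hy⟩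
  have hne : (s : ℂ) ≠ n := by
    intro h
    have : s = n := by exact_mod_cast h
    omega
  exact Submodule.mem_iSup_of_mem (s : ℂ) (Submodule.mem_iSup_of_mem hne hy)

theorem cartan_le_heightSpace : cartan A ≤ heightSpace A 0 := by
  have := rootSpace_le_heightSpace (A := A) 0
  simp only [Pi.zero_apply, Finset.sum_const_zero] at this
  exact cartan_le.trans this

theorem nPlus_le_heightGE (X : Finset I) : (nPlus A X).toSubmodule ≤ heightGE A 1 := by
  let S : LieSubalgebra ℂ (Alg A) :=
    { heightGE A 1 with
      lie_mem' := fun {x y} hx hy => heightGE_anti (by norm_num) (lie_mem_heightGE hx hy) }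
  have : nPlus A X ≤ S := by
    refine LieSubalgebra.lieSpan_le.2 ?_
    rintro _ ⟨i, _, rfl⟩
    refine heightSpace_le (le_refl 1) ?_
    rw [mem_heightSpace, degDer_e]
    simp
  exact this

theorem brWord_f_mem_heightSpace (w : List I) : brWord (f A) w ∈ heightSpace A (-w.length) := by
  rw [mem_heightSpace]
  induction w with
  | nil => simp [brWord]
  | cons i w ih =>
    by_cases hw : w = []
    · subst hw; simp [degDer_f]
    · rw [brWord_cons _ _ hw, LieDerivation.apply_lie_eq_add, ih, degDer_f, lie_smul, smul_lie,
        List.length_cons]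
      push_cast
      module

end Height

/-! ### The filtration of `𝔨_c` -/

/-- The elements of the Cartan subalgebra act by scalars on the generators. -/
theorem cartan_lie_f {A : Matrix I I ℤ} {x : Alg A} (hx : x ∈ cartan A) (j : I) :
    ∃ t : ℂ, ⁅x, f A j⁆ = t • f A j := by
  induction hx using Submodule.span_induction with
  | mem x hx => obtain ⟨i, rfl⟩ := hx; exact hf_scalar A i j
  | zero => exact ⟨0, by simp⟩
  | add x y _ _ hx hy =>
    obtain ⟨s, hs⟩ := hx
    obtain ⟨t, ht⟩ := hy
    exact ⟨s + t, by rw [add_lie, hs, ht, add_smul]⟩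
  | smul c x _ hx =>
    obtain ⟨s, hs⟩ := hx
    exact ⟨c * s, by rw [smul_lie, hs, smul_smul]⟩

theorem cartan_lie_e {A : Matrix I I ℤ} {x : Alg A} (hx : x ∈ cartan A) (j : I) :
    ∃ t : ℂ, ⁅x, e A j⁆ = t • e A j := by
  induction hx using Submodule.span_induction with
  | mem x hx => obtain ⟨i, rfl⟩ := hx; exact he_scalar A i j
  | zero => exact ⟨0, by simp⟩
  | add x y _ _ hx hy =>
    obtain ⟨s, hs⟩ := hx
    obtain ⟨t, ht⟩ := hy
    exact ⟨s + t, by rw [add_lie, hs, ht, add_smul]⟩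
  | smul c x _ hx =>
    obtain ⟨s, hs⟩ := hx
    exact ⟨c * s, by rw [smul_lie, hs, smul_smul]⟩

theorem h_mem_cartan (A : Matrix I I ℤ) (i : I) : h A i ∈ cartan A :=
  Submodule.subset_span ⟨i, rfl⟩

theorem cartan_lie_cartan {A : Matrix I I ℤ} {x y : Alg A} (hx : x ∈ cartan A)
    (hy : y ∈ cartan A) : ⁅x, y⁆ = 0 := by
  induction hx using Submodule.span_induction with
  | mem x hx =>
    obtain ⟨i, rfl⟩ := hx
    induction hy using Submodule.span_induction with
    | mem y hy => obtain ⟨j, rfl⟩ := hy; exact (rels A).hh i j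
    | zero => exact lie_zero _
    | add y z _ _ hy hz => rw [lie_add, hy, hz, add_zero]
    | smul c y _ hy => rw [lie_smul, hy, smul_zero]
  | zero => exact zero_lie _
  | add y z _ _ hy hz => rw [add_lie, hy, hz, add_zero]
  | smul c y _ hy => rw [smul_lie, hy, smul_zero]

theorem e_mem_nPlus {A : Matrix I I ℤ} {X : Finset I} {k : I} (hk : k ∈ X) : e A k ∈ nPlus A X :=
  LieSubalgebra.subset_lieSpan ⟨k, hk, rfl⟩

theorem cartan_lie_nPlus {A : Matrix I I ℤ} {X : Finset I} {x y : Alg A} (hx : x ∈ cartan A)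
    (hy : y ∈ nPlus A X) : ⁅x, y⁆ ∈ nPlus A X := by
  let S : LieSubalgebra ℂ (Alg A) :=
    { (nPlus A X).toSubmodule ⊓ (nPlus A X).toSubmodule.comap (LieAlgebra.ad ℂ (Alg A) x) with
      lie_mem' := by
        rintro y z ⟨hy, hy'⟩ ⟨hz, hz'⟩
        refine ⟨(nPlus A X).lie_mem hy hz, ?_⟩
        change ⁅x, ⁅y, z⁆⁆ ∈ nPlus A X
        rw [leibniz_lie]
        exact add_mem ((nPlus A X).lie_mem hy' hz) ((nPlus A X).lie_mem hy hz') }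
  have hS : nPlus A X ≤ S := by
    refine LieSubalgebra.lieSpan_le.2 ?_
    rintro _ ⟨k, hk, rfl⟩
    refine ⟨e_mem_nPlus hk, ?_⟩
    obtain ⟨t, ht⟩ := cartan_lie_e hx k
    change ⁅x, e A k⁆ ∈ nPlus A X
    rw [ht]
    exact (nPlus A X).smul_mem _ (e_mem_nPlus hk)
  exact (hS hy).2

theorem f_lie_nPlus {A : Matrix I I ℤ} {X : Finset I} {i : I} {y : Alg A}
    (hy : y ∈ nPlus A X) : ⁅f A i, y⁆ ∈ (nPlus A X).toSubmodule ⊔ Submodule.span ℂ {h A i} := by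
  set V := (nPlus A X).toSubmodule ⊔ Submodule.span ℂ {h A i} with hV
  have hVn : ∀ v ∈ V, ∀ z ∈ nPlus A X, ⁅v, z⁆ ∈ nPlus A X := by
    intro v hv z hz
    obtain ⟨a, ha, b, hb, rfl⟩ := Submodule.mem_sup.1 hv
    obtain ⟨t, rfl⟩ := Submodule.mem_span_singleton.1 hb
    rw [add_lie, smul_lie]
    exact add_mem ((nPlus A X).lie_mem ha hz)
      ((nPlus A X).smul_mem _ (cartan_lie_nPlus (h_mem_cartan A i) hz))
  let S : LieSubalgebra ℂ (Alg A) :=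
    { (nPlus A X).toSubmodule ⊓ V.comap (LieAlgebra.ad ℂ (Alg A) (f A i)) with
      lie_mem' := by
        rintro y z ⟨hy, hy'⟩ ⟨hz, hz'⟩
        refine ⟨(nPlus A X).lie_mem hy hz, Submodule.mem_sup_left ?_⟩
        change ⁅f A i, ⁅y, z⁆⁆ ∈ nPlus A X
        rw [leibniz_lie]
        refine add_mem (hVn _ hy' z hz) ?_
        rw [← lie_skew]
        exact neg_mem (hVn _ hz' y hy) }
  have hS : nPlus A X ≤ S := by
    refine LieSubalgebra.lieSpan_le.2 ?_
    rintro _ ⟨k, hk, rfl⟩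
    refine ⟨e_mem_nPlus hk, ?_⟩
    change ⁅f A i, e A k⁆ ∈ V
    rw [← lie_skew]
    by_cases hki : k = i
    · subst hki
      rw [(rels A).ef_same]
      exact neg_mem (Submodule.mem_sup_right (Submodule.mem_span_singleton_self _))
    · rw [(rels A).ef_ne k i hki, neg_zero]
      exact zero_mem _
  exact (hS hy).2

namespace SatakeDatum

variable {A : Matrix I I ℤ} {X : Finset I} {τ : Equiv.Perm I} {l : List I}
  (H : SatakeDatum A X τ l)

/-- `𝔥^θ` as a subspace. -/
def fixed : Submodule ℂ (Alg A) :=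
  cartan A ⊓ LinearMap.eqLocus (H.thetaHom : Alg A →ₗ[ℂ] Alg A) LinearMap.id

theorem mem_fixed {x : Alg A} : x ∈ H.fixed ↔ x ∈ cartan A ∧ H.thetaHom x = x := Iff.rfl

theorem h_mem_fixed {k : I} (hk : k ∈ X) : h A k ∈ H.fixed :=
  H.mem_fixed.2 ⟨h_mem_cartan A k, H.theta_h_of_mem hk⟩

/-- `𝔫_X⁺ + 𝔥^θ`. -/
def base : Submodule ℂ (Alg A) := (nPlus A X).toSubmodule ⊔ H.fixed

variable (c : {i // i ∉ X} → ℂˣ)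

/-- The generators `g_i`. -/
def gen (i : I) : Alg A := g H.satake.diagramAut l X c i

theorem gen_of_mem {i : I} (hi : i ∈ X) : H.gen c i = f A i := by
  simp [gen, g, hi]

theorem gen_of_notMem {i : I} (hi : i ∉ X) :
    H.gen c i = f A i + (c ⟨i, hi⟩ : ℂ) • H.thetaHom (f A i) := by
  simp [gen, g, hi, thetaHom_apply]

/-- The filtration of `𝔨_c` by the length of words in the `g_i`. -/
def filt (m : ℕ) : Submodule ℂ (Alg A) :=
  H.base ⊔ Submodule.span ℂ (brWord (H.gen c) '' {w | w.length ≤ m})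

theorem filt_mono : Monotone (H.filt c) := fun _ _ hab =>
  sup_le_sup_left (Submodule.span_mono (Set.image_mono fun _ hw => le_trans hw hab)) _

theorem base_le_filt (m : ℕ) : H.base ≤ H.filt c m := le_sup_left

theorem brWord_mem_filt {w : List I} {m : ℕ} (hw : w.length ≤ m) :
    brWord (H.gen c) w ∈ H.filt c m :=
  Submodule.mem_sup_right (Submodule.subset_span ⟨w, hw, rfl⟩)

theorem gen_mem_filt (i : I) : H.gen c i ∈ H.filt c 1 := H.brWord_mem_filt c (w := [i]) le_rfl

theorem nPlus_le_base {x : Alg A} (hx : x ∈ nPlus A X) : x ∈ H.base := Submodule.mem_sup_left hx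

theorem fixed_le_base {x : Alg A} (hx : x ∈ H.fixed) : x ∈ H.base := Submodule.mem_sup_right hx

theorem fixed_lie_gen {x : Alg A} (hx : x ∈ H.fixed) (j : I) :
    ∃ t : ℂ, ⁅x, H.gen c j⁆ = t • H.gen c j := by
  obtain ⟨t, ht⟩ := cartan_lie_f hx.1 j
  refine ⟨t, ?_⟩
  by_cases hj : j ∈ X
  · rw [H.gen_of_mem c hj, ht]
  · have h1 : ⁅x, H.thetaHom (f A j)⁆ = t • H.thetaHom (f A j) := by
      conv_lhs => rw [← (H.mem_fixed.1 hx).2]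
      rw [← LieHom.map_lie, ht, map_smul]
    rw [H.gen_of_notMem c hj, lie_add, lie_smul, h1, ht, smul_add, smul_comm]

theorem fixed_lie_brWord {x : Alg A} (hx : x ∈ H.fixed) (w : List I) :
    ∃ t : ℂ, ⁅x, brWord (H.gen c) w⁆ = t • brWord (H.gen c) w := by
  cases w with
  | nil => exact ⟨0, by simp [brWord]⟩
  | cons i w =>
    exact cartan_lie_brWord (t := fun _ : I => x) (fun _ j => H.fixed_lie_gen c hx j) i (i :: w)

theorem e_lie_gen {k : I} (hk : k ∈ X) (j : I) : ⁅e A k, H.gen c j⁆ ∈ H.fixed := by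
  by_cases hj : j ∈ X
  · rw [H.gen_of_mem c hj]
    by_cases hkj : k = j
    · subst hkj
      rw [(rels A).ef_same]
      exact H.h_mem_fixed hk
    · rw [(rels A).ef_ne k j hkj]
      exact zero_mem _
  · rw [H.gen_of_notMem c hj, lie_add, lie_smul, H.e_lie_theta hj hk,
      (rels A).ef_ne k j (H.tau_ne hj hk), smul_zero, add_zero]
    exact zero_mem _

/-- For `i ∈ X` the bracket may reach `h_i`, which is fixed by `θ`. For `i ∉ X` the generator `g_i`
centralises `𝔫_X⁺`. -/
theorem gen_lie_nPlus (i : I) {x : Alg A} (hx : x ∈ nPlus A X) : ⁅H.gen c i, x⁆ ∈ H.base := by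
  by_cases hi : i ∈ X
  · rw [H.gen_of_mem c hi]
    have hle : (nPlus A X).toSubmodule ⊔ Submodule.span ℂ {h A i} ≤ H.base :=
      sup_le_sup_left ((Submodule.span_singleton_le_iff_mem _ _).2 (H.h_mem_fixed hi)) _
    exact hle (f_lie_nPlus hx)
  · let S : LieSubalgebra ℂ (Alg A) :=
      { LinearMap.ker (LieAlgebra.ad ℂ (Alg A) (H.gen c i)) with
        lie_mem' := by
          intro y z hy hz
          change ⁅H.gen c i, ⁅y, z⁆⁆ = 0
          rw [leibniz_lie, show ⁅H.gen c i, y⁆ = 0 from hy, show ⁅H.gen c i, z⁆ = 0 from hz,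
            zero_lie, lie_zero, add_zero] }
    have hS : nPlus A X ≤ S := by
      refine LieSubalgebra.lieSpan_le.2 ?_
      rintro _ ⟨k, hk, rfl⟩
      change ⁅H.gen c i, e A k⁆ = 0
      rw [← lie_skew, H.gen_of_notMem c hi, lie_add, lie_smul, H.e_lie_theta hi hk,
        (rels A).ef_ne k i (H.tau_ne hi hk), smul_zero, add_zero, neg_zero]
    rw [show ⁅H.gen c i, x⁆ = 0 from hS hx]
    exact zero_mem _

theorem gen_lie_filt (i : I) {m : ℕ} {x : Alg A} (hx : x ∈ H.filt c m) :
    ⁅H.gen c i, x⁆ ∈ H.filt c (m + 1) := by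
  suffices h : H.filt c m ≤ (H.filt c (m + 1)).comap (LieAlgebra.ad ℂ (Alg A) (H.gen c i)) from
    h hx
  refine sup_le (sup_le ?_ ?_) (Submodule.span_le.2 ?_)
  · exact fun y hy => H.base_le_filt c _ (H.gen_lie_nPlus c i hy)
  · intro y hy
    obtain ⟨t, ht⟩ := H.fixed_lie_gen c hy i
    change ⁅H.gen c i, y⁆ ∈ H.filt c (m + 1)
    rw [← lie_skew, ht]
    exact neg_mem (Submodule.smul_mem _ _ (H.filt_mono c (by omega) (H.gen_mem_filt c i)))
  · rintro _ ⟨w, hw, rfl⟩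
    change ⁅H.gen c i, brWord (H.gen c) w⁆ ∈ H.filt c (m + 1)
    by_cases hw0 : w = []
    · subst hw0; simp [brWord]
    · rw [← brWord_cons _ _ hw0]
      exact H.brWord_mem_filt c (by simpa using hw)

theorem fixed_lie_filt {x : Alg A} (hx : x ∈ H.fixed) {m : ℕ} {y : Alg A} (hy : y ∈ H.filt c m) :
    ⁅x, y⁆ ∈ H.filt c m := by
  suffices h : H.filt c m ≤ (H.filt c m).comap (LieAlgebra.ad ℂ (Alg A) x) from h hy
  refine sup_le (sup_le ?_ ?_) (Submodule.span_le.2 ?_)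
  · exact fun y hy => H.base_le_filt c _ (H.nPlus_le_base (cartan_lie_nPlus hx.1 hy))
  · intro y hy
    change ⁅x, y⁆ ∈ H.filt c m
    rw [cartan_lie_cartan hx.1 hy.1]
    exact zero_mem _
  · rintro _ ⟨w, hw, rfl⟩
    obtain ⟨t, ht⟩ := H.fixed_lie_brWord c hx w
    change ⁅x, brWord (H.gen c) w⁆ ∈ H.filt c m
    rw [ht]
    exact Submodule.smul_mem _ _ (H.brWord_mem_filt c hw)

theorem e_lie_brWord {k : I} (hk : k ∈ X) (w : List I) :
    ⁅e A k, brWord (H.gen c) w⁆ ∈ H.filt c w.length := by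
  induction w with
  | nil => simp [brWord]
  | cons j w ih =>
    by_cases hw : w = []
    · subst hw
      exact H.base_le_filt c _ (H.fixed_le_base (H.e_lie_gen c hk j))
    · rw [brWord_cons _ _ hw, leibniz_lie, List.length_cons]
      exact add_mem (H.filt_mono c (Nat.le_succ _) (H.fixed_lie_filt c (H.e_lie_gen c hk j)
        (H.brWord_mem_filt c le_rfl))) (H.gen_lie_filt c j ih)

theorem nPlus_lie_filt {x : Alg A} (hx : x ∈ nPlus A X) {m : ℕ} {y : Alg A}
    (hy : y ∈ H.filt c m) : ⁅x, y⁆ ∈ H.filt c m := by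
  let S : LieSubalgebra ℂ (Alg A) :=
    { carrier := {x | ∀ y ∈ H.filt c m, ⁅x, y⁆ ∈ H.filt c m}
      add_mem' := fun hx hy z hz => by rw [add_lie]; exact add_mem (hx z hz) (hy z hz)
      zero_mem' := fun z _ => by rw [zero_lie]; exact zero_mem _
      smul_mem' := fun c x hx z hz => by rw [smul_lie]; exact Submodule.smul_mem _ _ (hx z hz)
      lie_mem' := fun {x y} hx hy z hz => by
        rw [lie_lie]; exact sub_mem (hx _ (hy z hz)) (hy _ (hx z hz)) }
  have hS : nPlus A X ≤ S := by
    refine LieSubalgebra.lieSpan_le.2 ?_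
    rintro _ ⟨k, hk, rfl⟩
    suffices h : H.filt c m ≤ (H.filt c m).comap (LieAlgebra.ad ℂ (Alg A) (e A k)) from
      fun y hy => h hy
    refine sup_le (sup_le ?_ ?_) (Submodule.span_le.2 ?_)
    · exact fun y hy => H.base_le_filt c _ (H.nPlus_le_base
        ((nPlus A X).lie_mem (e_mem_nPlus hk) hy))
    · intro y hy
      change ⁅e A k, y⁆ ∈ H.filt c m
      rw [← lie_skew]
      exact neg_mem (H.base_le_filt c _ (H.nPlus_le_base
        (cartan_lie_nPlus hy.1 (e_mem_nPlus hk))))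
    · rintro _ ⟨w, hw, rfl⟩
      exact H.filt_mono c hw (H.e_lie_brWord c hk w)
  exact hS hx y hy

theorem brWord_lie_filt (w : List I) {b : ℕ} {y : Alg A} (hy : y ∈ H.filt c b) :
    ⁅brWord (H.gen c) w, y⁆ ∈ H.filt c (w.length + b) := by
  induction w generalizing b y with
  | nil => rw [brWord, zero_lie]; exact zero_mem _
  | cons i w ih =>
    by_cases hw : w = []
    · subst hw
      rw [List.length_singleton, add_comm]
      exact H.gen_lie_filt c i hy
    · rw [brWord_cons _ _ hw, lie_lie, List.length_cons]
      refine sub_mem ?_ ?_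
      · have := H.gen_lie_filt c i (ih hy)
        rwa [show w.length + b + 1 = w.length + 1 + b by omega] at this
      · have := ih (H.gen_lie_filt c i hy)
        rwa [show w.length + (b + 1) = w.length + 1 + b by omega] at this

theorem filt_lie_filt (a b : ℕ) (x : Alg A) (hx : x ∈ H.filt c a) (y : Alg A)
    (hy : y ∈ H.filt c b) : ⁅x, y⁆ ∈ H.filt c (a + b) := by
  have hneg : ∀ z, ⁅y, z⁆ ∈ H.filt c (a + b) → ⁅z, y⁆ ∈ H.filt c (a + b) := fun z hz => by
    rw [← lie_skew]; exact neg_mem hz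
  suffices h : H.filt c a ≤ (H.filt c (a + b)).comap (LieAlgebra.ad ℂ (Alg A) y) from
    hneg _ (h hx)
  have hneg' : ∀ z, ⁅z, y⁆ ∈ H.filt c (a + b) → ⁅y, z⁆ ∈ H.filt c (a + b) := fun z hz => by
    rw [← lie_skew]; exact neg_mem hz
  have hb : H.filt c b ≤ H.filt c (a + b) := H.filt_mono c (Nat.le_add_left b a)
  refine sup_le (sup_le ?_ ?_) (Submodule.span_le.2 ?_)
  · exact fun z hz => hneg' z (hb (H.nPlus_lie_filt c hz hy))
  · exact fun z hz => hneg' z (hb (H.fixed_lie_filt c hz hy))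
  · rintro _ ⟨w, hw, rfl⟩
    exact hneg' _ (H.filt_mono c (Nat.add_le_add_right hw b) (H.brWord_lie_filt c w hy))

theorem mem_filt_of_mem_kc {x : Alg A} (hx : x ∈ kc H.satake.diagramAut l X c) :
    ∃ m, x ∈ H.filt c m := by
  let S : LieSubalgebra ℂ (Alg A) :=
    { carrier := {x | ∃ m, x ∈ H.filt c m}
      add_mem' := by
        rintro x y ⟨m, hx⟩ ⟨n, hy⟩
        exact ⟨m + n, add_mem (H.filt_mono c (Nat.le_add_right m n) hx)
          (H.filt_mono c (Nat.le_add_left n m) hy)⟩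
      zero_mem' := ⟨0, zero_mem _⟩
      smul_mem' := by
        rintro t x ⟨m, hx⟩
        exact ⟨m, Submodule.smul_mem _ _ hx⟩
      lie_mem' := by
        rintro x y ⟨m, hx⟩ ⟨n, hy⟩
        exact ⟨m + n, H.filt_lie_filt c m n x hx y hy⟩ }
  have hS : kc H.satake.diagramAut l X c ≤ S := by
    refine LieSubalgebra.lieSpan_le.2 ?_
    rintro y ((hy | hy) | ⟨i, rfl⟩)
    · exact ⟨0, H.base_le_filt c 0 (H.nPlus_le_base hy)⟩
    · exact ⟨0, H.base_le_filt c 0 (H.fixed_le_base (H.mem_fixed.2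
        ⟨hy.1, by rw [thetaHom_apply]; exact hy.2⟩))⟩
    · exact ⟨1, H.gen_mem_filt c i⟩
  exact hS hx

/-! ### Leading terms with respect to height -/

theorem gen_sub_f (i : I) : H.gen c i - f A i ∈ heightGE A 1 := by
  by_cases hi : i ∈ X
  · rw [H.gen_of_mem c hi, sub_self]
    exact zero_mem _
  · rw [H.gen_of_notMem c hi, add_sub_cancel_left]
    refine Submodule.smul_mem _ _ (heightSpace_le ?_ (rootSpace_le_heightSpace _ (H.theta_f_mem i)))
    have hτ : τ i ∉ X := fun h => hi (H.tau_mem_iff.1 h)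
    rw [w_eq_add_gam]
    simp only [Pi.add_apply, Finset.sum_add_distrib, simpleRoot, Finset.sum_pi_single',
      Finset.mem_univ, if_true]
    have := Finset.sum_nonneg fun k (_ : k ∈ Finset.univ) => H.gam_nonneg hτ k
    omega

/-- Replacing a letter `f_i` by its correction `g_i - f_i` raises the height of that letter from -1
to at least 1. -/
theorem brWord_gen_sub (w : List I) :
    brWord (H.gen c) w - brWord (f A) w ∈ heightGE A (-w.length + 1) := by
  induction w with
  | nil => simp [brWord]
  | cons i w ih =>
    by_cases hw : w = []
    · subst hw
      exact heightGE_anti (by simp) (H.gen_sub_f c i)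
    · rw [brWord_cons _ _ hw, brWord_cons _ _ hw]
      have hf : f A i ∈ heightGE A (-1) :=
        heightSpace_le le_rfl (by simpa using brWord_f_mem_heightSpace (A := A) [i])
      have hfw : brWord (f A) w ∈ heightGE A (-w.length) :=
        heightSpace_le le_rfl (brWord_f_mem_heightSpace w)
      have h1 : ⁅H.gen c i, brWord (H.gen c) w⁆ - ⁅f A i, brWord (f A) w⁆ =
          ⁅H.gen c i - f A i, brWord (f A) w⁆ +
          ⁅H.gen c i - f A i, brWord (H.gen c) w - brWord (f A) w⁆ +
          ⁅f A i, brWord (H.gen c) w - brWord (f A) w⁆ := by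
        simp only [sub_lie, lie_sub]; abel
      rw [h1, List.length_cons]
      push_cast
      refine add_mem (add_mem ?_ ?_) ?_
      · exact heightGE_anti (by omega) (lie_mem_heightGE (H.gen_sub_f c i) hfw)
      · exact heightGE_anti (by omega) (lie_mem_heightGE (H.gen_sub_f c i) ih)
      · exact heightGE_anti (by omega) (lie_mem_heightGE hf ih)

theorem base_le_heightGE : H.base ≤ heightGE A 0 :=
  sup_le ((nPlus_le_heightGE X).trans (heightGE_anti (by norm_num)))
    (fun _ hx => heightSpace_le le_rfl (cartan_le_heightSpace hx.1))

theorem filt_le_heightGE (m : ℕ) : H.filt c m ≤ heightGE A (-m) := by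
  refine sup_le (H.base_le_heightGE.trans (heightGE_anti (by omega))) (Submodule.span_le.2 ?_)
  rintro _ ⟨w, hw, rfl⟩
  have hw' : w.length ≤ m := hw
  have h1 := add_mem (heightGE_anti (m := -(m : ℤ)) (by omega) (H.brWord_gen_sub c w))
    (heightSpace_le (m := -(m : ℤ)) (by omega) (brWord_f_mem_heightSpace (A := A) w))
  simpa using h1

theorem filt_zero : H.filt c 0 = H.base := by
  refine le_antisymm (sup_le le_rfl (Submodule.span_le.2 ?_)) (H.base_le_filt c 0)
  rintro _ ⟨w, hw, rfl⟩
  rw [List.length_eq_zero_iff.1 (Nat.le_zero.1 hw)]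
  exact zero_mem _

/-- The Serre elements of the `g_i` lie in lower filtration degree. -/
def SerreLower : Prop := ∀ i j, i ≠ j →
  ((LieAlgebra.ad ℂ (Alg A) (H.gen c i)) ^ ((-A i j).toNat + 1)) (H.gen c j) ∈
    H.filt c ((-A i j).toNat + 1)

/-! ### Lowering the filtration degree -/

variable {c}

theorem mem_filt_of_succ (hS : H.SerreLower c) {m : ℕ} {x : Alg A} (hx : x ∈ H.filt c (m + 1))
    (hx0 : x ∈ heightGE A (-m)) : x ∈ H.filt c m := by
  have hle : H.filt c (m + 1) ≤ H.filt c m ⊔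
      Submodule.span ℂ (brWord (H.gen c) '' {w | w.length = m + 1}) := by
    refine sup_le ((H.base_le_filt c m).trans le_sup_left) (Submodule.span_le.2 ?_)
    rintro _ ⟨w, hw, rfl⟩
    rcases Nat.lt_or_eq_of_le (show w.length ≤ m + 1 from hw) with h | h
    · exact Submodule.mem_sup_left (H.brWord_mem_filt c (by omega))
    · exact Submodule.mem_sup_right (Submodule.subset_span ⟨w, h, rfl⟩)
  obtain ⟨y, hy, z, hz, rfl⟩ := Submodule.mem_sup.1 (hle hx)
  refine add_mem hy ?_
  obtain ⟨a, ha, rfl⟩ := (Finsupp.mem_span_image_iff_linearCombination ℂ).1 hz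
  rw [Finsupp.linearCombination_apply, Finsupp.sum] at hx0 ⊢
  have hlen : ∀ w ∈ a.support, w.length = m + 1 := fun w hw => ha hw
  refine sum_brWord_mem_of_serre H.gcm (K := H.filt c) (m := m + 1) (H.filt_mono c)
    (H.gen_mem_filt c) (H.filt_lie_filt c) hS (Nat.succ_ne_zero m) hlen ?_
  -- The sum over the `f`-words is homogeneous of height `-(m+1)`. It also equals a combination of
  -- terms of height at least `-m`, so it is zero.
  refine eq_zero_of_heightSpace (n := -((m : ℤ) + 1))
    (Submodule.sum_mem _ fun w hw => Submodule.smul_mem _ _ ?_) ?_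
  · have := brWord_f_mem_heightSpace (A := A) w
    rw [hlen w hw] at this
    exact_mod_cast this
  · have h1 : ∑ w ∈ a.support, a w • brWord (f A) w =
        (y + ∑ w ∈ a.support, a w • brWord (H.gen c) w) - y -
          ∑ w ∈ a.support, a w • (brWord (H.gen c) w - brWord (f A) w) := by
      simp only [smul_sub, Finset.sum_sub_distrib]; abel
    rw [h1, show -((m : ℤ) + 1) + 1 = -m by ring]
    refine sub_mem (sub_mem hx0 (H.filt_le_heightGE c m hy))
      (Submodule.sum_mem _ fun w hw => Submodule.smul_mem _ _ ?_)
    have := H.brWord_gen_sub c w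
    rw [hlen w hw] at this
    exact heightGE_anti (by push_cast; omega) this

theorem mem_base_of_mem_filt (hS : H.SerreLower c) {m : ℕ} {x : Alg A} (hx : x ∈ H.filt c m)
    (hx0 : x ∈ heightGE A 0) : x ∈ H.base := by
  induction m with
  | zero => rwa [H.filt_zero c] at hx
  | succ m ih => exact ih (H.mem_filt_of_succ hS hx (heightGE_anti (by omega) hx0))

theorem kc_inter_cartan (hS : H.SerreLower c) :
    (kc H.satake.diagramAut l X c : Set (Alg A)) ∩ cartan A =
      cartanFixed H.satake.diagramAut l := by
  refine Set.Subset.antisymm ?_ fun x hx =>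
    ⟨LieSubalgebra.subset_lieSpan (Or.inl (Or.inr hx)), hx.1⟩
  rintro x ⟨hx, hxh⟩
  obtain ⟨m, hm⟩ := H.mem_filt_of_mem_kc c hx
  have h0 := H.mem_base_of_mem_filt hS hm (heightSpace_le le_rfl (cartan_le_heightSpace hxh))
  obtain ⟨y, hy, z, hz, rfl⟩ := Submodule.mem_sup.1 h0
  -- `y` is a difference of elements of `𝔥`, so of height 0, while `𝔫_X⁺` has height at least 1.
  have hy0 : y = 0 := by
    refine eq_zero_of_heightSpace (n := 0) (cartan_le_heightSpace ?_) (nPlus_le_heightGE X hy)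
    simpa using sub_mem hxh hz.1
  rw [hy0, zero_add]
  exact ⟨hz.1, by rw [← H.thetaHom_apply]; exact (H.mem_fixed.1 hz).2⟩

end SatakeDatum

end KacMoody

namespace KacMoody

open CartanMatrix

variable {I : Type*} [DecidableEq I] [Fintype I]

/-! ### Weight components of iterated brackets -/

section Mix

variable {L : Type*} [LieRing L] [LieAlgebra ℂ L]

/-- The part of `ad(a + b)ⁿ(x)` of degree `q` in `b`. -/
def mix (a b x : L) : ℕ → ℕ → L
  | 0, 0 => x
  | 0, _ + 1 => 0
  | n + 1, 0 => ⁅a, mix a b x n 0⁆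
  | n + 1, q + 1 => ⁅a, mix a b x n (q + 1)⁆ + ⁅b, mix a b x n q⁆

theorem mix_of_lt (a b x : L) {n q : ℕ} (h : n < q) : mix a b x n q = 0 := by
  induction n generalizing q with
  | zero =>
    obtain ⟨q, rfl⟩ : ∃ r, q = r + 1 := ⟨q - 1, by omega⟩
    rfl
  | succ n ih =>
    obtain ⟨q, rfl⟩ : ∃ r, q = r + 1 := ⟨q - 1, by omega⟩
    rw [mix, ih (by omega), ih (by omega), lie_zero, lie_zero, add_zero]

theorem mix_zero (a b x : L) (n : ℕ) : mix a b x n 0 = ((LieAlgebra.ad ℂ L a) ^ n) x := by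
  induction n with
  | zero => rfl
  | succ n ih => rw [mix, ih, pow_succ', Module.End.mul_apply, LieAlgebra.ad_apply]

theorem mix_self (a b x : L) (n : ℕ) : mix a b x n n = ((LieAlgebra.ad ℂ L b) ^ n) x := by
  induction n with
  | zero => rfl
  | succ n ih =>
    rw [mix, ih, mix_of_lt a b x (Nat.lt_succ_self n), lie_zero, zero_add, pow_succ',
      Module.End.mul_apply, LieAlgebra.ad_apply]

theorem ad_add_pow (a b x : L) (n : ℕ) :
    ((LieAlgebra.ad ℂ L (a + b)) ^ n) x = ∑ q ∈ Finset.range (n + 1), mix a b x n q := by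
  induction n with
  | zero => simp [mix]
  | succ n ih =>
    rw [pow_succ', Module.End.mul_apply, LieAlgebra.ad_apply, ih, add_lie, lie_sum, lie_sum,
      Finset.sum_range_succ' (fun q => ⁅a, mix a b x n q⁆), Finset.sum_range_succ' _ (n + 1)]
    simp only [mix, Finset.sum_add_distrib]
    rw [Finset.sum_range_succ (fun q => ⁅a, mix a b x n (q + 1)⁆),
      mix_of_lt a b x (Nat.lt_succ_self n), lie_zero]
    abel

theorem ad_smul_pow (s : ℂ) (x y : L) (n : ℕ) :
    ((LieAlgebra.ad ℂ L (s • x)) ^ n) y = s ^ n • ((LieAlgebra.ad ℂ L x) ^ n) y := by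
  rw [map_smul, smul_pow, LinearMap.smul_apply]

end Mix

theorem mix_mem_rootSpace {A : Matrix I I ℤ} {α β ξ : I → ℤ} {a b x : Alg A}
    (ha : a ∈ rootSpace A α) (hb : b ∈ rootSpace A β) (hx : x ∈ rootSpace A ξ) (p q : ℕ) :
    mix a b x (p + q) q ∈ rootSpace A (ξ + (p : ℤ) • α + (q : ℤ) • β) := by
  suffices h : ∀ n p q : ℕ, p + q = n → mix a b x n q ∈ rootSpace A (ξ + (p : ℤ) • α + (q : ℤ) • β)
    from h _ p q rfl
  intro n
  induction n with
  | zero =>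
    intro p q hpq
    obtain ⟨rfl, rfl⟩ : p = 0 ∧ q = 0 := by omega
    simpa [mix] using hx
  | succ n ih =>
    have hA : ∀ p q : ℕ, p + q = n + 1 →
        ⁅a, mix a b x n q⁆ ∈ rootSpace A (ξ + (p : ℤ) • α + (q : ℤ) • β) := by
      intro p q hpq
      by_cases hp : p = 0
      · rw [mix_of_lt a b x (by omega), lie_zero]
        exact zero_mem _
      · obtain ⟨p, rfl⟩ : ∃ r, p = r + 1 := ⟨p - 1, by omega⟩
        have := lie_mem_rootSpace ha (ih p q (by omega))
        rwa [show α + (ξ + (p : ℤ) • α + (q : ℤ) • β) =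
          ξ + ((p + 1 : ℕ) : ℤ) • α + (q : ℤ) • β by funext k; simp; ring] at this
    intro p q hpq
    cases q with
    | zero => exact hA p 0 hpq
    | succ q =>
      refine add_mem (hA p (q + 1) hpq) ?_
      have := lie_mem_rootSpace hb (ih p q (by omega))
      rwa [show β + (ξ + (p : ℤ) • α + (q : ℤ) • β) =
        ξ + (p : ℤ) • α + ((q + 1 : ℕ) : ℤ) • β by funext k; simp; ring] at this

theorem simpleRoot_apply (i k : I) : simpleRoot i k = if k = i then 1 else 0 := by
  simp [simpleRoot, Pi.single_apply]

theorem serre_f_succ (A : Matrix I I ℤ) (i j : I) :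
    ((LieAlgebra.ad ℂ (Alg A) (f A i)) ^ ((-A i j).toNat + 1)) (f A j) = 0 := by
  rw [pow_succ]
  exact (rels A).serre_f i j

namespace SatakeDatum

variable {A : Matrix I I ℤ} {X : Finset I} {τ : Equiv.Perm I} {l : List I}
  (H : SatakeDatum A X τ l) (c : {i // i ∉ X} → ℂˣ)

theorem theta_serre (i j : I) (s : ℂ) :
    ((LieAlgebra.ad ℂ (Alg A) (s • H.thetaHom (f A i))) ^ ((-A i j).toNat + 1))
      (H.thetaHom (f A j)) = 0 := by
  rw [ad_smul_pow, ← map_ad_pow, serre_f_succ, map_zero, smul_zero]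

theorem theta_serre_of_mem (i : I) {j : I} (hj : j ∈ X) (s : ℂ) :
    ((LieAlgebra.ad ℂ (Alg A) (s • H.thetaHom (f A i))) ^ ((-A i j).toNat + 1)) (f A j) = 0 := by
  obtain ⟨t, ht0, ht⟩ := H.theta_f_of_mem hj
  have h1 := H.theta_serre i j s
  rw [ht, map_smul] at h1
  exact (smul_eq_zero.1 h1).resolve_left ht0

include H in
theorem toNat_eq {i j : I} (hij : i ≠ j) : ((-A i j).toNat : ℤ) = -A i j :=
  Int.toNat_of_nonneg (by have := H.gcm.offDiag i j hij; omega)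

/-- The weight component, of degree `p` in `f_i` and `q` in `θ(f_i)`, of an iterated bracket with
`g_i`. -/
def comp (i : I) (hi : i ∉ X) (x : Alg A) (n q : ℕ) : Alg A :=
  mix (f A i) ((c ⟨i, hi⟩ : ℂ) • H.thetaHom (f A i)) x n q

variable {i : I} (hi : i ∉ X)

theorem ad_gen_pow (x : Alg A) (n : ℕ) :
    ((LieAlgebra.ad ℂ (Alg A) (H.gen c i)) ^ n) x =
      ∑ q ∈ Finset.range (n + 1), H.comp c i hi x n q := by
  rw [H.gen_of_notMem c hi, ad_add_pow]
  rfl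

theorem comp_mem {ξ : I → ℤ} {x : Alg A} (hx : x ∈ rootSpace A ξ) (p q : ℕ) :
    H.comp c i hi x (p + q) q ∈
      rootSpace A (ξ + (p : ℤ) • -simpleRoot i + (q : ℤ) • weylAct A l (simpleRoot (τ i))) :=
  mix_mem_rootSpace (f_mem i) (Submodule.smul_mem _ _ (H.theta_f_mem i)) hx p q

theorem comp_f_zero (j : I) : H.comp c i hi (f A j) ((-A i j).toNat + 1) 0 = 0 := by
  rw [comp, mix_zero, serre_f_succ]

theorem comp_theta_last (j : I) :
    H.comp c i hi (H.thetaHom (f A j)) ((-A i j).toNat + 1) ((-A i j).toNat + 1) = 0 := by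
  rw [comp, mix_self, theta_serre]

theorem comp_f_last {j : I} (hj : j ∈ X) :
    H.comp c i hi (f A j) ((-A i j).toNat + 1) ((-A i j).toNat + 1) = 0 := by
  rw [comp, mix_self, H.theta_serre_of_mem i hj]

/-- Membership of a Serre element follows from that of its weight components. -/
theorem serre_mem_of_comp {j : I} {S : Submodule ℂ (Alg A)}
    (hf : ∀ p q : ℕ, p + q = (-A i j).toNat + 1 → 1 ≤ q → (j ∈ X → 1 ≤ p) →
      H.comp c i hi (f A j) (p + q) q ∈ S)
    (hθ : j ∉ X → ∀ p q : ℕ, p + q = (-A i j).toNat + 1 → 1 ≤ p →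
      H.comp c i hi (H.thetaHom (f A j)) (p + q) q ∈ S) :
    ((LieAlgebra.ad ℂ (Alg A) (H.gen c i)) ^ ((-A i j).toNat + 1)) (H.gen c j) ∈ S := by
  -- The Serre relation of the `f`'s removes `q = 0` for `f_j`, and its image under `θ` removes `p =
  -- 0` for `θ(f_j)`. If `j ∈ X`, the two vectors are proportional and `p = 0` drops out for `f_j`
  -- too.
  have h1 : ((LieAlgebra.ad ℂ (Alg A) (H.gen c i)) ^ ((-A i j).toNat + 1)) (f A j) ∈ S := by
    rw [H.ad_gen_pow c hi]
    refine Submodule.sum_mem _ fun q hq => ?_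
    rw [Finset.mem_range] at hq
    by_cases hq0 : q = 0
    · rw [hq0, comp_f_zero]; exact zero_mem _
    by_cases hql : j ∈ X ∧ q = (-A i j).toNat + 1
    · rw [hql.2, H.comp_f_last c hi hql.1]; exact zero_mem _
    have := hf ((-A i j).toNat + 1 - q) q (by omega) (by omega) (fun hj => by
      have : q ≠ (-A i j).toNat + 1 := fun h => hql ⟨hj, h⟩
      omega)
    rwa [show (-A i j).toNat + 1 - q + q = (-A i j).toNat + 1 by omega] at this
  by_cases hj : j ∈ X
  · rwa [H.gen_of_mem c hj]
  · rw [H.gen_of_notMem c hj, map_add, map_smul]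
    refine add_mem h1 (Submodule.smul_mem _ _ ?_)
    rw [H.ad_gen_pow c hi]
    refine Submodule.sum_mem _ fun q hq => ?_
    rw [Finset.mem_range] at hq
    by_cases hql : q = (-A i j).toNat + 1
    · rw [hql, comp_theta_last]; exact zero_mem _
    have := hθ hj ((-A i j).toNat + 1 - q) q (by omega) (by omega)
    rwa [show (-A i j).toNat + 1 - q + q = (-A i j).toNat + 1 by omega] at this

include H in
theorem w_apply (m : I) {k : I} (hk : k ∉ X) :
    weylAct A l (simpleRoot m) k = if k = m then 1 else 0 := by
  rw [weylAct_apply_of_notMem H.word_mem _ hk, simpleRoot_apply]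

include H in
theorem tau_notMem {j : I} (hj : j ∉ X) : τ j ∉ X := fun h => hj (H.tau_mem_iff.1 h)

/-! ### Serre elements of the `g_i` -/

/-- `θ(f_i)` is a nonzero multiple of `f_i`, so applying `θ` to the Serre relation gives that of
`f_i` with `θ(f_j)`. -/
theorem serre_of_mem {i : I} (hi : i ∈ X) (j : I) :
    ((LieAlgebra.ad ℂ (Alg A) (H.gen c i)) ^ ((-A i j).toNat + 1)) (H.gen c j) = 0 := by
  rw [H.gen_of_mem c hi]
  by_cases hj : j ∈ X
  · rw [H.gen_of_mem c hj, serre_f_succ]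
  · obtain ⟨s, hs0, hs⟩ := H.theta_f_of_mem hi
    have h1 := H.theta_serre i j s⁻¹
    rw [hs, smul_smul, inv_mul_cancel₀ hs0, one_smul] at h1
    rw [H.gen_of_notMem c hj, map_add, map_smul, serre_f_succ, h1, smul_zero, add_zero]

include hi in
-- For `f_j` the weights are `-α_j - pα_i + q w_X(α_{τi})`, positive at `τ(i)` and negative at `i`
-- or `j`. For `θ(f_j)` they are positive at `τ(j)` and negative at `i`.
theorem serre_of_tau_generic {j : I} (hij : i ≠ j) (h1 : τ i ≠ i) (h2 : τ i ≠ j) :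
    ((LieAlgebra.ad ℂ (Alg A) (H.gen c i)) ^ ((-A i j).toNat + 1)) (H.gen c j) = 0 := by
  rw [← Submodule.mem_bot ℂ]
  have hτi := H.tau_notMem hi
  refine H.serre_mem_of_comp c hi (fun p q hpq hq hp => ?_) (fun hj p q hpq hp => ?_)
  · have hmem := H.comp_mem c hi (f_mem (A := A) j) p q
    refine (Submodule.mem_bot ℂ).2 ?_
    by_cases hj : j ∈ X
    · refine eq_zero_of_mixed hmem (i := τ i) (j := i) ?_ ?_
      · simp [simpleRoot_apply, H.w_apply _ hτi, h1, h2]; omega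
      · have := hp hj
        simp [simpleRoot_apply, H.w_apply _ hi, h1.symm, hij]; omega
    · refine eq_zero_of_mixed hmem (i := τ i) (j := j) ?_ ?_
      · simp [simpleRoot_apply, H.w_apply _ hτi, h1, h2]; omega
      · simp [simpleRoot_apply, H.w_apply _ hj, h2.symm, hij.symm]
  · have hmem := H.comp_mem c hi (H.theta_f_mem j) p q
    have h3 : i ≠ τ j := fun h => h2 (by rw [h, H.satake.invol])
    have h4 : τ j ≠ τ i := fun h => hij (τ.injective h).symm
    have hτj := H.tau_notMem hj
    refine (Submodule.mem_bot ℂ).2 (eq_zero_of_mixed hmem (i := τ j) (j := i) ?_ ?_)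
    · simp [simpleRoot_apply, H.w_apply _ hτj, h3.symm, h4]
    · simp [simpleRoot_apply, H.w_apply _ hi, h1.symm, h3]; omega

end SatakeDatum

end KacMoody

namespace KacMoody

open CartanMatrix

variable {I : Type*} [DecidableEq I] [Fintype I]

namespace SatakeDatum

variable {A : Matrix I I ℤ} {X : Finset I} {τ : Equiv.Perm I} {l : List I}
  (H : SatakeDatum A X τ l) (c : {i // i ∉ X} → ℂˣ) {i : I} (hi : i ∉ X)

omit [Fintype I] in
theorem permAct_tau (v : I → ℤ) (k : I) : permAct τ v (τ k) = v k := by simp [permAct]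

/-- A weight component vanishes if the image of its weight under `w_X⁻¹` is not a root. -/
theorem comp_eq_zero_of_inv {ξ : I → ℤ} {x : Alg A} (hx : x ∈ rootSpace A ξ) (p q : ℕ)
    (h0 : ∀ y ∈ rootSpace A (weylAct A l.reverse ξ +
      (p : ℤ) • -(simpleRoot i + permAct τ (gam A l i)) + (q : ℤ) • simpleRoot (τ i)), y = 0) :
    H.comp c i hi x (p + q) q = 0 := by
  refine eq_zero_of_weyl H.gcm l.reverse (fun y hy => h0 y ?_) (H.comp_mem c hi hx p q)
  rwa [← weylHom_apply, map_add, map_add, map_zsmul, map_zsmul, map_neg, weylHom_apply,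
    weylHom_apply, weylHom_apply, weylAct_reverse H.gcm, H.w_inv_eq_add] at hy

include H in
theorem exists_gam_pos {j : I} (hj : j ∉ X) (h0 : gam A l j ≠ 0) :
    ∃ k ∈ X, 0 < gam A l j k := by
  obtain ⟨k, hk⟩ := Function.ne_iff.1 h0
  refine ⟨k, ?_, lt_of_le_of_ne (H.gam_nonneg hj k) (Ne.symm hk)⟩
  by_contra h
  exact hk (H.gam_notMem j h)

/-! ### Serre elements in the case `τ(i) = i` -/

include hi in
-- For `f_j` the weight is positive on the support of `γ_i` and negative at `j`. For `θ(f_j)` apply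
-- `w_X⁻¹`: the weight `α_{τj} - p(α_i + τγ_i) + qα_i` is positive at `τ(j)` and negative on `τ` of
-- that support.
theorem serre_of_tau_fixed_gam_ne {j : I} (hij : i ≠ j) (hj : j ∉ X) (h1 : τ i = i)
    (h0 : gam A l i ≠ 0) :
    ((LieAlgebra.ad ℂ (Alg A) (H.gen c i)) ^ ((-A i j).toNat + 1)) (H.gen c j) = 0 := by
  rw [← Submodule.mem_bot ℂ]
  obtain ⟨k, hkX, hk⟩ := H.exists_gam_pos hi h0
  have hki : k ≠ i := H.tau_ne hi hkX
  have hkj : k ≠ j := H.tau_ne hj hkX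
  refine H.serre_mem_of_comp c hi (fun p q hpq hq _ => ?_) (fun _ p q hpq hp => ?_)
  · have hmem := H.comp_mem c hi (f_mem (A := A) j) p q
    rw [h1] at hmem
    refine (Submodule.mem_bot ℂ).2 (eq_zero_of_mixed hmem (i := k) (j := j) ?_ ?_)
    · rw [w_eq_add_gam]
      simp [simpleRoot_apply, hki, hkj]
      exact mul_pos (by exact_mod_cast hq) hk
    · simp [simpleRoot_apply, H.w_apply _ hj, hij.symm]
  · have hτji : τ j ≠ i := fun h => hij (by rw [← h1, ← h, H.satake.invol])
    have hτkj : τ k ≠ τ j := fun h => hkj (τ.injective h)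
    have hτki : τ k ≠ i := fun h => hki (τ.injective (h.trans h1.symm))
    refine (Submodule.mem_bot ℂ).2 (H.comp_eq_zero_of_inv c hi (H.theta_f_mem j) p q
      fun y hy => ?_)
    rw [weylAct_reverse H.gcm, h1] at hy
    refine eq_zero_of_mixed hy (i := τ j) (j := τ k) ?_ ?_
    · have : gam A l i j = 0 := H.gam_notMem i hj
      simp [simpleRoot_apply, hτji, permAct_tau, this]
    · simp [simpleRoot_apply, hτkj, hτki, permAct_tau]
      exact mul_pos (by exact_mod_cast hp) hk

theorem theta_e_of_isolated {j : I} (hj : j ∉ X) (h0 : ∀ k ∈ X, A k (τ j) = 0) :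
    H.thetaHom (e A j) = -f A (τ j) := by
  rw [theta_e, AdWordHom_eq_self]
  intro k hk
  have hkX := H.word_mem k hk
  have hne : k ≠ τ j := fun h => hj (H.tau_mem_iff.1 (h ▸ hkX))
  refine ⟨(rels A).ef_ne _ _ hne, ?_⟩
  have h1 := (rels A).serre_f k (τ j)
  rw [h0 k hkX] at h1
  simpa using h1

theorem theta_h_of_isolated {j : I} (hj : j ∉ X) (h0 : ∀ k ∈ X, A k (τ j) = 0) :
    H.thetaHom (h A j) = -h A (τ j) := by
  rw [← (rels A).ef_same, LieHom.map_lie, H.theta_e_of_isolated hj h0, H.theta_f_of_isolated hj h0,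
    neg_lie, lie_neg, neg_neg, lie_f_e]

/-- Sequences obeying the three-term recursion of `g_i` stay close to the iterated brackets. -/
theorem sub_ad_pow_mem_filt (i j : I) {z : ℕ → Alg A} {r : ℕ → ℂ} (h0 : z 0 = H.gen c j)
    (h1 : z 1 = ⁅H.gen c i, z 0⁆) (h2 : ∀ n, z (n + 2) = ⁅H.gen c i, z (n + 1)⁆ + r n • z n)
    (n : ℕ) : z n - ((LieAlgebra.ad ℂ (Alg A) (H.gen c i)) ^ n) (H.gen c j) ∈ H.filt c n := by
  have hpow : ∀ n, ((LieAlgebra.ad ℂ (Alg A) (H.gen c i)) ^ n) (H.gen c j) ∈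
      H.filt c (n + 1) := by
    intro n
    induction n with
    | zero => exact H.gen_mem_filt c j
    | succ n ih =>
      rw [pow_succ', Module.End.mul_apply, LieAlgebra.ad_apply]
      exact H.gen_lie_filt c i ih
  suffices h : ∀ n, z n - ((LieAlgebra.ad ℂ (Alg A) (H.gen c i)) ^ n) (H.gen c j) ∈ H.filt c n ∧
      z (n + 1) - ((LieAlgebra.ad ℂ (Alg A) (H.gen c i)) ^ (n + 1)) (H.gen c j) ∈
        H.filt c (n + 1) from (h n).1
  intro n
  induction n with
  | zero => simp [h0, h1]
  | succ n ih =>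
    refine ⟨ih.2, ?_⟩
    have h3 := H.gen_lie_filt c i ih.2
    have h4 := add_mem (H.filt_mono c (Nat.le_succ n) ih.1) (hpow n)
    rw [sub_add_cancel] at h4
    rw [h2, pow_succ', Module.End.mul_apply, LieAlgebra.ad_apply, add_sub_right_comm, ← lie_sub]
    exact add_mem h3 (H.filt_mono c (Nat.le_succ _) (Submodule.smul_mem _ _ h4))

include hi in
-- Now `g_i = f_i - a e_i` lies in one `sl₂`, for which `f_j` is a highest and `θ(f_j)` a lowest
-- weight vector. With `λ = -a_ij`, the vectors `z_n = ad(f_i)ⁿ f_j + b(-a)ⁿ ad(e_i)ⁿ θ(f_j)`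
-- satisfy `z_{n+2} = [g_i, z_{n+1}] + a(n+1)(λ-n) z_n`, so `z_n` agrees with `ad(g_i)ⁿ(g_j)` up to
-- shorter words. The Serre relations give `z_{1-a_ij} = 0`.
theorem serre_of_tau_fixed_gam_eq {j : I} (hij : i ≠ j) (hj : j ∉ X) (h1 : τ i = i)
    (h0 : gam A l i = 0) :
    ((LieAlgebra.ad ℂ (Alg A) (H.gen c i)) ^ ((-A i j).toNat + 1)) (H.gen c j) ∈
      H.filt c ((-A i j).toNat + 1) := by
  have hiso : ∀ k ∈ X, A k (τ i) = 0 := fun k hk => by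
    rw [h1]; exact H.cartan_zero_of_gam_eq_zero hi hk h0
  have hθf := H.theta_f_of_isolated hi hiso
  have hθe := H.theta_e_of_isolated hi hiso
  have hθh := H.theta_h_of_isolated hi hiso
  rw [h1] at hθf hθe hθh
  obtain ⟨a, ha⟩ : ∃ a : ℂ, a = c ⟨i, hi⟩ := ⟨_, rfl⟩
  obtain ⟨b, hb⟩ : ∃ b : ℂ, b = c ⟨j, hj⟩ := ⟨_, rfl⟩
  have hgi : H.gen c i = f A i - a • e A i := by
    rw [H.gen_of_notMem c hi, hθf, ← ha, smul_neg, sub_eq_add_neg]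
  have hgj : H.gen c j = f A j + b • H.thetaHom (f A j) := by rw [H.gen_of_notMem c hj, hb]
  have hv := lie_ad_pow_succ (x := f A i) (y := e A i) (t := h A i) (v := f A j)
    (lam := -(A i j : ℂ)) ((rels A).ef_same i)
    (by rw [(rels A).hf, H.gcm.diag, neg_smul, ← Int.cast_smul_eq_zsmul ℂ]; norm_num)
    ((rels A).ef_ne i j hij) (by rw [(rels A).hf, neg_smul, Int.cast_smul_eq_zsmul])
  have hu := lie_ad_pow_succ (x := e A i) (y := f A i) (t := -h A i) (v := H.thetaHom (f A j))
    (lam := -(A i j : ℂ)) (lie_f_e i)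
    (by rw [neg_lie, (rels A).he, H.gcm.diag, neg_smul, ← Int.cast_smul_eq_zsmul ℂ]; norm_num)
    (by rw [← neg_neg (f A i), ← hθe, neg_lie, ← LieHom.map_lie, (rels A).ef_ne i j hij, map_zero,
      neg_zero])
    (by rw [← hθh, ← LieHom.map_lie, (rels A).hf, neg_smul, Int.cast_smul_eq_zsmul, map_neg,
      map_zsmul])
  have hserre : ((LieAlgebra.ad ℂ (Alg A) (e A i)) ^ ((-A i j).toNat + 1))
      (H.thetaHom (f A j)) = 0 := by
    have := H.theta_serre i j (-1)
    rwa [hθf, neg_smul, one_smul, neg_neg] at this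
  let z : ℕ → Alg A := fun n => ((LieAlgebra.ad ℂ (Alg A) (f A i)) ^ n) (f A j) +
    (b * (-a) ^ n) • ((LieAlgebra.ad ℂ (Alg A) (e A i)) ^ n) (H.thetaHom (f A j))
  have hz : z ((-A i j).toNat + 1) = 0 := by
    simp only [z, serre_f_succ, hserre, smul_zero, add_zero]
  have key := H.sub_ad_pow_mem_filt c i j (z := z)
    (r := fun n => a * ((n + 1) * (-(A i j : ℂ) - n))) ?_ ?_ ?_ ((-A i j).toNat + 1)
  · rw [hz, zero_sub] at key
    exact neg_mem_iff.1 key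
  · simp [z, hgj]
  · have h3 : ⁅f A i, H.thetaHom (f A j)⁆ = 0 := by
      rw [← neg_neg (f A i), ← hθe, neg_lie, ← LieHom.map_lie, (rels A).ef_ne i j hij, map_zero,
        neg_zero]
    simp only [z, hgi, pow_one, pow_zero, Module.End.one_apply, LieAlgebra.ad_apply,
      mul_one, sub_lie, smul_lie, lie_add, lie_smul, h3, (rels A).ef_ne i j hij]
    module
  · intro n
    have hs : ∀ (x y : Alg A) (m : ℕ), ((LieAlgebra.ad ℂ (Alg A) x) ^ (m + 1)) y =
        ⁅x, ((LieAlgebra.ad ℂ (Alg A) x) ^ m) y⁆ := fun x y m => by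
      rw [pow_succ', Module.End.mul_apply, LieAlgebra.ad_apply]
    simp only [z, hgi, sub_lie, smul_lie, lie_add, lie_smul, hv, hu, hs _ _ (n + 1)]
    module

/-- If `qγ_i ≤ α_j` in every coordinate, then `γ_i ≥ 0` leaves only `γ_i = 0` and `γ_i = α_j`. -/
theorem exists_excess {j : I} (h0 : gam A l i ≠ 0) (h1 : gam A l i ≠ simpleRoot j)
    (hnn : ∀ k, 0 ≤ gam A l i k) {q : ℕ} (hq : 1 ≤ q) :
    ∃ k, 0 < (q : ℤ) * gam A l i k - simpleRoot j k := by
  by_contra hcon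
  push Not at hcon
  have hk : ∀ k, k ≠ j → gam A l i k = 0 := by
    intro k hkj
    have h2 := hcon k
    have h3 := hnn k
    simp only [simpleRoot_apply, hkj, if_false, sub_zero] at h2
    have hq' : (0 : ℤ) < q := by exact_mod_cast hq
    nlinarith
  have hj : gam A l i j ≤ 1 := by
    have h2 := hcon j
    have h3 := hnn j
    simp only [simpleRoot_apply, if_true] at h2
    have hq' : (1 : ℤ) ≤ q := by exact_mod_cast hq
    nlinarith
  have hj' := hnn j
  rcases (by omega : gam A l i j = 0 ∨ gam A l i j = 1) with h | h
  · refine h0 (funext fun k => ?_)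
    by_cases hkj : k = j
    · rw [hkj, h]; rfl
    · exact hk k hkj
  · refine h1 (funext fun k => ?_)
    rw [simpleRoot_apply]
    split_ifs with hkj
    · rw [hkj, h]
    · exact hk k hkj

include hi H in
-- `γ_i = α_j` amounts to `θ(α_i) = -(α_i + α_j)`, the situation addressed by the generalized Satake
-- condition.
theorem satake_ne {j : I} (hj : j ∈ X) (h1 : τ i = i) (hγ : gam A l i = simpleRoot j) :
    A i j ≠ -1 := by
  refine H.satake.satake l H.longest j hj i hi ?_
  have h2 : permAct τ (simpleRoot i) = simpleRoot i := by
    funext k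
    have : τ.symm k = i ↔ k = i := by rw [Equiv.symm_apply_eq, h1]
    simp [permAct, simpleRoot_apply, this]
  rw [thetaRoot, h2, w_eq_add_gam, hγ, add_comm]

include hi H in
-- `θ(f_i)` is a nonzero multiple of `[e_j, e_i]` and is killed by `e_j`. Bracketing `[e_j, [e_j,
-- e_i]] = 0` with `f_j` yields `2 + 2a_ji = 0`.
theorem cartan_eq_of_gam {j : I} (hj : j ∈ X) (h1 : τ i = i) (hγ : gam A l i = simpleRoot j) :
    A j i = -1 ∧ ∃ t : ℂ, H.thetaHom (f A i) = t • ⁅e A j, e A i⁆ := by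
  have hij : j ≠ i := H.tau_ne hi hj
  have h2 := H.theta_f_mem i
  rw [h1, w_eq_add_gam, hγ, add_comm] at h2
  obtain ⟨t, ht⟩ := mem_span_lie_e hij h2
  refine ⟨?_, t, ht⟩
  have hne := H.theta_f_ne_zero i
  rw [ht] at hne
  have h3 := H.e_lie_theta hi hj
  rw [ht, lie_smul] at h3
  have h4 := (smul_eq_zero.1 h3).resolve_left (left_ne_zero_of_smul hne)
  have hu : ⁅f A j, ⁅e A j, e A i⁆⁆ = -(A j i : ℂ) • e A i := by
    rw [leibniz_lie, lie_f_e, ← lie_skew (f A j) (e A i), (rels A).ef_ne i j hij.symm, neg_zero,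
      lie_zero, add_zero, neg_lie, (rels A).he, neg_smul, Int.cast_smul_eq_zsmul]
  have h5 : ⁅f A j, ⁅e A j, ⁅e A j, e A i⁆⁆⁆ =
      -(2 + 2 * (A j i : ℂ)) • ⁅e A j, e A i⁆ := by
    rw [leibniz_lie (f A j) (e A j), lie_f_e, hu, lie_smul, neg_lie, leibniz_lie (h A j),
      (rels A).he, (rels A).he, H.gcm.diag, ← Int.cast_smul_eq_zsmul ℂ, ← Int.cast_smul_eq_zsmul ℂ,
      smul_lie, lie_smul]
    push_cast
    module
  rw [h4, lie_zero] at h5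
  have h6 := (smul_eq_zero.1 h5.symm).resolve_right (right_ne_zero_of_smul hne)
  have h7 : (A j i : ℂ) = ((-1 : ℤ) : ℂ) := by push_cast; linear_combination -(1 / 2 : ℂ) * h6
  exact_mod_cast h7

include H in
/-- The exceptional mixed components in rank two vanish. -/
theorem comp_eq_zero_of_rank_two {j : I} (hj : j ∈ X) (h1 : τ i = i)
    (hγ : gam A l i = simpleRoot j) (h2 : A i j = -2) {q : ℕ} (hq : q = 1 ∨ q = 2) :
    H.comp c i hi (f A j) 3 q = 0 := by
  -- The weights are `-α_i` for `q = 1` and `α_i + α_j` for `q = 2`. Both are roots, so the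
  -- components have to be computed.
  obtain ⟨hji, t, ht⟩ := H.cartan_eq_of_gam hi hj h1 hγ
  have hne : j ≠ i := H.tau_ne hi hj
  obtain ⟨s, hs⟩ : ∃ s : ℂ, (c ⟨i, hi⟩ : ℂ) • H.thetaHom (f A i) = s • ⁅e A j, e A i⁆ :=
    ⟨c ⟨i, hi⟩ * t, by rw [ht, smul_smul]⟩
  rw [comp, hs]
  set u := ⁅e A j, e A i⁆ with hu
  have hfh : ∀ a b, ⁅f A a, h A b⁆ = (A b a : ℂ) • f A a := fun a b => by
    rw [← lie_skew, (rels A).hf, neg_neg, Int.cast_smul_eq_zsmul]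
  have heh : ∀ a b, ⁅e A a, h A b⁆ = -(A b a : ℂ) • e A a := fun a b => by
    rw [← lie_skew, (rels A).he, neg_smul, Int.cast_smul_eq_zsmul]
  have huh : ∀ b, ⁅u, h A b⁆ = -((A b j : ℂ) + A b i) • u := fun b => by
    rw [hu, lie_lie, heh, heh, lie_smul, lie_smul, ← lie_skew (e A i) (e A j)]
    module
  have huj : ⁅u, f A j⁆ = -e A i := by
    rw [hu, lie_lie, (rels A).ef_ne i j hne.symm, (rels A).ef_same, lie_zero, heh, hji]
    push_cast
    module
  have hui : ⁅u, f A i⁆ = (2 : ℂ) • e A j := by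
    rw [hu, lie_lie, (rels A).ef_ne j i hne, (rels A).ef_same, lie_zero, heh, h2]
    push_cast
    module
  have huP : ⁅u, ⁅f A i, f A j⁆⁆ = (2 : ℂ) • h A j + h A i := by
    rw [leibniz_lie, hui, huj, smul_lie, (rels A).ef_same, lie_neg, lie_f_e, neg_neg]
  have hjP : ⁅e A j, ⁅f A i, f A j⁆⁆ = -f A i := by
    rw [leibniz_lie, (rels A).ef_ne j i hne, (rels A).ef_same, zero_lie, hfh, hji]
    push_cast
    module
  have huFP : ⁅u, ⁅f A i, ⁅f A i, f A j⁆⁆⁆ = -(2 : ℂ) • f A i := by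
    rw [leibniz_lie u (f A i), hui, huP, smul_lie, hjP, lie_add, lie_smul, hfh, hfh, hji,
      H.gcm.diag]
    push_cast
    module
  have hFue : ⁅f A i, ⁅u, e A i⁆⁆ = -(2 : ℂ) • u := by
    rw [leibniz_lie, ← lie_skew (f A i) u, hui, lie_f_e, lie_neg, huh, h2, H.gcm.diag, neg_lie,
      smul_lie, ← hu]
    push_cast
    module
  rcases hq with rfl | rfl
  · simp only [mix, lie_zero, zero_add, lie_add, smul_lie, lie_smul, huj, huP, huFP, lie_neg,
      lie_f_e, hfh, hji, H.gcm.diag]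
    push_cast
    module
  · simp only [mix, lie_zero, zero_add, lie_add, smul_lie, lie_smul, huj, huP, lie_neg,
      lie_f_e, huh, hFue, hji, h2, H.gcm.diag]
    push_cast
    module

include hi in
-- The weights are `(q-p)α_i + qγ_i - α_j`. For `q < p` this is negative at `i` and, by
-- `exists_excess`, usually positive elsewhere; `q > p` is the mirror image under `w_X⁻¹`; for `q =
-- p` the component vanishes or lies in `𝔫_X⁺`. The exceptions all have `γ_i = α_j`.
theorem serre_of_tau_fixed_mem {j : I} (hj : j ∈ X) (h1 : τ i = i) :
    ((LieAlgebra.ad ℂ (Alg A) (H.gen c i)) ^ ((-A i j).toNat + 1)) (H.gen c j) ∈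
      H.filt c ((-A i j).toNat + 1) := by
  have hji : j ≠ i := H.tau_ne hi hj
  have hn := H.toNat_eq hji.symm
  have hτj := H.tau_mem hj
  have hτji : τ j ≠ i := H.tau_ne hi hτj
  have hnn := H.gam_nonneg hi
  have hγi : gam A l i i = 0 := H.gam_notMem i hi
  refine H.serre_mem_of_comp c hi (fun p q hpq hq hp => ?_) (fun h => absurd hj h)
  replace hp := hp hj
  have hγ0 : gam A l i ≠ 0 := by
    intro h
    have := H.gcm.symm_zero (H.cartan_zero_of_gam_eq_zero hi hj h)
    omega
  have hmem := H.comp_mem c hi (f_mem (A := A) j) p q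
  rw [h1, w_eq_add_gam] at hmem
  have hinv := H.comp_eq_zero_of_inv c hi (f_mem (A := A) j) p q
  rw [← weylHom_apply, map_neg, weylHom_apply, H.w_inv_root hj, neg_neg, h1] at hinv
  have hzero : ∀ {x : Alg A}, x = 0 → x ∈ H.filt c ((-A i j).toNat + 1) := fun hx => by
    rw [hx]; exact zero_mem _
  have hmul : ∀ k, 0 ≤ (q : ℤ) * gam A l i k := fun k => mul_nonneg (by omega) (hnn k)
  rcases lt_trichotomy q p with hqp | hqp | hqp
  · refine hzero ?_
    by_cases hγ : gam A l i = simpleRoot j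
    · by_cases hq1 : q = 1
      · subst hq1
        have hne := H.satake_ne hi hj h1 hγ
        -- The weight is `(1-p)α_i` with `p = -a_ij ≥ 2`, so it can be a root only for `p = 2`.
        by_cases h2 : A i j = -2
        · rw [show p + 1 = 3 by omega]
          exact H.comp_eq_zero_of_rank_two c hi hj h1 hγ h2 (Or.inl rfl)
        · refine eq_zero_of_multiple (n := 1 - p) (i := i) ?_ (Or.inr (by omega))
          rwa [show -simpleRoot j + (p : ℤ) • -simpleRoot i +
            ((1 : ℕ) : ℤ) • (simpleRoot i + gam A l i) = ((1 : ℤ) - p) • simpleRoot i by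
              rw [hγ]; funext k; simp; ring] at hmem
      · refine eq_zero_of_mixed hmem (i := j) (j := i) ?_ ?_
        · simp [simpleRoot_apply, hji, hγ]; omega
        · simp [simpleRoot_apply, hji.symm, hγi]; omega
    · obtain ⟨k, hk⟩ := exists_excess hγ0 hγ hnn hq
      have hki : k ≠ i := by
        rintro rfl
        simp [hγi, simpleRoot_apply, hji.symm] at hk
      refine eq_zero_of_mixed hmem (i := k) (j := i) ?_ ?_
      · simp only [Pi.add_apply, Pi.neg_apply, Pi.smul_apply, smul_eq_mul, simpleRoot_apply i, hki,
          if_false]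
        linarith
      · simp [simpleRoot_apply, hji.symm, hγi]; omega
  · subst hqp
    have hwt : -simpleRoot j + (q : ℤ) • -simpleRoot i + (q : ℤ) • (simpleRoot i + gam A l i) =
        (q : ℤ) • gam A l i - simpleRoot j := by
      funext k; simp; ring
    rw [hwt] at hmem
    by_cases hγj : gam A l i j = 0
    · refine hzero ?_
      obtain ⟨k, hkX, hk⟩ := H.exists_gam_pos hi hγ0
      have hkj : k ≠ j := by rintro rfl; omega
      refine eq_zero_of_mixed hmem (i := k) (j := j) ?_ ?_
      · simp [simpleRoot_apply, hkj]
        exact mul_pos (by exact_mod_cast hq) hk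
      · simp [simpleRoot_apply, hγj]
    · refine H.base_le_filt c _ (H.nPlus_le_base (mem_nPlus_of_rootSpace ?_ ?_ ?_ hmem))
      · intro k hk
        have hkj : k ≠ j := fun h => hk (h ▸ hj)
        simp [simpleRoot_apply, hkj, H.gam_notMem i hk]
      -- A component of weight 0 might fall outside `𝔥^θ`. It would need `γ_i = α_j` and `p = q =
      -- 1`, that is `a_ij = -1`, which `satake_ne` excludes.
      · intro h0
        by_cases hγ : gam A l i = simpleRoot j
        · have hne := H.satake_ne hi hj h1 hγ
          have h3 := congrFun h0 j
          simp [hγ, simpleRoot_apply] at h3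
          omega
        · obtain ⟨k, hk⟩ := exists_excess hγ0 hγ hnn hq
          have h3 := congrFun h0 k
          simp only [Pi.sub_apply, Pi.smul_apply, smul_eq_mul, Pi.zero_apply] at h3
          omega
      · intro k
        by_cases hkj : k = j
        · subst hkj
          have h3 := hnn k
          have h4 : 1 ≤ gam A l i k := by omega
          simp only [Pi.sub_apply, Pi.smul_apply, smul_eq_mul, simpleRoot_apply, if_true]
          have hq' : (1 : ℤ) ≤ q := by exact_mod_cast hq
          nlinarith
        · simpa [simpleRoot_apply, hkj] using hmul k
  · refine hzero ?_
    by_cases hγ : gam A l i = simpleRoot j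
    · by_cases hp1 : p = 1
      · subst hp1
        have hne := H.satake_ne hi hj h1 hγ
        by_cases h2 : A i j = -2
        · rw [show 1 + q = 3 by omega]
          exact H.comp_eq_zero_of_rank_two c hi hj h1 hγ h2 (Or.inr (by omega))
        · refine hinv fun y hy => eq_zero_of_multiple (n := q - 1) (i := i) ?_ (Or.inl (by omega))
          have hperm : permAct τ (simpleRoot j) = simpleRoot (τ j) := by
            funext k
            simp [permAct, simpleRoot_apply, Equiv.symm_apply_eq]
          rwa [show simpleRoot (τ j) + ((1 : ℕ) : ℤ) • -(simpleRoot i + permAct τ (gam A l i)) +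
            (q : ℤ) • simpleRoot i = ((q : ℤ) - 1) • simpleRoot i by
              rw [hγ, hperm]; funext k; simp; ring] at hy
      · refine hinv fun y hy => eq_zero_of_mixed hy (i := i) (j := τ j) ?_ ?_
        · have : permAct τ (gam A l i) i = 0 :=
            (congrArg (permAct τ (gam A l i)) h1).symm.trans ((permAct_tau _ i).trans hγi)
          simp [simpleRoot_apply, hτji.symm, this]; omega
        · simp [simpleRoot_apply, hτji, permAct_tau, hγ]; omega
    · obtain ⟨k, hk⟩ := exists_excess hγ0 hγ hnn hp
      have hki : k ≠ i := by
        rintro rfl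
        simp [hγi, simpleRoot_apply, hji.symm] at hk
      have hτki : τ k ≠ i := fun h => hki (τ.injective (h.trans h1.symm))
      refine hinv fun y hy => eq_zero_of_mixed hy (i := i) (j := τ k) ?_ ?_
      · have : permAct τ (gam A l i) i = 0 :=
            (congrArg (permAct τ (gam A l i)) h1).symm.trans ((permAct_tau _ i).trans hγi)
        simp [simpleRoot_apply, hτji.symm, this]; omega
      · simp only [Pi.add_apply, Pi.neg_apply, Pi.smul_apply, smul_eq_mul, permAct_tau,
          simpleRoot_apply, hτki, if_false, EmbeddingLike.apply_eq_iff_eq] at hk ⊢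
        linarith

/-! ### The case `τ(i) = j` -/

include hi in
-- The weights are `(q-1)α_j - pα_i + qγ_j` for `f_j` and `(1-p)α_i + γ_i + q(α_j + γ_j)` for
-- `θ(f_j)`. In the borderline cases where the coefficients at `i` and `j` do not have opposite
-- signs, either `γ` supplies the missing sign, if need be after `w_X⁻¹`, or `a_ij ≤ -2` makes the
-- weight a proper multiple of a simple root.
theorem serre_of_tau_swap_generic {j : I} (hij : i ≠ j) (h1 : τ i = j) (hA0 : A i j ≠ 0)
    (h : gam A l j ≠ 0 ∨ A i j ≠ -1) :
    ((LieAlgebra.ad ℂ (Alg A) (H.gen c i)) ^ ((-A i j).toNat + 1)) (H.gen c j) = 0 := by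
  rw [← Submodule.mem_bot ℂ]
  have hn := H.toNat_eq hij
  have hoff := H.gcm.offDiag i j hij
  have hj : j ∉ X := h1 ▸ H.tau_notMem hi
  have hτj : τ j = i := by rw [← h1, H.satake.invol]
  have hγii : gam A l i i = 0 := H.gam_notMem i hi
  have hγji : gam A l j i = 0 := H.gam_notMem j hi
  have hγjj : gam A l j j = 0 := H.gam_notMem j hj
  have hpj : permAct τ (gam A l i) j = 0 :=
    (congrArg (permAct τ (gam A l i)) h1).symm.trans ((permAct_tau _ i).trans hγii)
  have hqj : permAct τ (gam A l j) j = 0 :=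
    (congrArg (permAct τ (gam A l j)) h1).symm.trans ((permAct_tau _ i).trans hγji)
  have hγ : gam A l j ≠ 0 → gam A l i ≠ 0 := fun h0 h' => h0 (by
    have := H.gam_tau_eq_zero hi h'
    rwa [h1] at this)
  have hp0 : permAct τ (0 : I → ℤ) = 0 := rfl
  refine H.serre_mem_of_comp c hi (fun p q hpq hq _ => ?_) (fun _ p q hpq hp => ?_)
  · refine (Submodule.mem_bot ℂ).2 ?_
    have hmem := H.comp_mem c hi (f_mem (A := A) j) p q
    have hinv := H.comp_eq_zero_of_inv c hi (f_mem (A := A) j) p q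
    rw [← weylHom_apply, map_neg, weylHom_apply, H.w_inv_eq_add, h1] at hinv
    rw [h1, w_eq_add_gam] at hmem
    by_cases hp0' : p = 0
    · subst hp0'
      by_cases h0 : gam A l j = 0
      · refine hinv fun y hy => eq_zero_of_multiple (n := q - 1) (i := j) ?_
          (Or.inl (by have := h.resolve_left (not_not.2 h0); omega))
        rwa [h0, hp0, show -(simpleRoot j + 0) + ((0 : ℕ) : ℤ) • -(simpleRoot i +
          permAct τ (gam A l i)) + (q : ℤ) • simpleRoot j = ((q : ℤ) - 1) • simpleRoot j by
            funext k; simp; ring] at hy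
      · obtain ⟨k, hkX, hk⟩ := H.exists_gam_pos hj h0
        have hτk := H.tau_mem hkX
        refine hinv fun y hy => eq_zero_of_mixed hy (i := j) (j := τ k) ?_ ?_
        · simp [simpleRoot_apply, hqj]; omega
        · simp [simpleRoot_apply, H.tau_ne hj hτk, permAct_tau, hk]
    · by_cases hq1 : q = 1
      · subst hq1
        by_cases h0 : gam A l j = 0
        · refine eq_zero_of_multiple (n := -p) (i := i) ?_
            (Or.inr (by have := h.resolve_left (not_not.2 h0); omega))
          rwa [h0, show -simpleRoot j + (p : ℤ) • -simpleRoot i +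
            ((1 : ℕ) : ℤ) • (simpleRoot j + 0) = (-(p : ℤ)) • simpleRoot i by
              funext k; simp] at hmem
        · obtain ⟨k, hkX, hk⟩ := H.exists_gam_pos hj h0
          refine eq_zero_of_mixed hmem (i := k) (j := i) ?_ ?_
          · simp [simpleRoot_apply, H.tau_ne hj hkX, H.tau_ne hi hkX, hk]
          · simp [simpleRoot_apply, hij, hγji]; omega
      · refine eq_zero_of_mixed hmem (i := j) (j := i) ?_ ?_
        · simp [simpleRoot_apply, hij.symm, hγjj]; omega
        · simp [simpleRoot_apply, hij, hγji]; omega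
  · refine (Submodule.mem_bot ℂ).2 ?_
    have hmem := H.comp_mem c hi (H.theta_f_mem j) p q
    have hinv := H.comp_eq_zero_of_inv c hi (H.theta_f_mem j) p q
    rw [weylAct_reverse H.gcm, h1, hτj] at hinv
    rw [h1, hτj, w_eq_add_gam, w_eq_add_gam] at hmem
    by_cases h0 : gam A l j = 0
    · have h0' : gam A l i = 0 := by
        have := H.gam_tau_eq_zero hj h0
        rwa [hτj] at this
      have hA1 := h.resolve_left (not_not.2 h0)
      rw [h0, h0', add_zero, add_zero] at hmem
      by_cases hq0 : q = 0
      · subst hq0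
        refine eq_zero_of_multiple (n := 1 - p) (i := i) ?_ (Or.inr (by omega))
        rwa [show simpleRoot i + (p : ℤ) • -simpleRoot i + ((0 : ℕ) : ℤ) • simpleRoot j =
          ((1 : ℤ) - p) • simpleRoot i by funext k; simp; ring] at hmem
      · by_cases hp1 : p = 1
        · subst hp1
          refine eq_zero_of_multiple (n := q) (i := j) ?_ (Or.inl (by omega))
          rwa [show simpleRoot i + ((1 : ℕ) : ℤ) • -simpleRoot i + (q : ℤ) • simpleRoot j =
            (q : ℤ) • simpleRoot j by funext k; simp] at hmem
        · refine eq_zero_of_mixed hmem (i := j) (j := i) ?_ ?_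
          · simp [simpleRoot_apply, hij.symm]; omega
          · simp [simpleRoot_apply, hij]; omega
    · obtain ⟨k, hkX, hk⟩ := H.exists_gam_pos hi (hγ h0)
      have hτk := H.tau_mem hkX
      by_cases hq0 : q = 0
      · subst hq0
        refine eq_zero_of_mixed hmem (i := k) (j := i) ?_ ?_
        · simp [simpleRoot_apply, H.tau_ne hi hkX, hk]
        · simp [simpleRoot_apply, hγii]; omega
      · refine hinv fun y hy => eq_zero_of_mixed hy (i := j) (j := τ k) ?_ ?_
        · simp [simpleRoot_apply, hij.symm, hpj]; omega
        · simp [simpleRoot_apply, H.tau_ne hi hτk, H.tau_ne hj hτk, permAct_tau]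
          exact mul_pos (by exact_mod_cast hp) hk

include hi in
-- The element is `[g_i, g_j]`, and its surviving components have the weights `γ_j` and `γ_i`,
-- nonzero, nonnegative and supported on `X`; so they lie in `𝔫_X⁺`.
theorem serre_of_tau_swap_zero_gam_ne {j : I} (h1 : τ i = j) (hA0 : A i j = 0)
    (h0 : gam A l j ≠ 0) :
    ((LieAlgebra.ad ℂ (Alg A) (H.gen c i)) ^ ((-A i j).toNat + 1)) (H.gen c j) ∈
      H.filt c ((-A i j).toNat + 1) := by
  have hj : j ∉ X := h1 ▸ H.tau_notMem hi
  have hτj : τ j = i := by rw [← h1, H.satake.invol]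
  have hγ : gam A l i ≠ 0 := fun h' => h0 (by
    have := H.gam_tau_eq_zero hi h'
    rwa [h1] at this)
  have hn : (-A i j).toNat = 0 := by rw [hA0]; rfl
  have hmemf : ∀ {m : I}, m ∉ X → gam A l m ≠ 0 → ∀ {x : Alg A}, x ∈ rootSpace A (gam A l m) →
      x ∈ H.filt c ((-A i j).toNat + 1) := fun hm hne x hx =>
    H.base_le_filt c _ (H.nPlus_le_base
      (mem_nPlus_of_rootSpace (fun k hk => H.gam_notMem _ hk) hne (H.gam_nonneg hm) hx))
  refine H.serre_mem_of_comp c hi (fun p q hpq hq _ => ?_) (fun _ p q hpq hp => ?_)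
  · obtain ⟨rfl, rfl⟩ : p = 0 ∧ q = 1 := by omega
    have hmem := H.comp_mem c hi (f_mem (A := A) j) 0 1
    rw [h1, w_eq_add_gam] at hmem
    refine hmemf hj h0 ?_
    rwa [show -simpleRoot j + ((0 : ℕ) : ℤ) • -simpleRoot i +
      ((1 : ℕ) : ℤ) • (simpleRoot j + gam A l j) = gam A l j by funext k; simp] at hmem
  · obtain ⟨rfl, rfl⟩ : p = 1 ∧ q = 0 := by omega
    have hmem := H.comp_mem c hi (H.theta_f_mem j) 1 0
    rw [hτj, w_eq_add_gam] at hmem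
    refine hmemf hi hγ ?_
    rwa [show simpleRoot i + gam A l i + ((1 : ℕ) : ℤ) • -simpleRoot i +
      ((0 : ℕ) : ℤ) • weylAct A l (simpleRoot (τ i)) = gam A l i by funext k; simp] at hmem

include hi in
-- Here `[g_i, g_j] = c_j h_i - c_i h_j`, while `θ` interchanges `h_i` and `-h_j`. The equality `c_i
-- = c_j` makes this element fixed by `θ`.
theorem serre_of_tau_swap_zero_gam_eq {j : I} (h1 : τ i = j) (hA0 : A i j = 0)
    (h0 : gam A l j = 0)
    (hc : ∀ j k : {i // i ∉ X}, (k : I) = τ j → A j k = 0 → adjComponent A X j = ∅ → c j = c k) :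
    ((LieAlgebra.ad ℂ (Alg A) (H.gen c i)) ^ ((-A i j).toNat + 1)) (H.gen c j) ∈
      H.filt c ((-A i j).toNat + 1) := by
  have hj : j ∉ X := h1 ▸ H.tau_notMem hi
  have hτj : τ j = i := by rw [← h1, H.satake.invol]
  have hn : (-A i j).toNat = 0 := by rw [hA0]; rfl
  have hisoj : ∀ k ∈ X, A k j = 0 := fun k hk => H.cartan_zero_of_gam_eq_zero hj hk h0
  have hisoi : ∀ k ∈ X, A k i = 0 := by
    have := H.tau_isolated hisoj
    rwa [hτj] at this
  have hθi := H.theta_f_of_isolated hi (by rwa [h1])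
  have hθj := H.theta_f_of_isolated hj (by rwa [hτj])
  have hhi := H.theta_h_of_isolated hi (by rwa [h1])
  have hhj := H.theta_h_of_isolated hj (by rwa [hτj])
  rw [h1] at hθi hhi
  rw [hτj] at hθj hhj
  have hcc : c ⟨i, hi⟩ = c ⟨j, hj⟩ := by
    refine hc ⟨i, hi⟩ ⟨j, hj⟩ h1.symm hA0 ?_
    refine Set.eq_empty_of_forall_notMem fun m hm => ?_
    -- No element of `X` is joined to `i`, so the empty set is admissible in the definition of
    -- `X(i)`.
    exact hm ∅ ⟨Set.empty_subset _, fun _ h => absurd h (Set.notMem_empty _)⟩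
      fun k hk hne => absurd (hisoi k hk) hne
  have hff : ⁅f A i, f A j⁆ = 0 := by simpa [hA0] using (rels A).serre_f i j
  have hee : ⁅e A j, e A i⁆ = 0 := by
    simpa [H.gcm.symm_zero hA0] using (rels A).serre_e j i
  have hY : ⁅H.gen c i, H.gen c j⁆ = (c ⟨i, hi⟩ : ℂ) • (h A i - h A j) := by
    rw [H.gen_of_notMem c hi, H.gen_of_notMem c hj, hθi, hθj, ← hcc]
    simp only [add_lie, lie_add, smul_lie, lie_smul, neg_lie, lie_neg, hff, hee, lie_f_e,
      (rels A).ef_same]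
    module
  rw [hn, zero_add, pow_one, LieAlgebra.ad_apply, hY]
  refine Submodule.smul_mem _ _ (H.base_le_filt c _ (H.fixed_le_base (H.mem_fixed.2
    ⟨sub_mem (h_mem_cartan A i) (h_mem_cartan A j), ?_⟩)))
  rw [map_sub, hhi, hhj]
  abel

include hi in
-- A direct computation gives `[g_i, [g_i, g_j]] = 2(c_i + c_j) g_i`, one letter instead of three.
theorem serre_of_tau_swap_neg_one {j : I} (hij : i ≠ j) (h1 : τ i = j) (hA1 : A i j = -1)
    (h0 : gam A l j = 0) :
    ((LieAlgebra.ad ℂ (Alg A) (H.gen c i)) ^ ((-A i j).toNat + 1)) (H.gen c j) ∈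
      H.filt c ((-A i j).toNat + 1) := by
  have hj : j ∉ X := h1 ▸ H.tau_notMem hi
  have hτj : τ j = i := by rw [← h1, H.satake.invol]
  have hn : (-A i j).toNat = 1 := by rw [hA1]; rfl
  have hA1' : A j i = -1 := by rw [← hA1, ← H.satake.diagramAut i j, h1, hτj]
  have hisoj : ∀ k ∈ X, A k j = 0 := fun k hk => H.cartan_zero_of_gam_eq_zero hj hk h0
  have hisoi : ∀ k ∈ X, A k i = 0 := by
    have := H.tau_isolated hisoj
    rwa [hτj] at this
  have hθi := H.theta_f_of_isolated hi (by rwa [h1])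
  have hθj := H.theta_f_of_isolated hj (by rwa [hτj])
  rw [h1] at hθi
  rw [hτj] at hθj
  obtain ⟨a, ha⟩ : ∃ a : ℂ, (c ⟨i, hi⟩ : ℂ) = a := ⟨_, rfl⟩
  obtain ⟨b, hb⟩ : ∃ b : ℂ, (c ⟨j, hj⟩ : ℂ) = b := ⟨_, rfl⟩
  have hgi : H.gen c i = f A i + a • -e A j := by rw [H.gen_of_notMem c hi, hθi, ha]
  have hgj : H.gen c j = f A j + b • -e A i := by rw [H.gen_of_notMem c hj, hθj, hb]
  have hfB : ⁅f A i, ⁅f A i, f A j⁆⁆ = 0 := by simpa [hA1] using (rels A).serre_f i j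
  have heC : ⁅e A j, ⁅e A j, e A i⁆⁆ = 0 := by simpa [hA1'] using (rels A).serre_e j i
  have hfh : ∀ a b, ⁅f A a, h A b⁆ = (A b a : ℂ) • f A a := fun a b => by
    rw [← lie_skew, (rels A).hf, neg_neg, Int.cast_smul_eq_zsmul]
  have heh : ∀ a b, ⁅e A a, h A b⁆ = -(A b a : ℂ) • e A a := fun a b => by
    rw [← lie_skew, (rels A).he, neg_smul, Int.cast_smul_eq_zsmul]
  have heB : ⁅e A j, ⁅f A i, f A j⁆⁆ = -f A i := by
    rw [leibniz_lie, (rels A).ef_ne j i hij.symm, (rels A).ef_same, zero_lie, hfh, hA1']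
    push_cast
    module
  have hfC : ⁅f A i, ⁅e A j, e A i⁆⁆ = -e A j := by
    rw [leibniz_lie, ← lie_skew (f A i) (e A j), (rels A).ef_ne j i hij.symm, lie_f_e, lie_neg,
      heh, hA1, neg_zero, zero_lie]
    push_cast
    module
  have hY : ⁅H.gen c i, ⁅H.gen c i, H.gen c j⁆⁆ = (2 * (a + b)) • H.gen c i := by
    rw [hgi, hgj]
    simp only [add_lie, lie_add, smul_lie, lie_smul, neg_lie, lie_neg, lie_f_e,
      (rels A).ef_same, hfB, heC, heB, hfC, hfh, heh, hA1, hA1', H.gcm.diag]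
    push_cast
    module
  rw [hn, pow_succ, pow_one, Module.End.mul_apply, LieAlgebra.ad_apply, LieAlgebra.ad_apply, hY]
  exact Submodule.smul_mem _ _ (H.filt_mono c (by omega) (H.gen_mem_filt c i))

theorem serreLower
    (hc : ∀ j k : {i // i ∉ X}, (k : I) = τ j → A j k = 0 → adjComponent A X j = ∅ → c j = c k) :
    H.SerreLower c := by
  intro i j hij
  by_cases hi : i ∈ X
  · rw [H.serre_of_mem c hi j]; exact zero_mem _
  by_cases h1 : τ i = i
  · by_cases hj : j ∈ X
    · exact H.serre_of_tau_fixed_mem c hi hj h1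
    · by_cases h0 : gam A l i = 0
      · exact H.serre_of_tau_fixed_gam_eq c hi hij hj h1 h0
      · rw [H.serre_of_tau_fixed_gam_ne c hi hij hj h1 h0]; exact zero_mem _
  by_cases h2 : τ i = j
  · by_cases hA0 : A i j = 0
    · by_cases h0 : gam A l j = 0
      · exact H.serre_of_tau_swap_zero_gam_eq c hi h2 hA0 h0 hc
      · exact H.serre_of_tau_swap_zero_gam_ne c hi h2 hA0 h0
    · by_cases h : gam A l j = 0 ∧ A i j = -1
      · exact H.serre_of_tau_swap_neg_one c hi hij h2 h.2 h.1
      · rw [H.serre_of_tau_swap_generic c hi hij h2 hA0 (by tauto)]; exact zero_mem _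
  · rw [H.serre_of_tau_generic c hi hij h1 h2]; exact zero_mem _

end SatakeDatum

end KacMoody

end

theorem mainTheorem3 {I : Type*} [Fintype I] [DecidableEq I]
    (A : Matrix I I ℤ) (hA : KacMoody.IsIndecSymmGCM A)
    (X : Finset I) (τ : Equiv.Perm I) (hXτ : KacMoody.IsGenSatake A X τ)
    (l : List I) (hl : KacMoody.IsLongestWord A X l)
    (c : {i // i ∉ X} → ℂˣ)
    (hc : ∀ j k : {i // i ∉ X}, (k : I) = τ j → A j k = 0 →
      KacMoody.adjComponent A X j = ∅ → c j = c k) :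
    (KacMoody.kc hXτ.diagramAut l X c : Set (KacMoody.Alg A)) ∩ KacMoody.cartan A =
      KacMoody.cartanFixed hXτ.diagramAut l :=
  have H : KacMoody.SatakeDatum A X τ l := ⟨hA, hXτ, hl⟩
  H.kc_inter_cartan (H.serreLower c hc)
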